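/- Let $n\ge 1$ and let $P_0=v\cdot\nabla_x-\Delta_v+\frac14|v|^2-\frac n2$ be the free Kramers–Fokker–Planck operator on $L^2(\mathbb R^{2n}_{x,v};\mathbb C)$ with its maximal domain $D(P_0)=\{u\in L^2:\ P_0u\in L^2\}$, where $P_0u$ is taken in the sense of distributions. The operator $-P_0$ generates a strongly continuous semigroup $(e^{-tP_0})_{t\ge0}$ on $L^2(\mathbb R^{2n})$. For $p\in[1,\infty]$ let $\mathcal L^p=L^p(\mathbb R^n_x;L^2(\mathbb R^n_v))$, and for $s\in\mathbb R$ let $\mathcal L^{2,s}=L^2(\mathbb R^{2n};\langle x\rangle^{2s}\,dx\,dv)$ with $\langle x\rangle=(1+|x|^2)^{1/2}$, each with its natural norm. (a) There is a constant $C>0$ such that for every $t\ge 3$ the operator $e^{-tP_0}$, restricted to $L^2(\mathbb R^{2n})\cap\mathcal L^1$ (which is dense in $\mathcal L^1$), extends to a bounded linear operator from $\mathcal L^1$ to $\mathcal L^\infty$, still denoted $e^{-tP_0}$, and $$\|e^{-tP_0}u\|_{\mathcal L^\infty}\le \frac{C}{t^{n/2}}\,\|u\|_{\mathcal L^1},\qquad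 t\ge 3,\ u\in\mathcal L^1 .$$ (b) For every $s>\frac n2$ there is a constant $C_s>0$ such that $$\|e^{-tP_0}u\|_{\mathcal L^{2,-s}}\le \frac{C_s}{t^{n/2}}\,\|u\|_{\mathcal L^{2,s}},\qquad t\ge 3,\ u\in\mathcal L^{2,s}\subset L^2(\mathbb R^{2n}).$$ -/

import Mathlib

open MeasureTheory Filter Topology
open scoped SchwartzMap ENNReal

noncomputable section

/-- Position space `ℝⁿ_x`, and likewise velocity space `ℝⁿ_v`, with the Euclidean norm. -/
abbrev KSpace (n : ℕ) : Type := EuclideanSpace ℝ (Fin n)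

/-- `L²(ℝ²ⁿ_{x,v}; ℂ)`; a point of phase space is a pair `(x, v)`. -/
abbrev PhaseL2 (n : ℕ) : Type := Lp ℂ 2 (volume : Measure (KSpace n × KSpace n))

/-- The formal transpose, for the bilinear pairing `∫ u φ dx dv`, of
`P₀ = v·∇ₓ - Δᵥ + |v|²/4 - n/2`, namely `-v·∇ₓ - Δᵥ + |v|²/4 - n/2`,
applied to a Schwartz function. -/
def freeKFPTranspose {n : ℕ} (φ : 𝓢(KSpace n × KSpace n, ℂ)) (z : KSpace n × KSpace n) : ℂ :=
  -(fderiv ℝ (fun y => φ y) z (z.2, 0))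
    - Laplacian.laplacian (fun w : KSpace n => φ (z.1, w)) z.2
    + ((‖z.2‖ ^ 2 / 4 - (n : ℝ) / 2 : ℝ) : ℂ) * φ z

/-- The graph of the free Kramers-Fokker-Planck operator `P₀` in `L²` with its maximal domain
`D(P₀) = {u ∈ L² : P₀ u ∈ L²}`: the pair `(u, f)` belongs to it when `f ∈ L²` and `P₀ u = f`
in the sense of (tempered) distributions. -/
def IsFreeKFP {n : ℕ} (u f : PhaseL2 n) : Prop :=
  ∀ φ : 𝓢(KSpace n × KSpace n, ℂ),
    ∫ z, u z * freeKFPTranspose φ z = ∫ z, f z * φ z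

/-- `S` is the strongly continuous semigroup `t ↦ e^{-tP₀}`, `t ≥ 0`, on `L²`: its infinitesimal
generator is exactly `-P₀`, domain included.  (A strongly continuous semigroup is determined on
`[0, ∞)` by its generator; the values of `S` at negative times play no role.) -/
structure IsFreeKFPSemigroup {n : ℕ} (S : ℝ → PhaseL2 n →L[ℂ] PhaseL2 n) : Prop where
  map_zero : S 0 = ContinuousLinearMap.id ℂ (PhaseL2 n)
  map_add : ∀ s t : ℝ, 0 ≤ s → 0 ≤ t → S (s + t) = (S s).comp (S t)
  tendsto_zero : ∀ u : PhaseL2 n, Tendsto (fun t => S t u) (𝓝[>] 0) (𝓝 u)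
  generator : ∀ u f : PhaseL2 n,
    Tendsto (fun t : ℝ => t⁻¹ • (S t u - u)) (𝓝[>] 0) (𝓝 (-f)) ↔ IsFreeKFP u f

/-- The space `𝓛ᵖ = Lᵖ(ℝⁿ_x; L²(ℝⁿ_v))` with its natural norm. -/
abbrev MixedLp (n : ℕ) (p : ℝ≥0∞) : Type :=
  Lp (Lp ℂ 2 (volume : Measure (KSpace n))) p (volume : Measure (KSpace n))

/-- `U ∈ 𝓛ᵖ` and `u ∈ L²(ℝ²ⁿ)` are the same function of `(x, v)` (almost everywhere). -/
def SameFunction {n : ℕ} {p : ℝ≥0∞} (U : MixedLp n p) (u : PhaseL2 n) : Prop :=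
  ∀ᵐ x : KSpace n, ∀ᵐ v : KSpace n, U x v = u (x, v)

/-- The measure `⟨x⟩^{2s} dx dv` on phase space, with `⟨x⟩ = (1 + |x|²)^{1/2}`; the weighted space
`𝓛^{2,s}` is the `L²` space of this measure. -/
def weightedMeasure (n : ℕ) (s : ℝ) : Measure (KSpace n × KSpace n) :=
  volume.withDensity fun z => ENNReal.ofReal (Real.sqrt (1 + ‖z.1‖ ^ 2) ^ (2 * s))

end

noncomputable section

/-! ### The Schur test -/

section Schur

variable {α : Type*} [MeasurableSpace α] {μ : Measure α}

/-! The semigroup has an explicit Gaussian kernel. With `τ = tanh (t/2)` and `σ = 2t - 4τ` it is the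
Mehler kernel of the velocity oscillator times a heat kernel of variance `σ` in the displacement `x
- y - τ (v + w)`. Both decay estimates follow from this product form. The heat factor is at most
`(2πσ)^(-n/2)`, which is at most `t^(-n/2)` once `t ≥ 3`, and the Mehler factor is a contraction of
`L²` in velocity. For (a) the kernel at fixed displacement is an operator on `L²(ℝⁿ_v)` of norm at
most the heat maximum, and integrating it over the position variable maps `𝓛¹` to `𝓛^∞` (`mixedOp`).
For (b) Cauchy-Schwarz in position is applied on both sides, with `⟨x⟩^(-2s)` integrable for `s >
n/2` (`weighted_decay`).

Most of the work is to show that this kernel does define the semigroup generated by `-P₀` on its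
maximal domain. Boundedness is a Schur test whose weight is the ground state `exp (-|v|²/4)`, which
the kernel preserves exactly (`schurBound_kfpKernel`). The semigroup law is Gaussian integration
together with the addition law of `tanh` (`lintegral_kfpKernel_mul_kfpKernel`). Division by the
ground state turns the kernel into the transition law of a Langevin process, which gives strong
continuity (`tendsto_inner_kfpSemigroup`).

The generator is found by duality, without a core argument. As a function of one variable the kernel
is a Schwartz function solving the transposed equation, so it is an admissible test function. If `P₀
u = f` weakly, testing against kernels gives `S b u - u = -∫₀ᵇ S r f dr`
(`kfpSemigroup_sub_eq_integral`), and `u` lies in the domain of the generator. Conversely, Schwartz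
functions lie in the domain of the transposed semigroup by the same result, and pairing with them
recovers the weak equation (`isFreeKFP_of_tendsto`). The sign `ε = ±1` of the transport term is
carried throughout so that the transpose is treated along with the semigroup. -/

theorem sq_lintegral_mul_le {k f p : α → ℝ≥0∞} (hk : Measurable k) (hf : AEMeasurable f μ)
    (hp : Measurable p) (hp0 : ∀ z, p z ≠ 0) (hpt : ∀ z, p z ≠ ∞) :
    (∫⁻ z, k z * f z ∂μ) ^ 2 ≤ (∫⁻ z, k z * p z ∂μ) * ∫⁻ z, k z * (f z ^ 2 / p z) ∂μ := by
  -- Cauchy-Schwarz for the splitting `k f = (k p)^(1/2) (k f² / p)^(1/2)`.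
  have h := ENNReal.lintegral_mul_le_Lp_mul_Lq μ (p := 2) (q := 2)
    (by constructor <;> norm_num)
    (f := fun z => (k z * p z) ^ (1 / 2 : ℝ)) (g := fun z => (k z * (f z ^ 2 / p z)) ^ (1 / 2 : ℝ))
    ((hk.mul hp).pow_const _).aemeasurable
    (show AEMeasurable (fun z => (k z * (f z ^ 2 / p z)) ^ (1 / 2 : ℝ)) μ from
      AEMeasurable.pow_const (hk.aemeasurable.mul ((hf.pow_const 2).div hp.aemeasurable)) _)
  have e1 : ∀ z, ((fun z => (k z * p z) ^ (1 / 2 : ℝ)) *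
      (fun z => (k z * (f z ^ 2 / p z)) ^ (1 / 2 : ℝ))) z = k z * f z := by
    intro z
    simp only [Pi.mul_apply]
    rw [← ENNReal.mul_rpow_of_nonneg _ _ (by norm_num)]
    have : k z * p z * (k z * (f z ^ 2 / p z)) = (k z * f z) ^ 2 := by
      rw [show k z * p z * (k z * (f z ^ 2 / p z)) = k z * k z * (p z * (f z ^ 2 / p z)) by ring,
        ENNReal.mul_div_cancel (hp0 z) (hpt z)]
      ring
    rw [this, ← ENNReal.rpow_natCast, ← ENNReal.rpow_mul]
    norm_num
  have e2 : ∀ a : ℝ≥0∞, (a ^ (1 / 2 : ℝ)) ^ (2 : ℝ) = a := by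
    intro a
    rw [← ENNReal.rpow_mul]
    norm_num
  simp only [e1, e2] at h
  calc _ ≤ _ := pow_le_pow_left' h 2
    _ = _ := by
      rw [mul_pow, ← ENNReal.rpow_natCast, ← ENNReal.rpow_natCast, ← ENNReal.rpow_mul,
        ← ENNReal.rpow_mul]
      norm_num

theorem eLpNorm_two_eq {E : Type*} [NormedAddCommGroup E] (f : α → E) :
    eLpNorm f 2 μ = (∫⁻ z, ‖f z‖ₑ ^ 2 ∂μ) ^ (1 / 2 : ℝ) := by
  rw [eLpNorm_eq_lintegral_rpow_enorm_toReal (by norm_num) (by norm_num)]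
  simp

theorem enorm_integral_ofReal_mul_le (k : α → ℝ) (u : α → ℂ) :
    ‖∫ z, (k z : ℂ) * u z ∂μ‖ₑ ≤ ∫⁻ z, ‖k z‖ₑ * ‖u z‖ₑ ∂μ := by
  refine (enorm_integral_le_lintegral_enorm _).trans_eq ?_
  refine lintegral_congr fun z' => ?_
  rw [enorm_mul, show ‖(k z' : ℂ)‖ₑ = ‖k z'‖ₑ by
    simp [enorm_eq_nnnorm]]

/-- The hypotheses of the Schur test for the kernel `k` with the weight `p` and the constant `A`. -/
structure SchurBound (μ : Measure α) (k : α → α → ℝ) (p : α → ℝ≥0∞) (A : NNReal) : Prop where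
  measurable_kernel : Measurable (Function.uncurry k)
  measurable_weight : Measurable p
  weight_ne_zero : ∀ z, p z ≠ 0
  weight_ne_top : ∀ z, p z ≠ ∞
  lintegral_right : ∀ z, ∫⁻ z', ‖k z z'‖ₑ * p z' ∂μ ≤ A * p z
  lintegral_left : ∀ z', ∫⁻ z, ‖k z z'‖ₑ * p z ∂μ ≤ A * p z'

variable {k : α → α → ℝ} {p : α → ℝ≥0∞} {A : NNReal} [SFinite μ]

/-- Weighted Cauchy-Schwarz in `z'` spends the row bound; after Tonelli the remaining integral in
`z` is the column bound. Each contributes one factor `A`. -/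
theorem SchurBound.lintegral_sq_le (h : SchurBound μ k p A) {f : α → ℝ≥0∞}
    (hf : AEMeasurable f μ) :
    ∫⁻ z, (∫⁻ z', ‖k z z'‖ₑ * f z' ∂μ) ^ 2 ∂μ ≤ (A : ℝ≥0∞) ^ 2 * ∫⁻ z, f z ^ 2 ∂μ := by
  have hkm : Measurable fun z : α × α => ‖k z.1 z.2‖ₑ := h.measurable_kernel.enorm
  have hswap : ∫⁻ z, ∫⁻ z', p z * (‖k z z'‖ₑ * (f z' ^ 2 / p z')) ∂μ ∂μ =
      ∫⁻ z', ∫⁻ z, p z * (‖k z z'‖ₑ * (f z' ^ 2 / p z')) ∂μ ∂μ := by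
    apply lintegral_lintegral_swap
    refine (h.measurable_weight.comp measurable_fst).aemeasurable.mul (hkm.aemeasurable.mul ?_)
    exact ((hf.pow_const 2).div h.measurable_weight.aemeasurable).comp_snd
  have hkl : ∀ z, Measurable fun z' => ‖k z z'‖ₑ := fun z =>
    hkm.comp (measurable_const.prodMk measurable_id)
  have hkr : ∀ z', Measurable fun z => ‖k z z'‖ₑ := fun z =>
    hkm.comp (measurable_id.prodMk measurable_const)
  calc ∫⁻ z, (∫⁻ z', ‖k z z'‖ₑ * f z' ∂μ) ^ 2 ∂μ
      ≤ ∫⁻ z, A * ∫⁻ z', p z * (‖k z z'‖ₑ * (f z' ^ 2 / p z')) ∂μ ∂μ := by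
        refine lintegral_mono fun z => ?_
        refine (sq_lintegral_mul_le (hkl z) hf h.measurable_weight h.weight_ne_zero
          h.weight_ne_top).trans ?_
        rw [lintegral_const_mul' _ _ (h.weight_ne_top z), ← mul_assoc]
        exact mul_le_mul_left (h.lintegral_right z) _
    _ = A * ∫⁻ z', ∫⁻ z, p z * (‖k z z'‖ₑ * (f z' ^ 2 / p z')) ∂μ ∂μ := by
        rw [lintegral_const_mul' _ _ ENNReal.coe_ne_top, hswap]
    _ ≤ A * ∫⁻ z', A * f z' ^ 2 ∂μ := by
        refine mul_le_mul_right (lintegral_mono fun z' => ?_) _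
        calc ∫⁻ z, p z * (‖k z z'‖ₑ * (f z' ^ 2 / p z')) ∂μ
            = ∫⁻ z, (‖k z z'‖ₑ * p z) * (f z' ^ 2 / p z') ∂μ := by
              refine lintegral_congr fun z => ?_
              ring
          _ = (∫⁻ z, ‖k z z'‖ₑ * p z ∂μ) * (f z' ^ 2 / p z') :=
              lintegral_mul_const _ ((hkr z').mul h.measurable_weight)
          _ ≤ A * p z' * (f z' ^ 2 / p z') := mul_le_mul_left (h.lintegral_left z') _
          _ = A * f z' ^ 2 := by
              rw [mul_assoc, ENNReal.mul_div_cancel (h.weight_ne_zero z') (h.weight_ne_top z')]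
    _ = _ := by
        rw [lintegral_const_mul' _ _ ENNReal.coe_ne_top]
        ring

theorem SchurBound.rpow_lintegral_sq_le (h : SchurBound μ k p A) {u : α → ℂ}
    (hu : AEStronglyMeasurable u μ) :
    (∫⁻ z, (∫⁻ z', ‖k z z'‖ₑ * ‖u z'‖ₑ ∂μ) ^ 2 ∂μ) ^ (1 / 2 : ℝ) ≤ A * eLpNorm u 2 μ := by
  rw [eLpNorm_two_eq]
  refine (ENNReal.rpow_le_rpow (h.lintegral_sq_le hu.enorm) (by norm_num)).trans_eq ?_
  rw [ENNReal.mul_rpow_of_nonneg _ _ (by norm_num), ← ENNReal.rpow_natCast, ← ENNReal.rpow_mul]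
  norm_num

theorem SchurBound.measurable_lintegral (h : SchurBound μ k p A) {u : α → ℂ}
    (hu : AEStronglyMeasurable u μ) :
    AEMeasurable (fun z => ∫⁻ z', ‖k z z'‖ₑ * ‖u z'‖ₑ ∂μ) μ := by
  have : AEMeasurable (fun z : α × α => ‖k z.1 z.2‖ₑ * ‖u z.2‖ₑ) (μ.prod μ) :=
    h.measurable_kernel.enorm.aemeasurable.mul hu.comp_snd.enorm
  exact this.lintegral_prod_right'

theorem SchurBound.ae_integrable (h : SchurBound μ k p A) {u : α → ℂ} (hu : MemLp u 2 μ) :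
    ∀ᵐ z ∂μ, Integrable (fun z' => (k z z' : ℂ) * u z') μ := by
  have h1 := h.rpow_lintegral_sq_le hu.1
  have h2 : ∫⁻ z, (∫⁻ z', ‖k z z'‖ₑ * ‖u z'‖ₑ ∂μ) ^ 2 ∂μ ≠ ∞ := by
    intro h3
    rw [h3, ENNReal.top_rpow_of_pos (by norm_num)] at h1
    exact (ENNReal.mul_lt_top ENNReal.coe_lt_top hu.2).ne (top_le_iff.mp h1)
  filter_upwards [ae_lt_top' ((h.measurable_lintegral hu.1).pow_const 2) h2] with z hz
  have hkz : Measurable fun z' => k z z' :=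
    h.measurable_kernel.comp (measurable_const.prodMk measurable_id)
  refine ⟨(Complex.measurable_ofReal.comp hkz).aestronglyMeasurable.mul hu.1, ?_⟩
  rw [HasFiniteIntegral]
  have : (∫⁻ z', ‖k z z'‖ₑ * ‖u z'‖ₑ ∂μ) ≠ ∞ := by
    intro h4
    simp [h4] at hz
  refine lt_of_le_of_lt (le_of_eq ?_) this.lt_top
  refine lintegral_congr fun z' => ?_
  rw [enorm_mul, show ‖(k z z' : ℂ)‖ₑ = ‖k z z'‖ₑ by
    simp [enorm_eq_nnnorm]]

theorem SchurBound.aestronglyMeasurable (h : SchurBound μ k p A) {u : α → ℂ}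
    (hu : AEStronglyMeasurable u μ) :
    AEStronglyMeasurable (fun z => ∫ z', (k z z' : ℂ) * u z' ∂μ) μ := by
  have : AEStronglyMeasurable (fun z : α × α => (k z.1 z.2 : ℂ) * u z.2) (μ.prod μ) :=
    (Complex.measurable_ofReal.comp h.measurable_kernel).aestronglyMeasurable.mul hu.comp_snd
  exact this.integral_prod_right'

theorem SchurBound.eLpNorm_le (h : SchurBound μ k p A) {u : α → ℂ}
    (hu : AEStronglyMeasurable u μ) :
    eLpNorm (fun z => ∫ z', (k z z' : ℂ) * u z' ∂μ) 2 μ ≤ A * eLpNorm u 2 μ := by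
  refine le_trans ?_ (h.rpow_lintegral_sq_le hu)
  rw [eLpNorm_two_eq]
  refine ENNReal.rpow_le_rpow (lintegral_mono fun z => ?_) (by norm_num)
  exact pow_le_pow_left' (enorm_integral_ofReal_mul_le _ _) 2

theorem SchurBound.memLp (h : SchurBound μ k p A) {u : α → ℂ} (hu : MemLp u 2 μ) :
    MemLp (fun z => ∫ z', (k z z' : ℂ) * u z' ∂μ) 2 μ :=
  ⟨h.aestronglyMeasurable hu.1,
    (h.eLpNorm_le hu.1).trans_lt (ENNReal.mul_lt_top ENNReal.coe_lt_top hu.2)⟩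

/-- The bounded operator on `L²` with a kernel that satisfies the Schur test. -/
def SchurBound.op (h : SchurBound μ k p A) : Lp ℂ 2 μ →L[ℂ] Lp ℂ 2 μ :=
  LinearMap.mkContinuous
    { toFun := fun u => (h.memLp (Lp.memLp u)).toLp
      map_add' := by
        intro u v
        rw [← MemLp.toLp_add]
        apply MemLp.toLp_congr
        filter_upwards [h.ae_integrable (Lp.memLp u), h.ae_integrable (Lp.memLp v)] with z hz hz'
        rw [Pi.add_apply, ← integral_add hz hz']
        apply integral_congr_ae
        filter_upwards [Lp.coeFn_add u v] with z' h'
        rw [h', Pi.add_apply, mul_add]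
      map_smul' := by
        intro c u
        rw [RingHom.id_apply, ← MemLp.toLp_const_smul]
        apply MemLp.toLp_congr
        refine Eventually.of_forall fun z => ?_
        simp only [Pi.smul_apply]
        rw [← integral_smul]
        apply integral_congr_ae
        filter_upwards [Lp.coeFn_smul c u] with z' h'
        rw [h', Pi.smul_apply, smul_eq_mul, smul_eq_mul]
        ring } A (by
    intro u
    simp only [LinearMap.coe_mk, AddHom.coe_mk]
    rw [Lp.norm_toLp, Lp.norm_def]
    have := h.eLpNorm_le (Lp.memLp u).1
    refine (ENNReal.toReal_mono
      (ENNReal.mul_lt_top ENNReal.coe_lt_top (Lp.memLp u).2).ne this).trans_eq ?_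
    simp)

theorem SchurBound.op_apply_ae (h : SchurBound μ k p A) (u : Lp ℂ 2 μ) :
    h.op u =ᵐ[μ] fun z => ∫ z', (k z z' : ℂ) * u z' ∂μ :=
  (h.memLp (Lp.memLp u)).coeFn_toLp

theorem SchurBound.norm_op_le (h : SchurBound μ k p A) : ‖h.op‖ ≤ A :=
  LinearMap.mkContinuous_norm_le _ A.2 _

end Schur

/-! ### Exponentials of coercive functions are Schwartz functions -/

section GaussianSchwartz

variable {E : Type*} [NormedAddCommGroup E] [NormedSpace ℝ E]

theorem exists_pow_mul_exp_neg_sq_le (δ : ℝ) (hδ : 0 < δ) (N : ℕ) :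
    ∃ C : ℝ, ∀ r : ℝ, 0 ≤ r → (1 + r) ^ N * Real.exp (-(δ * r ^ 2)) ≤ C := by
  -- From `(1 + r)^N ≤ N! exp (1 + r)` and `r - δ r² ≤ 1 / (4δ)`.
  refine ⟨N.factorial * Real.exp (1 + 1 / (4 * δ)), fun r hr => ?_⟩
  have h1 : (1 + r) ^ N ≤ N.factorial * Real.exp (1 + r) := by
    have := Real.pow_div_factorial_le_exp (1 + r) (by linarith) N
    rwa [div_le_iff₀ (by positivity), mul_comm] at this
  have h2 : 1 + r + -(δ * r ^ 2) ≤ 1 + 1 / (4 * δ) := by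
    have : 0 ≤ δ * (r - 1 / (2 * δ)) ^ 2 := by positivity
    have e : δ * (r - 1 / (2 * δ)) ^ 2 = δ * r ^ 2 - r + 1 / (4 * δ) := by
      field_simp
      ring
    linarith
  calc _ ≤ N.factorial * Real.exp (1 + r) * Real.exp (-(δ * r ^ 2)) := by gcongr
    _ = N.factorial * Real.exp (1 + r + -(δ * r ^ 2)) := by rw [Real.exp_add (1 + r)]; ring
    _ ≤ _ := by gcongr

/-- Every derivative of `exp` at `-q z` is `exp (-q z)`, so the Faà di Bruno bound leaves that
factor times a polynomial in `‖z‖`, which the coercivity of `q` absorbs. -/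
theorem schwartz_decay_exp_neg {q : E → ℝ} (hq : q.HasTemperateGrowth) {δ c : ℝ} (hδ : 0 < δ)
    (hc : ∀ z, δ * ‖z‖ ^ 2 - c ≤ q z) (k m : ℕ) :
    ∃ C : ℝ, ∀ z, ‖z‖ ^ k * ‖iteratedFDeriv ℝ m (fun z => Real.exp (-q z)) z‖ ≤ C := by
  obtain ⟨a, B, hB, hb⟩ := hq.norm_iteratedFDeriv_le_uniform m
  obtain ⟨C, hC⟩ := exists_pow_mul_exp_neg_sq_le δ hδ (k + a * m)
  have key : ∀ z, ‖iteratedFDeriv ℝ m (fun z => Real.exp (-q z)) z‖ ≤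
      m.factorial * Real.exp (-q z) * ((B + 1) * (1 + ‖z‖) ^ a) ^ m := by
    intro z
    refine norm_iteratedFDeriv_comp_le (g := Real.exp) (f := fun z => -q z) (N := (m : WithTop ℕ∞))
      Real.contDiff_exp (hq.1.neg.of_le (by exact_mod_cast le_top)) le_rfl z ?_ ?_
    · intro i _
      rw [norm_iteratedFDeriv_eq_norm_iteratedDeriv, iteratedDeriv_eq_iterate,
        Real.iter_deriv_exp, Real.norm_of_nonneg (Real.exp_pos _).le]
    · intro i hi him
      rw [show (fun z => -q z) = -q from rfl, iteratedFDeriv_neg_apply, norm_neg]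
      -- `B + 1` in place of `B` makes the base at least `1`, so that it is bounded by its own
      -- `i`-th power, as the composition estimate requires.
      have h1 : (1 : ℝ) ≤ (B + 1) * (1 + ‖z‖) ^ a := by
        have : (1 : ℝ) ≤ (1 + ‖z‖) ^ a := one_le_pow₀ (by linarith [norm_nonneg z])
        nlinarith
      calc _ ≤ _ := hb i him z
        _ ≤ (B + 1) * (1 + ‖z‖) ^ a := by gcongr; linarith
        _ ≤ _ := le_self_pow₀ h1 (by omega)
  refine ⟨m.factorial * (B + 1) ^ m * Real.exp c * C, fun z => ?_⟩
  have h0 : Real.exp (-q z) ≤ Real.exp c * Real.exp (-(δ * ‖z‖ ^ 2)) := by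
    rw [← Real.exp_add]
    exact Real.exp_le_exp.mpr (by linarith [hc z])
  have hC0 := hC ‖z‖ (norm_nonneg _)
  calc _ ≤ (1 + ‖z‖) ^ k * (m.factorial * (Real.exp c * Real.exp (-(δ * ‖z‖ ^ 2))) *
        ((B + 1) * (1 + ‖z‖) ^ a) ^ m) := by
        refine mul_le_mul (by gcongr; linarith) ((key z).trans (by gcongr)) (norm_nonneg _)
          (by positivity)
    _ = m.factorial * (B + 1) ^ m * Real.exp c *
        ((1 + ‖z‖) ^ (k + a * m) * Real.exp (-(δ * ‖z‖ ^ 2))) := by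
        rw [mul_pow, ← pow_mul, pow_add]
        ring
    _ ≤ _ := by gcongr

/-- The Schwartz function `A exp (-q)`, for a function `q` of temperate growth that is bounded
below by a positive multiple of `‖z‖²`, up to a constant. -/
def expNegSchwartz (A : ℝ) (q : E → ℝ) (hq : q.HasTemperateGrowth) {δ c : ℝ} (hδ : 0 < δ)
    (hc : ∀ z, δ * ‖z‖ ^ 2 - c ≤ q z) : 𝓢(E, ℝ) :=
  A • { toFun := fun z => Real.exp (-q z)
        smooth' := Real.contDiff_exp.comp hq.1.neg
        decay' := schwartz_decay_exp_neg hq hδ hc }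

theorem expNegSchwartz_apply (A : ℝ) (q : E → ℝ) (hq : q.HasTemperateGrowth) {δ c : ℝ} (hδ : 0 < δ)
    (hc : ∀ z, δ * ‖z‖ ^ 2 - c ≤ q z) (z : E) :
    expNegSchwartz A q hq hδ hc z = A * Real.exp (-q z) := rfl

end GaussianSchwartz

/-! ### The heat kernel in position and the Mehler kernel in velocity -/

section Kernels

variable {n : ℕ}

theorem mul_exp_mul_mul_exp (p x q y : ℝ) :
    p * Real.exp x * (q * Real.exp y) = p * q * Real.exp (x + y) := by
  rw [Real.exp_add]
  ring

/-- The centred Gaussian density on `ℝⁿ` with covariance `s` times the identity. -/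
def heatKernel (s : ℝ) (x : KSpace n) : ℝ :=
  (2 * Real.pi * s) ^ (-((n : ℝ) / 2)) * Real.exp (-(‖x‖ ^ 2 / (2 * s)))

/-- The Mehler kernel of `exp (-t (-Δ + |v|²/4 - n/2))`, with `τ = tanh (t/2)`. -/
def mehlerKernel (τ : ℝ) (v w : KSpace n) : ℝ :=
  (8 * Real.pi * τ / (1 + τ) ^ 2) ^ (-((n : ℝ) / 2)) *
    Real.exp (-(τ * ‖v + w‖ ^ 2 / 8 + ‖v - w‖ ^ 2 / (8 * τ)))

/-- The ground state `exp (-|v|²/4)` of the harmonic oscillator `-Δ + |v|²/4 - n/2`. -/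
def groundState (v : KSpace n) : ℝ := Real.exp (-(‖v‖ ^ 2 / 4))

theorem groundState_pos (v : KSpace n) : 0 < groundState v := Real.exp_pos _

theorem continuous_groundState : Continuous (groundState : KSpace n → ℝ) := by
  unfold groundState; fun_prop

theorem heatKernel_pos {s : ℝ} (hs : 0 < s) (x : KSpace n) : 0 < heatKernel s x := by
  unfold heatKernel; positivity

theorem mehlerKernel_pos {τ : ℝ} (hτ : 0 < τ) (v w : KSpace n) : 0 < mehlerKernel τ v w := by
  unfold mehlerKernel; positivity

theorem mehlerKernel_comm (τ : ℝ) (v w : KSpace n) : mehlerKernel τ v w = mehlerKernel τ w v := by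
  unfold mehlerKernel
  rw [add_comm v w, norm_sub_rev v w]

theorem continuous_heatKernel (s : ℝ) : Continuous (heatKernel s : KSpace n → ℝ) := by
  unfold heatKernel; fun_prop

theorem heatKernel_neg (s : ℝ) (x : KSpace n) : heatKernel s (-x) = heatKernel s x := by
  simp [heatKernel]

theorem continuous_mehlerKernel (τ : ℝ) :
    Continuous fun z : KSpace n × KSpace n => mehlerKernel τ z.1 z.2 := by
  unfold mehlerKernel; fun_prop

theorem integral_heatKernel {s : ℝ} (hs : 0 < s) : ∫ x : KSpace n, heatKernel s x = 1 := by
  unfold heatKernel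
  have h := GaussianFourier.integral_rexp_neg_mul_sq_norm (V := KSpace n) (b := 1 / (2 * s))
    (by positivity)
  have e : ∀ x : KSpace n, Real.exp (-(‖x‖ ^ 2 / (2 * s))) =
      Real.exp (-(1 / (2 * s)) * ‖x‖ ^ 2) := by
    intro x
    congr 1
    ring
  simp_rw [e]
  rw [integral_const_mul, h, finrank_euclideanSpace_fin, Real.rpow_neg (by positivity),
    show Real.pi / (1 / (2 * s)) = 2 * Real.pi * s by field_simp]
  exact inv_mul_cancel₀ (by positivity)

theorem integrable_heatKernel {s : ℝ} (hs : 0 < s) :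
    Integrable (heatKernel s : KSpace n → ℝ) :=
  Integrable.of_integral_ne_zero (by rw [integral_heatKernel hs]; exact one_ne_zero)

theorem lintegral_heatKernel {s : ℝ} (hs : 0 < s) :
    ∫⁻ x : KSpace n, ‖heatKernel s x‖ₑ = 1 := by
  have h := ofReal_integral_eq_lintegral_ofReal (integrable_heatKernel (n := n) hs)
    (Eventually.of_forall fun x => (heatKernel_pos hs x).le)
  rw [integral_heatKernel hs, ENNReal.ofReal_one] at h
  rw [h]
  exact lintegral_congr fun x => Real.enorm_of_nonneg (heatKernel_pos hs x).le

theorem lintegral_heatKernel_sub_right {s : ℝ} (hs : 0 < s) (m : KSpace n) :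
    ∫⁻ x, ‖heatKernel s (x - m)‖ₑ = 1 := by
  rw [lintegral_sub_right_eq_self (fun x => ‖heatKernel s x‖ₑ) m, lintegral_heatKernel hs]

theorem lintegral_heatKernel_sub_left {s : ℝ} (hs : 0 < s) (m : KSpace n) :
    ∫⁻ x, ‖heatKernel s (m - x)‖ₑ = 1 := by
  rw [lintegral_sub_left_eq_self (fun x => ‖heatKernel s x‖ₑ) m, lintegral_heatKernel hs]

/-- Completing the square in `y`: given the end points, the midpoint is Gaussian, and its density
integrates to `1`. -/
theorem heatKernel_mul_heatKernel {s r : ℝ} (hs : 0 < s) (hr : 0 < r) (x y c : KSpace n) :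
    heatKernel s (x - y) * heatKernel r (y - c) =
      heatKernel (s + r) (x - c) *
        heatKernel (s * r / (s + r)) (y - ((r / (s + r)) • x + (s / (s + r)) • c)) := by
  unfold heatKernel
  have hsr : 0 < s + r := by positivity
  rw [mul_exp_mul_mul_exp, mul_exp_mul_mul_exp,
    ← Real.mul_rpow (by positivity) (by positivity), ← Real.mul_rpow (by positivity) (by positivity)]
  congr 2
  · field_simp
  · rw [← neg_add, ← neg_add]
    congr 1
    simp only [EuclideanSpace.real_norm_sq_eq, Finset.sum_div, ← Finset.sum_add_distrib]
    refine Finset.sum_congr rfl fun i _ => ?_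
    simp only [PiLp.sub_apply, PiLp.add_apply, PiLp.smul_apply, smul_eq_mul]
    field_simp
    ring

theorem lintegral_heatKernel_mul_heatKernel {s r : ℝ} (hs : 0 < s) (hr : 0 < r) (x c : KSpace n) :
    ∫⁻ y, ‖heatKernel s (x - y) * heatKernel r (y - c)‖ₑ = ‖heatKernel (s + r) (x - c)‖ₑ := by
  simp_rw [heatKernel_mul_heatKernel hs hr, enorm_mul]
  rw [lintegral_const_mul' _ _ enorm_ne_top, lintegral_heatKernel_sub_right (by positivity), mul_one]

/-- The ground state transform. For `τ = tanh (t/2)` the Gaussian on the right is the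
Ornstein-Uhlenbeck transition density, with mean `exp (-t) v` and variance `1 - exp (-2t)`. -/
theorem mehlerKernel_mul_groundState {τ : ℝ} (hτ : 0 < τ) (v w : KSpace n) :
    mehlerKernel τ v w * groundState w =
      groundState v * heatKernel (4 * τ / (1 + τ) ^ 2) (w - ((1 - τ) / (1 + τ)) • v) := by
  unfold mehlerKernel groundState heatKernel
  rw [mul_left_comm, mul_assoc, ← Real.exp_add, ← Real.exp_add]
  congr 2
  · ring
  · rw [← neg_add, ← neg_add]
    congr 1
    simp only [EuclideanSpace.real_norm_sq_eq, Finset.sum_div, ← Finset.sum_add_distrib,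
      Finset.mul_sum]
    refine Finset.sum_congr rfl fun i _ => ?_
    simp only [PiLp.sub_apply, PiLp.add_apply, PiLp.smul_apply, smul_eq_mul]
    have : 0 < 1 + τ := by positivity
    field_simp
    ring

theorem lintegral_mehlerKernel_mul_groundState {τ : ℝ} (hτ : 0 < τ) (v : KSpace n) :
    ∫⁻ w, ‖mehlerKernel τ v w‖ₑ * ‖groundState w‖ₑ = ‖groundState v‖ₑ := by
  simp_rw [← enorm_mul, mehlerKernel_mul_groundState hτ, enorm_mul]
  rw [lintegral_const_mul' _ _ enorm_ne_top, lintegral_heatKernel_sub_right (by positivity), mul_one]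

theorem schurBound_mehlerKernel {τ : ℝ} (hτ : 0 < τ) :
    SchurBound (volume : Measure (KSpace n)) (mehlerKernel τ) (fun v => ‖groundState v‖ₑ) 1 where
  measurable_kernel := (continuous_mehlerKernel τ).measurable
  measurable_weight := continuous_groundState.measurable.enorm
  weight_ne_zero v := by simp [(groundState_pos v).ne']
  weight_ne_top v := enorm_ne_top
  lintegral_right v := by
    rw [lintegral_mehlerKernel_mul_groundState hτ]; simp
  lintegral_left v := by
    simp_rw [mehlerKernel_comm τ _ v]
    rw [lintegral_mehlerKernel_mul_groundState hτ]; simp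

/-- Composition of two Mehler kernels coupled to a heat kernel in position: the variable `w` can be
integrated out after completing the square. -/
theorem heatKernel_mul_mehlerKernel_mul_mehlerKernel {a b R e : ℝ} (ha : 0 < a) (hb : 0 < b)
    (hR : 0 < R) (he : e ^ 2 = 1) (X v u : KSpace n) : ∃ m : KSpace n, ∀ w : KSpace n,
    heatKernel R (X - (e * a) • (v + w) - (e * b) • (w + u)) * mehlerKernel a v w *
        mehlerKernel b w u =
      heatKernel (R + 4 * (a + b) * (a * b) / (1 + a * b))
          (X - (e * ((a + b) / (1 + a * b))) • (v + u)) *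
        mehlerKernel ((a + b) / (1 + a * b)) v u *
        heatKernel (4 * a * b * R / ((a + b) * (1 + a * b) *
          (R + 4 * (a + b) * (a * b) / (1 + a * b)))) (w - m) := by
  set R' : ℝ := R + 4 * (a + b) * (a * b) / (1 + a * b) with hR'
  have h1 : 0 < 1 + a * b := by positivity
  have hR'0 : 0 < R' := by positivity
  set S : ℝ := 4 * a * b * R / ((a + b) * (1 + a * b) * R') with hS
  have hS0 : 0 < S := by positivity
  -- `1 / S` is the coefficient of `‖w‖² / 2` in the total exponent, and the vector multiplied by
  -- `S` collects the terms linear in `w`.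
  refine ⟨S • ((e * (a + b) / R) • (X - (e * a) • v - (e * b) • u) + ((1 / a - a) / 4) • v +
    ((1 / b - b) / 4) • u), fun w => ?_⟩
  unfold heatKernel mehlerKernel
  rw [mul_exp_mul_mul_exp, mul_exp_mul_mul_exp, mul_exp_mul_mul_exp, mul_exp_mul_mul_exp]
  congr 1
  · rw [← Real.mul_rpow (by positivity) (by positivity), ← Real.mul_rpow (by positivity) (by positivity),
      ← Real.mul_rpow (by positivity) (by positivity), ← Real.mul_rpow (by positivity) (by positivity)]
    congr 1
    rw [hS]
    clear_value R' S
    have h2 : (1 + a) * (1 + b) ≠ 0 := by positivity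
    have h3 : 1 + a * b + (a + b) ≠ 0 := by positivity
    have h4 : 1 + a ≠ 0 := by positivity
    have h5 : 1 + b ≠ 0 := by positivity
    have h6 : 1 + (a + b) / (1 + a * b) = (1 + a) * (1 + b) / (1 + a * b) := by
      field_simp
      ring
    rw [h6]
    field_simp
    ring
  · congr 1
    rw [← neg_add, ← neg_add, ← neg_add, ← neg_add]
    congr 1
    simp only [EuclideanSpace.real_norm_sq_eq, Finset.sum_div, ← Finset.sum_add_distrib,
      Finset.mul_sum]
    refine Finset.sum_congr rfl fun i _ => ?_
    simp only [PiLp.sub_apply, PiLp.add_apply, PiLp.smul_apply, smul_eq_mul]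
    rw [hS, hR']
    have h2 : R * (1 + a * b) + 4 * (a + b) * (a * b) ≠ 0 := by positivity
    have h3 : R + 4 * (a + b) * (a * b) / (1 + a * b) =
      (R * (1 + a * b) + 4 * (a + b) * (a * b)) / (1 + a * b) := by
      field_simp
    rw [h3]
    clear_value R' S
    -- The identity uses `e ^ 2 = 1`; for each sign it is a rational identity in the remaining
    -- variables.
    have he' : e = 1 ∨ e = -1 := by
      rw [← sq_eq_sq_iff_eq_or_eq_neg, he, one_pow]
    rcases he' with rfl | rfl
    · field_simp
      ring
    · field_simp
      ring

end Kernels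

/-! ### The kernel of the free Kramers-Fokker-Planck semigroup -/

/-- `tanh (t/2)`. -/
def tanhHalf (t : ℝ) : ℝ := (1 - Real.exp (-t)) / (1 + Real.exp (-t))

/-- The variance `2 t - 4 tanh (t/2)` of the displacement, given both end velocities. -/
def bridgeVar (t : ℝ) : ℝ := 2 * t - 4 * tanhHalf t

theorem tanhHalf_zero : tanhHalf 0 = 0 := by simp [tanhHalf]

theorem tanhHalf_pos {t : ℝ} (ht : 0 < t) : 0 < tanhHalf t := by
  have : Real.exp (-t) < 1 := by
    rw [Real.exp_lt_one_iff]
    linarith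
  exact div_pos (by linarith) (by positivity)

theorem tanhHalf_lt_one (t : ℝ) : tanhHalf t < 1 := by
  have := Real.exp_pos (-t)
  rw [tanhHalf, div_lt_one (by positivity)]
  linarith

/-- This is the parameter that the composition of two Mehler kernels produces. -/
theorem tanhHalf_add (s t : ℝ) :
    tanhHalf (s + t) = (tanhHalf s + tanhHalf t) / (1 + tanhHalf s * tanhHalf t) := by
  unfold tanhHalf
  have h1 := Real.exp_pos (-s)
  have h2 := Real.exp_pos (-t)
  rw [neg_add, Real.exp_add]
  generalize Real.exp (-s) = a at *
  generalize Real.exp (-t) = b at *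
  have h3 : 1 + (1 - a) / (1 + a) * ((1 - b) / (1 + b)) =
      2 * (1 + a * b) / ((1 + a) * (1 + b)) := by
    field_simp
    ring
  rw [h3]
  field_simp
  ring

theorem hasDerivAt_tanhHalf (t : ℝ) : HasDerivAt tanhHalf ((1 - tanhHalf t ^ 2) / 2) t := by
  have h0 := Real.exp_pos (-t)
  have h1 : HasDerivAt (fun t : ℝ => Real.exp (-t)) (-Real.exp (-t)) t := by
    simpa using (hasDerivAt_neg t).exp
  have h2 := (h1.const_sub 1).div (h1.const_add 1) (by positivity)
  refine h2.congr_deriv ?_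
  unfold tanhHalf
  field_simp
  ring

theorem hasDerivAt_bridgeVar (t : ℝ) : HasDerivAt bridgeVar (2 * tanhHalf t ^ 2) t := by
  have h := ((hasDerivAt_id t).const_mul 2).sub ((hasDerivAt_tanhHalf t).const_mul 4)
  refine h.congr_deriv ?_
  ring

theorem continuous_tanhHalf : Continuous tanhHalf :=
  continuous_iff_continuousAt.mpr fun t => (hasDerivAt_tanhHalf t).continuousAt

theorem continuous_bridgeVar : Continuous bridgeVar :=
  continuous_iff_continuousAt.mpr fun t => (hasDerivAt_bridgeVar t).continuousAt

theorem tanhHalf_sq_lt_one (t : ℝ) : tanhHalf t ^ 2 < 1 := by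
  have h := Real.exp_pos (-t)
  rw [sq_lt_one_iff_abs_lt_one, abs_lt]
  refine ⟨?_, tanhHalf_lt_one t⟩
  rw [tanhHalf, lt_div_iff₀ (by positivity)]
  linarith

theorem strictMono_tanhHalf : StrictMono tanhHalf :=
  strictMono_of_hasDerivAt_pos hasDerivAt_tanhHalf fun t => by linarith [tanhHalf_sq_lt_one t]

theorem monotone_bridgeVar : Monotone bridgeVar :=
  monotone_of_hasDerivAt_nonneg hasDerivAt_bridgeVar fun t => by
    simp only [Pi.zero_apply]; positivity

theorem bridgeVar_zero : bridgeVar 0 = 0 := by simp [bridgeVar, tanhHalf_zero]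

theorem bridgeVar_pos {t : ℝ} (ht : 0 < t) : 0 < bridgeVar t := by
  have h : StrictMonoOn bridgeVar (Set.Ici 0) := by
    refine strictMonoOn_of_deriv_pos (convex_Ici 0) continuous_bridgeVar.continuousOn ?_
    intro s hs
    rw [interior_Ici] at hs
    rw [(hasDerivAt_bridgeVar s).deriv]
    have := tanhHalf_pos hs
    positivity
  have := h (Set.mem_Ici.mpr le_rfl) (Set.mem_Ici.mpr ht.le) ht
  rwa [bridgeVar_zero] at this

/-- The extra term is the variance contributed by the intermediate velocity, in the form given by
`heatKernel_mul_mehlerKernel_mul_mehlerKernel` with `R = bridgeVar s + bridgeVar t`. -/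
theorem bridgeVar_add {s t : ℝ} (hs : 0 < s) (ht : 0 < t) :
    bridgeVar (s + t) = bridgeVar s + bridgeVar t + 4 * (tanhHalf s + tanhHalf t) *
      (tanhHalf s * tanhHalf t) / (1 + tanhHalf s * tanhHalf t) := by
  have := tanhHalf_pos hs
  have := tanhHalf_pos ht
  unfold bridgeVar
  rw [tanhHalf_add]
  field_simp
  ring

section Kernel

variable {n : ℕ}

/-- The displacement in position, minus its mean given both end velocities, when the transport
term is `ε v·∇ₓ`. -/
def kfpShift (ε t : ℝ) (z z' : KSpace n × KSpace n) : KSpace n :=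
  z.1 - z'.1 - (ε * tanhHalf t) • (z.2 + z'.2)

/-- The integral kernel of `exp (-t (ε v·∇ₓ - Δᵥ + |v|²/4 - n/2))` for `ε = ±1`. -/
def kfpKernel (ε t : ℝ) (z z' : KSpace n × KSpace n) : ℝ :=
  heatKernel (bridgeVar t) (kfpShift ε t z z') * mehlerKernel (tanhHalf t) z.2 z'.2

theorem kfpKernel_pos (ε : ℝ) {t : ℝ} (ht : 0 < t) (z z' : KSpace n × KSpace n) :
    0 < kfpKernel ε t z z' :=
  mul_pos (heatKernel_pos (bridgeVar_pos ht) _) (mehlerKernel_pos (tanhHalf_pos ht) _ _)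

/-- Transposition reverses the transport. This yields the column half of the Schur test and the
duality used for the generator. -/
theorem kfpKernel_swap (ε t : ℝ) (z z' : KSpace n × KSpace n) :
    kfpKernel ε t z z' = kfpKernel (-ε) t z' z := by
  unfold kfpKernel
  rw [mehlerKernel_comm, ← heatKernel_neg]
  congr 2
  unfold kfpShift
  rw [add_comm z'.2 z.2]
  module

theorem continuous_kfpKernel (ε t : ℝ) :
    Continuous (Function.uncurry (kfpKernel ε t : KSpace n × KSpace n → _ → ℝ)) := by
  unfold kfpKernel kfpShift heatKernel mehlerKernel Function.uncurry
  fun_prop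

theorem lintegral_prod_swap {f : KSpace n × KSpace n → ℝ≥0∞} (hf : Measurable f) :
    ∫⁻ z, f z = ∫⁻ w, ∫⁻ y, f (y, w) := by
  rw [Measure.volume_eq_prod, lintegral_prod_symm' _ hf]

/-- The heat factor has mass `1` in the position variable, whatever the velocities are, so only the
Mehler factor survives. -/
theorem lintegral_kfpKernel_mul (ε : ℝ) {t : ℝ} (ht : 0 < t) (z : KSpace n × KSpace n)
    {f : KSpace n → ℝ≥0∞} (hf : Measurable f) :
    ∫⁻ z', ‖kfpKernel ε t z z'‖ₑ * f z'.2 = ∫⁻ w, ‖mehlerKernel (tanhHalf t) z.2 w‖ₑ * f w := by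
  have hc := continuous_kfpKernel (n := n) ε t
  have hm : Measurable fun z' : KSpace n × KSpace n => ‖kfpKernel ε t z z'‖ₑ * f z'.2 :=
    ((hc.comp (by fun_prop : Continuous fun z' => (z, z'))).measurable.enorm).mul
      (hf.comp measurable_snd)
  rw [lintegral_prod_swap hm]
  refine lintegral_congr fun w => ?_
  unfold kfpKernel
  simp_rw [enorm_mul, mul_assoc]
  rw [lintegral_mul_const]
  · have : ∀ y : KSpace n, kfpShift ε t z (y, w) =
        (z.1 - (ε * tanhHalf t) • (z.2 + w)) - y := by
      intro y
      unfold kfpShift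
      simp only
      abel
    simp_rw [this]
    rw [lintegral_heatKernel_sub_left (bridgeVar_pos ht), one_mul]
  · unfold kfpShift
    exact ((continuous_heatKernel _).comp (by fun_prop)).measurable.enorm

theorem schurBound_kfpKernel (ε : ℝ) {t : ℝ} (ht : 0 < t) :
    SchurBound (volume : Measure (KSpace n × KSpace n)) (kfpKernel ε t)
      (fun z => ‖groundState z.2‖ₑ) 1 := by
  have key : ∀ (ε : ℝ) (z : KSpace n × KSpace n),
      ∫⁻ z', ‖kfpKernel ε t z z'‖ₑ * ‖groundState z'.2‖ₑ ≤ (1 : NNReal) * ‖groundState z.2‖ₑ := by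
    intro ε z
    rw [lintegral_kfpKernel_mul ε ht z continuous_groundState.measurable.enorm,
      lintegral_mehlerKernel_mul_groundState (tanhHalf_pos ht)]
    simp
  exact
    { measurable_kernel := (continuous_kfpKernel ε t).measurable
      measurable_weight := continuous_groundState.measurable.enorm.comp measurable_snd
      weight_ne_zero := fun z => by simp [(groundState_pos z.2).ne']
      weight_ne_top := fun z => enorm_ne_top
      lintegral_right := key ε
      lintegral_left := fun z => by
        simp_rw [kfpKernel_swap ε t _ z]
        exact key (-ε) z }

/-- The Chapman-Kolmogorov equation. -/
theorem lintegral_kfpKernel_mul_kfpKernel {ε s t : ℝ} (hε : ε ^ 2 = 1) (hs : 0 < s) (ht : 0 < t)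
    (z z'' : KSpace n × KSpace n) :
    ∫⁻ z', ‖kfpKernel ε s z z' * kfpKernel ε t z' z''‖ₑ = ‖kfpKernel ε (s + t) z z''‖ₑ := by
  have hc := continuous_kfpKernel (n := n) ε s
  have hc' := continuous_kfpKernel (n := n) ε t
  have hm : Measurable fun z' : KSpace n × KSpace n =>
      ‖kfpKernel ε s z z' * kfpKernel ε t z' z''‖ₑ :=
    ((hc.comp (by fun_prop : Continuous fun z' => (z, z'))).mul
      (hc'.comp (by fun_prop : Continuous fun z' => (z', z'')))).measurable.enorm
  have ha := tanhHalf_pos hs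
  have hb := tanhHalf_pos ht
  have hσ := bridgeVar_pos hs
  have hσ' := bridgeVar_pos ht
  rw [lintegral_prod_swap hm]
  -- The intermediate position is integrated first, as a convolution of heat kernels; the
  -- intermediate velocity then goes by completing the square.
  have inner : ∀ w : KSpace n, ∫⁻ y, ‖kfpKernel ε s z (y, w) * kfpKernel ε t (y, w) z''‖ₑ =
      ‖heatKernel (bridgeVar s + bridgeVar t) ((z.1 - z''.1) - (ε * tanhHalf s) • (z.2 + w) -
        (ε * tanhHalf t) • (w + z''.2)) * mehlerKernel (tanhHalf s) z.2 w *
        mehlerKernel (tanhHalf t) w z''.2‖ₑ := by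
    intro w
    have e : ∀ y : KSpace n, kfpKernel ε s z (y, w) * kfpKernel ε t (y, w) z'' =
        heatKernel (bridgeVar s) ((z.1 - (ε * tanhHalf s) • (z.2 + w)) - y) *
          heatKernel (bridgeVar t) (y - (z''.1 + (ε * tanhHalf t) • (w + z''.2))) *
          (mehlerKernel (tanhHalf s) z.2 w * mehlerKernel (tanhHalf t) w z''.2) := by
      intro y
      unfold kfpKernel kfpShift
      simp only
      rw [mul_mul_mul_comm, sub_right_comm z.1 y, sub_sub y z''.1]
    simp_rw [e, enorm_mul _ (mehlerKernel _ _ _ * mehlerKernel _ _ _)]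
    rw [lintegral_mul_const' _ _ enorm_ne_top, lintegral_heatKernel_mul_heatKernel hσ hσ',
      ← enorm_mul, ← mul_assoc]
    congr 4
    abel
  simp_rw [inner]
  obtain ⟨m, hm⟩ := heatKernel_mul_mehlerKernel_mul_mehlerKernel ha hb (add_pos hσ hσ') hε
    (z.1 - z''.1) z.2 z''.2
  simp_rw [hm, enorm_mul]
  rw [lintegral_const_mul' _ _ (by simp [ENNReal.mul_eq_top]), lintegral_heatKernel_sub_right (by positivity), mul_one,
    ← enorm_mul]
  unfold kfpKernel kfpShift
  rw [bridgeVar_add hs ht, tanhHalf_add]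

/-- The exponent of the kernel. -/
def kfpPhase (ε t : ℝ) (z z' : KSpace n × KSpace n) : ℝ :=
  ‖kfpShift ε t z z'‖ ^ 2 / (2 * bridgeVar t) +
    (tanhHalf t * ‖z.2 + z'.2‖ ^ 2 / 8 + ‖z.2 - z'.2‖ ^ 2 / (8 * tanhHalf t))

/-- The normalisation of the kernel. -/
def kfpNorm (n : ℕ) (t : ℝ) : ℝ :=
  (2 * Real.pi * bridgeVar t) ^ (-((n : ℝ) / 2)) *
    (8 * Real.pi * tanhHalf t / (1 + tanhHalf t) ^ 2) ^ (-((n : ℝ) / 2))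

theorem kfpKernel_eq (ε t : ℝ) (z z' : KSpace n × KSpace n) :
    kfpKernel ε t z z' = kfpNorm n t * Real.exp (-kfpPhase ε t z z') := by
  unfold kfpKernel heatKernel mehlerKernel kfpNorm kfpPhase
  rw [mul_exp_mul_mul_exp, ← neg_add]

/-- Uniformity over a compact time interval is what later permits differentiation under the integral
sign. -/
theorem kfpPhase_coercive {ε a b : ℝ} (hε : ε ^ 2 = 1) (ha : 0 < a) (hab : a ≤ b)
    (z' : KSpace n × KSpace n) :
    ∃ δ c : ℝ, 0 < δ ∧ ∀ t ∈ Set.Icc a b, ∀ z : KSpace n × KSpace n,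
      δ * (‖z.1‖ ^ 2 + ‖z.2‖ ^ 2) - c ≤ kfpPhase ε t z z' := by
  have hb : 0 < b := ha.trans_le hab
  have hσ := bridgeVar_pos hb
  have hτ := tanhHalf_pos ha
  -- By monotonicity in `t`, a lower bound on `[a, b]` for the coefficients of `‖kfpShift‖²` and `‖v
  -- + w‖²`. These two squares control `z` up to the fixed point `z'`. The `6` below is `3` for each
  -- of the two components of `z`, from the square of a sum of three terms.
  set κ : ℝ := min (1 / (2 * bridgeVar b)) (tanhHalf a / 8) with hκ
  have hκ0 : 0 < κ := lt_min (by positivity) (by positivity)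
  refine ⟨κ / 6, κ * (‖z'.1‖ + ‖z'.2‖) ^ 2, by positivity, fun t ht z => ?_⟩
  have ht0 : 0 < t := ha.trans_le ht.1
  have hσt := bridgeVar_pos ht0
  have hτt := tanhHalf_pos ht0
  have h1 : κ ≤ 1 / (2 * bridgeVar t) := by
    refine (min_le_left _ _).trans ?_
    exact one_div_le_one_div_of_le (by positivity)
      (by linarith [monotone_bridgeVar ht.2])
  have h2 : κ ≤ tanhHalf t / 8 := by
    refine (min_le_right _ _).trans ?_
    linarith [strictMono_tanhHalf.monotone ht.1]
  set X := kfpShift ε t z z' with hX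
  have h3 : κ * (‖X‖ ^ 2 + ‖z.2 + z'.2‖ ^ 2) ≤ kfpPhase ε t z z' := by
    unfold kfpPhase
    have e1 : κ * ‖X‖ ^ 2 ≤ ‖X‖ ^ 2 / (2 * bridgeVar t) := by
      rw [div_eq_mul_one_div, mul_comm]
      gcongr
    have e2 : κ * ‖z.2 + z'.2‖ ^ 2 ≤ tanhHalf t * ‖z.2 + z'.2‖ ^ 2 / 8 := by
      rw [mul_div_right_comm]
      gcongr
    have e3 : 0 ≤ ‖z.2 - z'.2‖ ^ 2 / (8 * tanhHalf t) := by positivity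
    linarith
  have h4 : ‖z.2‖ ≤ ‖z.2 + z'.2‖ + ‖z'.2‖ := by
    have := norm_sub_le (z.2 + z'.2) z'.2
    rwa [add_sub_cancel_right] at this
  have h5 : ‖z.1‖ ≤ ‖X‖ + ‖z'.1‖ + ‖z.2 + z'.2‖ := by
    have e : z.1 = X + z'.1 + (ε * tanhHalf t) • (z.2 + z'.2) := by
      rw [hX, kfpShift]
      abel
    have hετ : |ε * tanhHalf t| ≤ 1 := by
      rw [abs_mul, show |ε| = 1 by rw [← sq_eq_sq₀ (abs_nonneg _) zero_le_one, sq_abs, hε, one_pow],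
        one_mul, abs_of_pos hτt]
      exact (tanhHalf_lt_one t).le
    calc ‖z.1‖ ≤ ‖X‖ + ‖z'.1‖ + ‖(ε * tanhHalf t) • (z.2 + z'.2)‖ := by
          conv_lhs => rw [e]
          exact norm_add₃_le
      _ ≤ _ := by
          rw [norm_smul, Real.norm_eq_abs]
          have := mul_le_mul_of_nonneg_right hετ (norm_nonneg (z.2 + z'.2))
          linarith
  have h6 : ‖z.1‖ ^ 2 + ‖z.2‖ ^ 2 ≤ 6 * (‖X‖ ^ 2 + ‖z.2 + z'.2‖ ^ 2 + (‖z'.1‖ + ‖z'.2‖) ^ 2) := by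
    have hS : ∀ r : ℝ, 0 ≤ r → r ≤ ‖X‖ + ‖z.2 + z'.2‖ + (‖z'.1‖ + ‖z'.2‖) →
        r ^ 2 ≤ 3 * (‖X‖ ^ 2 + ‖z.2 + z'.2‖ ^ 2 + (‖z'.1‖ + ‖z'.2‖) ^ 2) := by
      intro r hr h
      nlinarith [pow_le_pow_left₀ hr h 2, sq_nonneg (‖X‖ - ‖z.2 + z'.2‖),
        sq_nonneg (‖X‖ - (‖z'.1‖ + ‖z'.2‖)), sq_nonneg (‖z.2 + z'.2‖ - (‖z'.1‖ + ‖z'.2‖))]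
    have := hS _ (norm_nonneg z.1) (by linarith [norm_nonneg z'.2])
    have := hS _ (norm_nonneg z.2) (by linarith [norm_nonneg z'.1, norm_nonneg X])
    linarith
  nlinarith

theorem sq_norm_prod_le (z : KSpace n × KSpace n) : ‖z‖ ^ 2 ≤ ‖z.1‖ ^ 2 + ‖z.2‖ ^ 2 := by
  rcases max_choice ‖z.1‖ ‖z.2‖ with h | h <;> rw [Prod.norm_def, h]
  · linarith [sq_nonneg ‖z.2‖]
  · linarith [sq_nonneg ‖z.1‖]

theorem hasTemperateGrowth_norm_sq_affine (L : KSpace n × KSpace n →L[ℝ] KSpace n) (c : KSpace n) :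
    (fun z : KSpace n × KSpace n => ‖L z + c‖ ^ 2).HasTemperateGrowth :=
  Function.HasTemperateGrowth.comp (g := fun x : KSpace n => ‖x‖ ^ 2)
    (Function.hasTemperateGrowth_norm_sq _)
    (L.hasTemperateGrowth.add (Function.HasTemperateGrowth.const c))

theorem hasTemperateGrowth_kfpPhase (ε t : ℝ) (z' : KSpace n × KSpace n) :
    (fun z => kfpPhase ε t z z').HasTemperateGrowth := by
  have h1 := hasTemperateGrowth_norm_sq_affine
    (ContinuousLinearMap.fst ℝ (KSpace n) (KSpace n) -
      (ε * tanhHalf t) • ContinuousLinearMap.snd ℝ (KSpace n) (KSpace n))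
    (-z'.1 - (ε * tanhHalf t) • z'.2)
  have h2 := hasTemperateGrowth_norm_sq_affine (ContinuousLinearMap.snd ℝ (KSpace n) (KSpace n)) z'.2
  have h3 := hasTemperateGrowth_norm_sq_affine (ContinuousLinearMap.snd ℝ (KSpace n) (KSpace n))
    (-z'.2)
  have h4 := ((h1.mul (Function.HasTemperateGrowth.const (1 / (2 * bridgeVar t)))).add
    ((h2.mul (Function.HasTemperateGrowth.const (tanhHalf t / 8))))).add
    (h3.mul (Function.HasTemperateGrowth.const (1 / (8 * tanhHalf t))))
  refine (congrArg Function.HasTemperateGrowth (funext fun z => ?_)).mp h4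
  simp only [Pi.add_apply, Pi.mul_apply, kfpPhase, kfpShift]
  have e1 : z.1 - z'.1 - (ε * tanhHalf t) • (z.2 + z'.2) =
      (ContinuousLinearMap.fst ℝ (KSpace n) (KSpace n) -
      (ε * tanhHalf t) • ContinuousLinearMap.snd ℝ (KSpace n) (KSpace n)) z +
      (-z'.1 - (ε * tanhHalf t) • z'.2) := by
    simp only [sub_apply, smul_apply,
      ContinuousLinearMap.coe_fst', ContinuousLinearMap.coe_snd']
    module
  rw [← e1]
  simp only [ContinuousLinearMap.coe_snd', ← sub_eq_add_neg]
  ring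

theorem kfpPhase_ge {ε t : ℝ} (hε : ε ^ 2 = 1) (ht : 0 < t) (z' : KSpace n × KSpace n) :
    ∃ p : ℝ × ℝ, 0 < p.1 ∧ ∀ z : KSpace n × KSpace n, p.1 * ‖z‖ ^ 2 - p.2 ≤ kfpPhase ε t z z' := by
  obtain ⟨δ, c, hδ, h⟩ := kfpPhase_coercive hε ht le_rfl z'
  refine ⟨(δ, c), hδ, fun z => ?_⟩
  have := mul_le_mul_of_nonneg_left (sq_norm_prod_le z) hδ.le
  have := h t ⟨le_rfl, le_rfl⟩ z
  simp only
  linarith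

/-- The kernel, as a real Schwartz function of its first variable. -/
def kfpSchwartzReal {ε t : ℝ} (hε : ε ^ 2 = 1) (ht : 0 < t) (z' : KSpace n × KSpace n) :
    𝓢(KSpace n × KSpace n, ℝ) :=
  expNegSchwartz (kfpNorm n t) (fun z => kfpPhase ε t z z') (hasTemperateGrowth_kfpPhase ε t z')
    (kfpPhase_ge hε ht z').choose_spec.1 (kfpPhase_ge hε ht z').choose_spec.2

theorem kfpSchwartzReal_apply {ε t : ℝ} (hε : ε ^ 2 = 1) (ht : 0 < t) (z z' : KSpace n × KSpace n) :
    kfpSchwartzReal hε ht z' z = kfpKernel ε t z z' := by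
  rw [kfpSchwartzReal, expNegSchwartz_apply, kfpKernel_eq]

/-- A real Schwartz function, seen as a complex one. -/
def SchwartzMap.toComplex {E : Type*} [NormedAddCommGroup E] [NormedSpace ℝ E] (f : 𝓢(E, ℝ)) :
    𝓢(E, ℂ) := SchwartzMap.postcompCLM Complex.ofRealCLM f

theorem SchwartzMap.toComplex_apply {E : Type*} [NormedAddCommGroup E] [NormedSpace ℝ E]
    (f : 𝓢(E, ℝ)) (x : E) : f.toComplex x = (f x : ℂ) := rfl

/-- The kernel, as a complex Schwartz function of its first variable. -/
def kfpSchwartz {ε t : ℝ} (hε : ε ^ 2 = 1) (ht : 0 < t) (z' : KSpace n × KSpace n) :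
    𝓢(KSpace n × KSpace n, ℂ) := (kfpSchwartzReal hε ht z').toComplex

theorem kfpSchwartz_apply {ε t : ℝ} (hε : ε ^ 2 = 1) (ht : 0 < t) (z z' : KSpace n × KSpace n) :
    kfpSchwartz hε ht z' z = (kfpKernel ε t z z' : ℂ) := by
  rw [kfpSchwartz, SchwartzMap.toComplex_apply, kfpSchwartzReal_apply]

instance isAddHaarMeasure_volume_prod :
    (volume : Measure (KSpace n × KSpace n)).IsAddHaarMeasure :=
  Measure.prod.instIsAddHaarMeasure _ _

theorem memLp_kfpKernel_left {ε t : ℝ} (hε : ε ^ 2 = 1) (ht : 0 < t) (z' : KSpace n × KSpace n) :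
    MemLp (fun z => (kfpKernel ε t z z' : ℂ)) 2 volume := by
  have := (kfpSchwartz hε ht z').memLp 2
  exact this.ae_eq (Eventually.of_forall fun z => kfpSchwartz_apply hε ht z z')

theorem memLp_kfpKernel_right {ε t : ℝ} (hε : ε ^ 2 = 1) (ht : 0 < t) (z : KSpace n × KSpace n) :
    MemLp (fun z' => (kfpKernel ε t z z' : ℂ)) 2 volume := by
  simp_rw [kfpKernel_swap ε t z]
  exact memLp_kfpKernel_left (by rwa [neg_sq]) ht z

end Kernel

/-! ### The operator on Schwartz functions -/

section Operator

open LineDeriv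

variable {n : ℕ}

/-- The `i`-th unit vector in position space, as a vector of phase space. -/
def unitPos (i : Fin n) : KSpace n × KSpace n := (EuclideanSpace.basisFun (Fin n) ℝ i, 0)

/-- The `i`-th unit vector in velocity space, as a vector of phase space. -/
def unitVel (i : Fin n) : KSpace n × KSpace n := (0, EuclideanSpace.basisFun (Fin n) ℝ i)

theorem hasTemperateGrowth_velocity (i : Fin n) :
    (fun z : KSpace n × KSpace n => ((z.2 i : ℝ) : ℂ)).HasTemperateGrowth :=
  Function.HasTemperateGrowth.comp (g := Complex.ofReal) Function.Complex.hasTemperateGrowth_ofReal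
    ((EuclideanSpace.proj i : KSpace n →L[ℝ] ℝ).comp
      (ContinuousLinearMap.snd ℝ (KSpace n) (KSpace n))).hasTemperateGrowth

theorem hasTemperateGrowth_potential :
    (fun z : KSpace n × KSpace n =>
      ((‖z.2‖ ^ 2 / 4 - (n : ℝ) / 2 : ℝ) : ℂ)).HasTemperateGrowth := by
  have h := ((hasTemperateGrowth_norm_sq_affine
    (ContinuousLinearMap.snd ℝ (KSpace n) (KSpace n)) 0).mul
    (Function.HasTemperateGrowth.const (1 / 4 : ℝ))).sub
    (Function.HasTemperateGrowth.const ((n : ℝ) / 2))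
  have h' := Function.HasTemperateGrowth.comp (g := Complex.ofReal)
    Function.Complex.hasTemperateGrowth_ofReal h
  refine (congrArg Function.HasTemperateGrowth (funext fun z => ?_)).mp h'
  simp only [Function.comp_apply, Pi.sub_apply, Pi.mul_apply, ContinuousLinearMap.coe_snd',
    add_zero, mul_one_div]

/-- The operator `ε v·∇ₓ - Δᵥ + |v|²/4 - n/2` on Schwartz functions. -/
def kfpOp (ε : ℝ) (φ : 𝓢(KSpace n × KSpace n, ℂ)) : 𝓢(KSpace n × KSpace n, ℂ) :=
  (ε : ℂ) • ∑ i, SchwartzMap.smulLeftCLM ℂ (fun z : KSpace n × KSpace n => ((z.2 i : ℝ) : ℂ))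
      (∂_{(unitPos i : KSpace n × KSpace n)} φ)
    - ∑ i, ∂_{(unitVel i : KSpace n × KSpace n)} (∂_{(unitVel i : KSpace n × KSpace n)} φ)
    + SchwartzMap.smulLeftCLM ℂ (fun z : KSpace n × KSpace n =>
      ((‖z.2‖ ^ 2 / 4 - (n : ℝ) / 2 : ℝ) : ℂ)) φ

theorem SchwartzMap.sum_apply' {E : Type*} [NormedAddCommGroup E] [NormedSpace ℝ E] {ι : Type*}
    (s : Finset ι) (f : ι → 𝓢(E, ℂ)) (x : E) : (∑ i ∈ s, f i) x = ∑ i ∈ s, f i x := by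
  induction s using Finset.cons_induction with
  | empty => simp
  | cons a s ha ih => simp [Finset.sum_cons, ih]

theorem kfpOp_apply (ε : ℝ) (φ : 𝓢(KSpace n × KSpace n, ℂ)) (z : KSpace n × KSpace n) :
    kfpOp ε φ z = (ε : ℂ) * ∑ i, ((z.2 i : ℝ) : ℂ) * (∂_{(unitPos i : KSpace n × KSpace n)} φ) z
      - ∑ i, (∂_{(unitVel i : KSpace n × KSpace n)} (∂_{(unitVel i : KSpace n × KSpace n)} φ)) z
      + ((‖z.2‖ ^ 2 / 4 - (n : ℝ) / 2 : ℝ) : ℂ) * φ z := by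
  unfold kfpOp
  rw [add_apply, sub_apply, smul_apply,
    SchwartzMap.sum_apply', SchwartzMap.sum_apply',
    SchwartzMap.smulLeftCLM_apply_apply hasTemperateGrowth_potential, smul_eq_mul, smul_eq_mul]
  simp_rw [SchwartzMap.smulLeftCLM_apply_apply (hasTemperateGrowth_velocity _), smul_eq_mul]

theorem fderiv_slice (φ : 𝓢(KSpace n × KSpace n, ℂ)) (x w e : KSpace n) :
    fderiv ℝ (fun w : KSpace n => φ (x, w)) w e =
      (∂_{((0, e) : KSpace n × KSpace n)} φ) (x, w) := by
  rw [SchwartzMap.lineDerivOp_apply_eq_fderiv]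
  have h1 : HasFDerivAt (fun w : KSpace n => (x, w))
      (ContinuousLinearMap.inr ℝ (KSpace n) (KSpace n)) w := hasFDerivAt_prodMk_right x w
  have h2 := (φ.hasFDerivAt (x, w)).comp w h1
  rw [show (fun w : KSpace n => φ (x, w)) = φ ∘ fun w => (x, w) from rfl, h2.fderiv]
  rfl

/-- Rewriting the velocity Laplacian through Schwartz line derivatives on phase space makes
integration by parts available. -/
theorem laplacian_slice (φ : 𝓢(KSpace n × KSpace n, ℂ)) (x v : KSpace n) :
    Laplacian.laplacian (fun w : KSpace n => φ (x, w)) v =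
      ∑ i, (∂_{(unitVel i : KSpace n × KSpace n)} (∂_{(unitVel i : KSpace n × KSpace n)} φ))
        (x, v) := by
  rw [InnerProductSpace.laplacian_eq_iteratedFDeriv_orthonormalBasis _
    (EuclideanSpace.basisFun (Fin n) ℝ)]
  refine Finset.sum_congr rfl fun i _ => ?_
  have hs : ContDiff ℝ 2 (fun w : KSpace n => φ (x, w)) :=
    (φ.smooth 2).comp (contDiff_prodMk_right x)
  rw [iteratedFDeriv_two_apply]
  simp only [Matrix.cons_val_zero, Matrix.cons_val_one]
  set e := EuclideanSpace.basisFun (Fin n) ℝ i with he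
  have h1 : DifferentiableAt ℝ (fderiv ℝ (fun w : KSpace n => φ (x, w))) v :=
    (hs.fderiv_right (m := 1) (by norm_num)).differentiable (by norm_num) v
  have h2 : fderiv ℝ (fun w => fderiv ℝ (fun w : KSpace n => φ (x, w)) w e) v e =
      fderiv ℝ (fderiv ℝ (fun w : KSpace n => φ (x, w))) v e e := by
    rw [fderiv_clm_apply h1 (differentiableAt_const e)]
    simp
  rw [← h2]
  simp_rw [fderiv_slice φ x _ e]
  exact fderiv_slice (∂_{((0, e) : KSpace n × KSpace n)} φ) x v e

theorem fderiv_pos_eq_sum (φ : 𝓢(KSpace n × KSpace n, ℂ)) (z : KSpace n × KSpace n)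
    (v : KSpace n) : fderiv ℝ (fun y => φ y) z (v, 0) =
      ∑ i, ((v i : ℝ) : ℂ) * (∂_{(unitPos i : KSpace n × KSpace n)} φ) z := by
  have h : ((v, 0) : KSpace n × KSpace n) = ∑ i, v i • (unitPos i : KSpace n × KSpace n) := by
    have := (EuclideanSpace.basisFun (Fin n) ℝ).sum_repr v
    refine Prod.ext ?_ ?_
    · rw [Prod.fst_sum]
      conv_lhs => rw [← this]
      rfl
    · rw [Prod.snd_sum]
      simp [unitPos]
  rw [h, map_sum]
  refine Finset.sum_congr rfl fun i _ => ?_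
  rw [map_smul, Complex.real_smul]
  rfl

theorem freeKFPTranspose_eq (φ : 𝓢(KSpace n × KSpace n, ℂ)) (z : KSpace n × KSpace n) :
    freeKFPTranspose φ z = kfpOp (-1) φ z := by
  rw [kfpOp_apply, freeKFPTranspose, fderiv_pos_eq_sum, laplacian_slice]
  push_cast
  ring

theorem SchwartzMap.integrable_mul' (f g : 𝓢(KSpace n × KSpace n, ℂ)) :
    Integrable fun z => f z * g z :=
  (f.memLp 2).integrable_mul (g.memLp 2)

/-- The coefficient `v i` is constant in position directions, so integration by parts produces no
zeroth order term. -/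
theorem integral_mul_velocity_lineDeriv (φ ψ : 𝓢(KSpace n × KSpace n, ℂ)) (i : Fin n) :
    ∫ z, φ z * (((z.2 i : ℝ) : ℂ) * (∂_{(unitPos i : KSpace n × KSpace n)} ψ) z) =
      -∫ z, ((z.2 i : ℝ) : ℂ) * (∂_{(unitPos i : KSpace n × KSpace n)} φ) z * ψ z := by
  set g : KSpace n × KSpace n → ℂ := fun z => ((z.2 i : ℝ) : ℂ) with hg
  have hgt : g.HasTemperateGrowth := hasTemperateGrowth_velocity i
  have h := SchwartzMap.integral_mul_lineDerivOp_right_eq_neg_left (μ := volume)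
    (SchwartzMap.smulLeftCLM ℂ g φ) ψ (unitPos i : KSpace n × KSpace n)
  have e1 : ∀ z, (∂_{(unitPos i : KSpace n × KSpace n)} (SchwartzMap.smulLeftCLM ℂ g φ)) z =
      g z * (∂_{(unitPos i : KSpace n × KSpace n)} φ) z := by
    intro z
    rw [SchwartzMap.lineDerivOp_apply, SchwartzMap.smulLeftCLM_apply hgt]
    apply HasLineDerivAt.lineDeriv
    have h1 : HasLineDerivAt ℝ φ ((∂_{(unitPos i : KSpace n × KSpace n)} φ) z) z (unitPos i) :=
      (φ.hasFDerivAt z).hasLineDerivAt _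
    have h2 : HasDerivAt (fun t : ℝ => g z • φ (z + t • unitPos i))
      (g z • (∂_{(unitPos i : KSpace n × KSpace n)} φ) z) 0 := h1.const_smul (g z)
    refine h2.congr_of_eventuallyEq (Eventually.of_forall fun t => ?_)
    change g (z + t • unitPos i) • φ (z + t • unitPos i) = g z • φ (z + t • unitPos i)
    congr 1
    simp [hg, unitPos]
  simp only [e1, SchwartzMap.smulLeftCLM_apply_apply hgt, smul_eq_mul] at h
  rw [← h]
  congr 1
  ext z
  ring

/-- Integration by parts. -/
theorem integral_mul_kfpOp (ε : ℝ) (φ ψ : 𝓢(KSpace n × KSpace n, ℂ)) :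
    ∫ z, φ z * kfpOp ε ψ z = ∫ z, kfpOp (-ε) φ z * ψ z := by
  have i1 : ∀ (f g : 𝓢(KSpace n × KSpace n, ℂ)) (i : Fin n),
      Integrable fun z => f z * (((z.2 i : ℝ) : ℂ) * g z) := by
    intro f g i
    have := SchwartzMap.integrable_mul' f (SchwartzMap.smulLeftCLM ℂ
      (fun z : KSpace n × KSpace n => ((z.2 i : ℝ) : ℂ)) g)
    simpa only [SchwartzMap.smulLeftCLM_apply_apply (hasTemperateGrowth_velocity i),
      smul_eq_mul] using this
  have i2 : Integrable fun z => φ z * (((‖z.2‖ ^ 2 / 4 - (n : ℝ) / 2 : ℝ) : ℂ) * ψ z) := by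
    have := SchwartzMap.integrable_mul' φ (SchwartzMap.smulLeftCLM ℂ (fun z : KSpace n × KSpace n =>
      ((‖z.2‖ ^ 2 / 4 - (n : ℝ) / 2 : ℝ) : ℂ)) ψ)
    simpa only [SchwartzMap.smulLeftCLM_apply_apply hasTemperateGrowth_potential,
      smul_eq_mul] using this
  have l1 : ∀ z, φ z * kfpOp ε ψ z =
      (ε : ℂ) * (∑ i, φ z * (((z.2 i : ℝ) : ℂ) * (∂_{(unitPos i : KSpace n × KSpace n)} ψ) z))
      - (∑ i, φ z *
        (∂_{(unitVel i : KSpace n × KSpace n)} (∂_{(unitVel i : KSpace n × KSpace n)} ψ)) z)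
      + φ z * (((‖z.2‖ ^ 2 / 4 - (n : ℝ) / 2 : ℝ) : ℂ) * ψ z) := by
    intro z
    rw [kfpOp_apply, ← Finset.mul_sum, ← Finset.mul_sum]
    ring
  have l2 : ∀ z, kfpOp (-ε) φ z * ψ z =
      (ε : ℂ) * (-∑ i, ((z.2 i : ℝ) : ℂ) * (∂_{(unitPos i : KSpace n × KSpace n)} φ) z * ψ z)
      - (∑ i,
        (∂_{(unitVel i : KSpace n × KSpace n)} (∂_{(unitVel i : KSpace n × KSpace n)} φ)) z * ψ z)
      + φ z * (((‖z.2‖ ^ 2 / 4 - (n : ℝ) / 2 : ℝ) : ℂ) * ψ z) := by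
    intro z
    rw [kfpOp_apply, ← Finset.sum_mul, ← Finset.sum_mul]
    push_cast
    ring
  simp_rw [l1, l2]
  have i3 : ∀ i : Fin n, Integrable fun z : KSpace n × KSpace n =>
      ((z.2 i : ℝ) : ℂ) * (∂_{(unitPos i : KSpace n × KSpace n)} φ) z * ψ z := by
    intro i
    refine (i1 ψ (∂_{(unitPos i : KSpace n × KSpace n)} φ) i).congr (Eventually.of_forall fun z => ?_)
    simp only
    ring
  have i4 := fun i : Fin n => SchwartzMap.integrable_mul' φ
    (∂_{(unitVel i : KSpace n × KSpace n)} (∂_{(unitVel i : KSpace n × KSpace n)} ψ))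
  have i5 := fun i : Fin n => SchwartzMap.integrable_mul'
    (∂_{(unitVel i : KSpace n × KSpace n)} (∂_{(unitVel i : KSpace n × KSpace n)} φ)) ψ
  have i6 := fun i : Fin n => i1 φ (∂_{(unitPos i : KSpace n × KSpace n)} ψ) i
  have s6 := (integrable_finsetSum Finset.univ fun i _ => i6 i).const_mul (ε : ℂ)
  have s4 := integrable_finsetSum Finset.univ fun i _ => i4 i
  have s3 := (integrable_finsetSum Finset.univ fun i _ => i3 i).neg.const_mul (ε : ℂ)
  have s5 := integrable_finsetSum Finset.univ fun i _ => i5 i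
  simp only [Pi.neg_apply] at s3
  rw [integral_add (s6.sub' s4) i2, integral_sub s6 s4, integral_add (s3.sub' s5) i2,
    integral_sub s3 s5, integral_const_mul, integral_const_mul, integral_neg,
    integral_finsetSum _ fun i _ => i6 i, integral_finsetSum _ fun i _ => i4 i,
    integral_finsetSum _ fun i _ => i3 i, integral_finsetSum _ fun i _ => i5 i]
  congr 2
  · simp_rw [integral_mul_velocity_lineDeriv φ ψ, Finset.sum_neg_distrib]
  · refine Finset.sum_congr rfl fun i _ => ?_
    rw [SchwartzMap.integral_mul_lineDerivOp_right_eq_neg_left,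
      SchwartzMap.integral_mul_lineDerivOp_right_eq_neg_left, neg_neg]

end Operator

/-! ### The Kramers-Fokker-Planck equation for the kernel -/

section Equation

open LineDeriv

variable {n : ℕ}

/-- The logarithmic time derivative of the kernel. -/
def kfpLogDeriv (ε t : ℝ) (z z' : KSpace n × KSpace n) : ℝ :=
  -(n * (tanhHalf t ^ 2 / bridgeVar t + (1 - tanhHalf t) ^ 2 / (4 * tanhHalf t)))
    + tanhHalf t ^ 2 / bridgeVar t ^ 2 * ‖kfpShift ε t z z'‖ ^ 2
    + ε * (1 - tanhHalf t ^ 2) / (2 * bridgeVar t) * inner ℝ (kfpShift ε t z z') (z.2 + z'.2)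
    - (1 - tanhHalf t ^ 2) / 16 * ‖z.2 + z'.2‖ ^ 2
    + (1 - tanhHalf t ^ 2) / (16 * tanhHalf t ^ 2) * ‖z.2 - z'.2‖ ^ 2

theorem hasDerivAt_kfpNorm {t : ℝ} (ht : 0 < t) :
    HasDerivAt (kfpNorm n) (kfpNorm n t *
      (-(n * (tanhHalf t ^ 2 / bridgeVar t + (1 - tanhHalf t) ^ 2 / (4 * tanhHalf t))))) t := by
  have hτ := tanhHalf_pos ht
  have hσ := bridgeVar_pos ht
  have hp := Real.pi_pos
  have dτ := hasDerivAt_tanhHalf t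
  have dσ := hasDerivAt_bridgeVar t
  have h1 : HasDerivAt (fun t => 2 * Real.pi * bridgeVar t) (2 * Real.pi * (2 * tanhHalf t ^ 2)) t :=
    dσ.const_mul _
  have h2 := h1.rpow_const (p := -((n : ℝ) / 2)) (Or.inl (by positivity))
  have h3 : HasDerivAt (fun t => 8 * Real.pi * tanhHalf t / (1 + tanhHalf t) ^ 2) _ t :=
    (dτ.const_mul (8 * Real.pi)).div ((dτ.const_add 1).pow 2) (by positivity)
  have h4 := h3.rpow_const (p := -((n : ℝ) / 2)) (Or.inl (by positivity))
  refine (h2.mul h4).congr_deriv ?_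
  unfold kfpNorm
  rw [Real.rpow_sub_one (by positivity), Real.rpow_sub_one (by positivity)]
  generalize (2 * Real.pi * bridgeVar t) ^ (-((n : ℝ) / 2)) = A
  generalize (8 * Real.pi * tanhHalf t / (1 + tanhHalf t) ^ 2) ^ (-((n : ℝ) / 2)) = B
  generalize tanhHalf t = τ at *
  generalize bridgeVar t = σ at *
  push_cast
  field_simp
  ring

theorem hasDerivAt_kfpPhase (ε : ℝ) {t : ℝ} (ht : 0 < t) (z z' : KSpace n × KSpace n) :
    HasDerivAt (fun t => kfpPhase ε t z z') (-(tanhHalf t ^ 2 / bridgeVar t ^ 2 *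
      ‖kfpShift ε t z z'‖ ^ 2 + ε * (1 - tanhHalf t ^ 2) / (2 * bridgeVar t) *
      inner ℝ (kfpShift ε t z z') (z.2 + z'.2) - (1 - tanhHalf t ^ 2) / 16 * ‖z.2 + z'.2‖ ^ 2
      + (1 - tanhHalf t ^ 2) / (16 * tanhHalf t ^ 2) * ‖z.2 - z'.2‖ ^ 2)) t := by
  have hτ := tanhHalf_pos ht
  have hσ := bridgeVar_pos ht
  have dτ := hasDerivAt_tanhHalf t
  have dσ := hasDerivAt_bridgeVar t
  have dX : HasDerivAt (fun t => kfpShift ε t z z')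
      (-((ε * ((1 - tanhHalf t ^ 2) / 2)) • (z.2 + z'.2))) t :=
    ((dτ.const_mul ε).smul_const (z.2 + z'.2)).const_sub _
  have h1 := dX.norm_sq.div (dσ.const_mul 2) (by positivity)
  have h2 := ((dτ.mul_const (‖z.2 + z'.2‖ ^ 2)).div_const 8).add
    ((hasDerivAt_const t (‖z.2 - z'.2‖ ^ 2)).div (dτ.const_mul 8) (by positivity))
  refine (h1.add h2).congr_deriv ?_
  rw [inner_neg_right, inner_smul_right]
  field_simp
  ring

theorem hasDerivAt_kfpKernel (ε : ℝ) {t : ℝ} (ht : 0 < t) (z z' : KSpace n × KSpace n) :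
    HasDerivAt (fun t => kfpKernel ε t z z') (kfpKernel ε t z z' * kfpLogDeriv ε t z z') t := by
  simp_rw [kfpKernel_eq]
  refine ((hasDerivAt_kfpNorm ht).mul (hasDerivAt_kfpPhase ε ht z z').neg.exp).congr_deriv ?_
  simp only [Pi.neg_apply, kfpLogDeriv]
  ring

/-- Minus the directional derivative of the phase in the direction `d`. -/
def kfpSlope (ε t : ℝ) (z z' d : KSpace n × KSpace n) : ℝ :=
  -(inner ℝ (kfpShift ε t z z') (d.1 - (ε * tanhHalf t) • d.2) / bridgeVar t +
    tanhHalf t * inner ℝ (z.2 + z'.2) d.2 / 4 + inner ℝ (z.2 - z'.2) d.2 / (4 * tanhHalf t))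

theorem hasDerivAt_kfpShift_line (ε t : ℝ) (z z' d : KSpace n × KSpace n) :
    HasDerivAt (fun s : ℝ => kfpShift ε t (z + s • d) z') (d.1 - (ε * tanhHalf t) • d.2) 0 := by
  have h0 := hasDerivAt_id (0 : ℝ)
  have h1 := (((h0.smul_const d.1).const_add z.1).sub_const z'.1).sub
    ((((h0.smul_const d.2).const_add z.2).add_const z'.2).const_smul (ε * tanhHalf t))
  exact h1.congr_deriv (by simp)

theorem hasDerivAt_velocity_line (z d : KSpace n × KSpace n) (c : KSpace n) :
    HasDerivAt (fun s : ℝ => (z + s • d).2 + c) d.2 0 := by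
  have h1 := (((hasDerivAt_id (0 : ℝ)).smul_const d.2).const_add z.2).add_const c
  simpa using h1

theorem hasLineDerivAt_kfpKernel (ε : ℝ) {t : ℝ} (ht : 0 < t) (z z' d : KSpace n × KSpace n) :
    HasLineDerivAt ℝ (fun z => kfpKernel ε t z z') (kfpKernel ε t z z' * kfpSlope ε t z z' d) z
      d := by
  have hτ := tanhHalf_pos ht
  have hσ := bridgeVar_pos ht
  have h1 := (hasDerivAt_kfpShift_line ε t z z' d).norm_sq.div_const (2 * bridgeVar t)
  have h2 := ((hasDerivAt_velocity_line z d z'.2).norm_sq.const_mul (tanhHalf t)).div_const 8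
  have h3 := (hasDerivAt_velocity_line z d (-z'.2)).norm_sq.div_const (8 * tanhHalf t)
  have h4 := ((h1.add (h2.add h3)).neg.exp).const_mul (kfpNorm n t)
  unfold HasLineDerivAt
  simp_rw [kfpKernel_eq]
  refine (h4.congr_deriv ?_).congr_of_eventuallyEq (Eventually.of_forall fun s => ?_)
  · simp only [Pi.neg_apply, Pi.add_apply, zero_smul, add_zero, ← sub_eq_add_neg, kfpSlope]
    rw [← kfpPhase]
    field_simp
    ring
  · simp only [Pi.neg_apply, Pi.add_apply, ← sub_eq_add_neg, kfpPhase]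

theorem hasLineDerivAt_kfpSlope (ε : ℝ) (t : ℝ) (z z' d : KSpace n × KSpace n) :
    HasLineDerivAt ℝ (fun z => kfpSlope ε t z z' d)
      (-(‖d.1 - (ε * tanhHalf t) • d.2‖ ^ 2 / bridgeVar t + tanhHalf t * ‖d.2‖ ^ 2 / 4 +
        ‖d.2‖ ^ 2 / (4 * tanhHalf t))) z d := by
  have h1 := ((hasDerivAt_kfpShift_line ε t z z' d).inner ℝ
    (hasDerivAt_const 0 (d.1 - (ε * tanhHalf t) • d.2))).div_const (bridgeVar t)
  have h2 := (((hasDerivAt_velocity_line z d z'.2).inner ℝ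
    (hasDerivAt_const 0 d.2)).const_mul (tanhHalf t)).div_const 4
  have h3 := ((hasDerivAt_velocity_line z d (-z'.2)).inner ℝ
    (hasDerivAt_const 0 d.2)).div_const (4 * tanhHalf t)
  unfold HasLineDerivAt
  refine (((h1.add h2).add h3).neg.congr_deriv ?_).congr_of_eventuallyEq
    (Eventually.of_forall fun s => ?_)
  · simp only [inner_zero_right, zero_add, real_inner_self_eq_norm_sq]
  · simp only [Pi.neg_apply, Pi.add_apply, kfpSlope, ← sub_eq_add_neg]

theorem lineDeriv_kfpSchwartzReal {ε t : ℝ} (hε : ε ^ 2 = 1) (ht : 0 < t)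
    (z z' d : KSpace n × KSpace n) :
    (∂_{d} (kfpSchwartzReal hε ht z')) z = kfpKernel ε t z z' * kfpSlope ε t z z' d := by
  rw [SchwartzMap.lineDerivOp_apply]
  simp_rw [show (kfpSchwartzReal hε ht z' : KSpace n × KSpace n → ℝ) =
    fun z => kfpKernel ε t z z' from funext fun z => kfpSchwartzReal_apply hε ht z z']
  exact (hasLineDerivAt_kfpKernel ε ht z z' d).lineDeriv

/-- Since `∂K = K · slope`, the second derivative is `K (slope² + ∂ slope)`, and `∂ slope` does not
depend on `z` because the phase is quadratic. -/
theorem lineDeriv_lineDeriv_kfpSchwartzReal {ε t : ℝ} (hε : ε ^ 2 = 1) (ht : 0 < t)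
    (z z' d : KSpace n × KSpace n) :
    (∂_{d} (∂_{d} (kfpSchwartzReal hε ht z'))) z = kfpKernel ε t z z' *
      (kfpSlope ε t z z' d ^ 2 - (‖d.1 - (ε * tanhHalf t) • d.2‖ ^ 2 / bridgeVar t +
        tanhHalf t * ‖d.2‖ ^ 2 / 4 + ‖d.2‖ ^ 2 / (4 * tanhHalf t))) := by
  rw [SchwartzMap.lineDerivOp_apply]
  rw [show ⇑(∂_{d} (kfpSchwartzReal hε ht z') : 𝓢(KSpace n × KSpace n, ℝ)) =
    fun z => kfpKernel ε t z z' * kfpSlope ε t z z' d from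
      funext fun z => lineDeriv_kfpSchwartzReal hε ht z z' d]
  have h : HasDerivAt (fun s : ℝ => kfpKernel ε t (z + s • d) z' * kfpSlope ε t (z + s • d) z' d)
      _ 0 := HasDerivAt.mul (hasLineDerivAt_kfpKernel ε ht z z' d) (hasLineDerivAt_kfpSlope ε t z z' d)
  have h' : HasLineDerivAt ℝ (fun z => kfpKernel ε t z z' * kfpSlope ε t z z' d) _ z d := h
  rw [h'.lineDeriv]
  simp only [zero_smul, add_zero]
  ring

theorem SchwartzMap.lineDerivOp_toComplex (f : 𝓢(KSpace n × KSpace n, ℝ))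
    (d : KSpace n × KSpace n) : ∂_{d} f.toComplex = (∂_{d} f).toComplex := by
  ext z
  rw [SchwartzMap.toComplex_apply, SchwartzMap.lineDerivOp_apply]
  apply HasLineDerivAt.lineDeriv
  have h1 : HasDerivAt (fun s : ℝ => f (z + s • d)) ((∂_{d} f) z) 0 :=
    (f.hasFDerivAt z).hasLineDerivAt d
  exact h1.ofReal_comp

/-- The kernel solves the equation `∂ₜ K = - (ε v·∇ₓ - Δᵥ + |v|²/4 - n/2) K`. -/
theorem kfpOp_kfpSchwartz {ε t : ℝ} (hε : ε ^ 2 = 1) (ht : 0 < t) (z z' : KSpace n × KSpace n) :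
    kfpOp ε (kfpSchwartz hε ht z') z =
      ((-(kfpKernel ε t z z' * kfpLogDeriv ε t z z') : ℝ) : ℂ) := by
  rw [kfpOp_apply, kfpSchwartz_apply]
  unfold kfpSchwartz
  simp_rw [SchwartzMap.lineDerivOp_toComplex, SchwartzMap.toComplex_apply,
    lineDeriv_kfpSchwartzReal, lineDeriv_lineDeriv_kfpSchwartzReal]
  norm_cast
  have hτ := tanhHalf_pos ht
  have hσ := bridgeVar_pos ht
  have hb : ∀ (a : KSpace n) (i : Fin n),
      inner ℝ a (EuclideanSpace.basisFun (Fin n) ℝ i) = a i := by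
    intro a i
    simp [EuclideanSpace.inner_single_right]
  have s1 : ∀ i : Fin n, kfpSlope ε t z z' (unitPos i) = -(kfpShift ε t z z' i / bridgeVar t) := by
    intro i
    simp only [kfpSlope, unitPos, smul_zero, sub_zero, hb, inner_zero_right]
    ring
  have s2 : ∀ i : Fin n, kfpSlope ε t z z' (unitVel i) =
      ε * tanhHalf t * kfpShift ε t z z' i / bridgeVar t - tanhHalf t * (z.2 i + z'.2 i) / 4 -
        (z.2 i - z'.2 i) / (4 * tanhHalf t) := by
    intro i
    simp only [kfpSlope, unitVel, zero_sub, inner_neg_right, inner_smul_right, hb, PiLp.add_apply,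
      PiLp.sub_apply]
    ring
  have s3 : ∀ i : Fin n, ‖(unitVel i : KSpace n × KSpace n).2‖ = 1 := by
    intro i
    exact (EuclideanSpace.basisFun (Fin n) ℝ).norm_eq_one i
  have s4 : ∀ i : Fin n, ‖(unitVel i : KSpace n × KSpace n).1 -
      (ε * tanhHalf t) • (unitVel i : KSpace n × KSpace n).2‖ ^ 2 = tanhHalf t ^ 2 := by
    intro i
    have : (unitVel i : KSpace n × KSpace n).1 = 0 := rfl
    rw [this, zero_sub, norm_neg, norm_smul, s3, mul_one, Real.norm_eq_abs, sq_abs, mul_pow, hε,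
      one_mul]
  simp_rw [s1, s2, s3, s4]
  -- With the dimension written as a sum, both sides become sums over coordinates and the equation
  -- reduces to a scalar identity for each coordinate.
  have hn : (n : ℝ) = ∑ i : Fin n, (1 : ℝ) := by simp
  have hinner : inner ℝ (kfpShift ε t z z') (z.2 + z'.2) =
      ∑ i, kfpShift ε t z z' i * (z.2 i + z'.2 i) := by
    rw [PiLp.inner_apply]
    refine Finset.sum_congr rfl fun i _ => ?_
    simp [mul_comm]
  rw [kfpLogDeriv, hinner, hn]
  simp only [EuclideanSpace.real_norm_sq_eq, Finset.sum_div, Finset.mul_sum, Finset.sum_mul,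
    ← Finset.sum_add_distrib, ← Finset.sum_sub_distrib, ← Finset.sum_neg_distrib, PiLp.add_apply,
    PiLp.sub_apply]
  refine Finset.sum_congr rfl fun i _ => ?_
  generalize kfpShift ε t z z' i = X
  generalize kfpKernel ε t z z' = K
  generalize z.2 i = v
  generalize z'.2 i = w
  generalize tanhHalf t = τ at *
  generalize bridgeVar t = σ at *
  have he : ε = 1 ∨ ε = -1 := by
    rw [← sq_eq_sq_iff_eq_or_eq_neg, hε, one_pow]
  rcases he with rfl | rfl
  · field_simp
    ring
  · field_simp
    ring

end Equation

/-! ### Time derivative of integrals against the kernel -/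

section TimeDerivative

variable {n : ℕ}

/-- Apart from a bounded constant, the logarithmic derivative is a combination of the three squares
in the phase and one inner product controlled by two of them. The coefficients relative to the phase
stay bounded as long as `t` stays away from `0`. -/
theorem abs_kfpLogDeriv_le {ε a : ℝ} (hε : ε ^ 2 = 1) (ha : 0 < a) :
    ∃ C : ℝ, 0 ≤ C ∧ ∀ t, a ≤ t → ∀ z z' : KSpace n × KSpace n,
      |kfpLogDeriv ε t z z'| ≤ C * (1 + kfpPhase ε t z z') := by
  have hσa := bridgeVar_pos ha
  have hτa := tanhHalf_pos ha
  refine ⟨n * (1 / bridgeVar a + 1 / (4 * tanhHalf a)) + (2 / bridgeVar a + 1 / 2 +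
    2 / (bridgeVar a * tanhHalf a) + 1 / tanhHalf a), by positivity, fun t hat z z' => ?_⟩
  have ht : 0 < t := ha.trans_le hat
  have hσ : bridgeVar a ≤ bridgeVar t := monotone_bridgeVar hat
  have hτ : tanhHalf a ≤ tanhHalf t := strictMono_tanhHalf.monotone hat
  have hτ1 := (tanhHalf_lt_one t).le
  have hε1 : |ε| = 1 := by
    rw [← sq_eq_sq₀ (abs_nonneg _) zero_le_one, sq_abs, hε, one_pow]
  unfold kfpLogDeriv kfpPhase
  set X := kfpShift ε t z z'
  set p := z.2 + z'.2
  set m := z.2 - z'.2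
  have hin : |inner ℝ X p| ≤ (‖X‖ ^ 2 + ‖p‖ ^ 2) / 2 := by
    have := abs_real_inner_le_norm X p
    nlinarith [sq_nonneg (‖X‖ - ‖p‖)]
  generalize inner ℝ X p = I at *
  have hX0 : 0 ≤ ‖X‖ ^ 2 := by positivity
  have hp0 : 0 ≤ ‖p‖ ^ 2 := by positivity
  have hm0 : 0 ≤ ‖m‖ ^ 2 := by positivity
  generalize ‖X‖ ^ 2 = x at *
  generalize ‖p‖ ^ 2 = y at *
  generalize ‖m‖ ^ 2 = w at *
  generalize tanhHalf t = τ at *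
  generalize bridgeVar t = σ at *
  generalize bridgeVar a = σa at *
  generalize tanhHalf a = τa at *
  have hσ0 : 0 < σ := hσa.trans_le hσ
  have hτ0 : 0 < τ := hτa.trans_le hτ
  set Φ := x / (2 * σ) + (τ * y / 8 + w / (8 * τ)) with hΦ
  have b1 : x / (2 * σ) ≤ Φ := by rw [hΦ]; linarith [show 0 ≤ τ * y / 8 + w / (8 * τ) by positivity]
  have b2 : τ * y / 8 ≤ Φ := by
    rw [hΦ]; linarith [show 0 ≤ x / (2 * σ) by positivity, show 0 ≤ w / (8 * τ) by positivity]
  have b3 : w / (8 * τ) ≤ Φ := by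
    rw [hΦ]; linarith [show 0 ≤ x / (2 * σ) by positivity, show 0 ≤ τ * y / 8 by positivity]
  have hΦ0 : 0 ≤ Φ := by positivity
  clear_value Φ
  have c1 : 1 / σ ≤ 1 / σa := one_div_le_one_div_of_le hσa hσ
  have c2 : 1 / τ ≤ 1 / τa := one_div_le_one_div_of_le hτa hτ
  have d1 : 0 ≤ 1 - τ ^ 2 := by nlinarith
  have d2 : 1 - τ ^ 2 ≤ 1 := by nlinarith
  have d3 : τ ^ 2 ≤ 1 := by nlinarith
  have t0 : |-(n * (τ ^ 2 / σ + (1 - τ) ^ 2 / (4 * τ)))| ≤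
      n * (1 / σa + 1 / (4 * τa)) := by
    rw [abs_neg, abs_of_nonneg (by positivity)]
    have e1 : τ ^ 2 / σ ≤ 1 / σa := le_trans (by gcongr) c1
    have e2 : (1 - τ) ^ 2 / (4 * τ) ≤ 1 / (4 * τa) := by
      have : (1 - τ) ^ 2 ≤ 1 := by nlinarith
      gcongr
    gcongr
  have t1 : |τ ^ 2 / σ ^ 2 * x| ≤ 2 / σa * Φ := by
    rw [abs_of_nonneg (by positivity)]
    calc τ ^ 2 / σ ^ 2 * x = τ ^ 2 * (2 * (1 / σ)) * (x / (2 * σ)) := by field_simp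
      _ ≤ 1 * (2 * (1 / σa)) * Φ := by gcongr
      _ = _ := by ring
  have t2 : |ε * (1 - τ ^ 2) / (2 * σ) * I| ≤ (1 / 2 + 2 / (σa * τa)) * Φ := by
    rw [abs_mul, abs_div, abs_mul, hε1, one_mul, abs_of_nonneg d1, abs_of_pos (by positivity :
      0 < 2 * σ)]
    calc (1 - τ ^ 2) / (2 * σ) * |I| ≤ 1 / (2 * σ) * ((x + y) / 2) := by gcongr
      _ = 1 / 2 * (x / (2 * σ)) + 2 * (1 / σ) * (1 / τ) * (τ * y / 8) := by field_simp; ring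
      _ ≤ 1 / 2 * Φ + 2 * (1 / σa) * (1 / τa) * Φ := by gcongr
      _ = _ := by field_simp
  have t3 : |(1 - τ ^ 2) / 16 * y| ≤ 1 / (2 * τa) * Φ := by
    rw [abs_of_nonneg (by positivity)]
    calc (1 - τ ^ 2) / 16 * y ≤ 1 / 16 * y := by gcongr
      _ = 1 / 2 * (1 / τ) * (τ * y / 8) := by field_simp; ring
      _ ≤ 1 / 2 * (1 / τa) * Φ := by gcongr
      _ = _ := by field_simp
  have t4 : |(1 - τ ^ 2) / (16 * τ ^ 2) * w| ≤ 1 / (2 * τa) * Φ := by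
    rw [abs_of_nonneg (by positivity)]
    calc (1 - τ ^ 2) / (16 * τ ^ 2) * w ≤ 1 / (16 * τ ^ 2) * w := by gcongr
      _ = 1 / 2 * (1 / τ) * (w / (8 * τ)) := by field_simp; ring
      _ ≤ 1 / 2 * (1 / τa) * Φ := by gcongr
      _ = _ := by field_simp
  have A : ∀ A B C D E : ℝ, |A + B + C - D + E| ≤ |A| + |B| + |C| + |D| + |E| := by
    intro A B C D E
    refine (abs_add_le _ _).trans (add_le_add_left ?_ _)
    refine (abs_sub _ _).trans (add_le_add_left ?_ _)
    exact abs_add_three _ _ _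
  refine (A _ _ _ _ _).trans ((add_le_add (add_le_add (add_le_add (add_le_add t0 t1) t2) t3)
    t4).trans ?_)
  have f1 : 0 ≤ n * (1 / σa + 1 / (4 * τa)) * Φ := by positivity
  have f2 : 0 ≤ 2 / σa + 1 / 2 + 2 / (σa * τa) + 1 / τa := by positivity
  have f3 : 1 / (2 * τa) * Φ + 1 / (2 * τa) * Φ = 1 / τa * Φ := by field_simp; ring
  linarith

theorem kfpNorm_nonneg (n : ℕ) {t : ℝ} (ht : 0 < t) : 0 ≤ kfpNorm n t := by
  have := tanhHalf_pos ht
  have := bridgeVar_pos ht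
  unfold kfpNorm
  positivity

theorem kfpNorm_le (n : ℕ) {a : ℝ} (ha : 0 < a) : ∃ C : ℝ, ∀ t, a ≤ t → kfpNorm n t ≤ C := by
  have hσa := bridgeVar_pos ha
  have hτa := tanhHalf_pos ha
  refine ⟨(2 * Real.pi * bridgeVar a) ^ (-((n : ℝ) / 2)) *
    (8 * Real.pi * tanhHalf a / 2 ^ 2) ^ (-((n : ℝ) / 2)), fun t hat => ?_⟩
  have ht : 0 < t := ha.trans_le hat
  have hσ : bridgeVar a ≤ bridgeVar t := monotone_bridgeVar hat
  have hτ : tanhHalf a ≤ tanhHalf t := strictMono_tanhHalf.monotone hat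
  have hτ1 := (tanhHalf_lt_one t).le
  have hτ0 := tanhHalf_pos ht
  have hn : -((n : ℝ) / 2) ≤ 0 := by
    have : (0 : ℝ) ≤ (n : ℝ) / 2 := by positivity
    linarith
  unfold kfpNorm
  refine mul_le_mul (Real.rpow_le_rpow_of_nonpos (by positivity) (by gcongr) hn)
    (Real.rpow_le_rpow_of_nonpos (by positivity) ?_ hn) (by positivity) (by positivity)
  have : 1 + tanhHalf t ≤ 2 := by linarith
  gcongr

/-- The dominating function is a Gaussian, hence in `L²`, so it stays integrable after
multiplication by any `L²` function. -/
theorem exists_dominating_kfpKernel_deriv {ε a b : ℝ} (hε : ε ^ 2 = 1) (ha : 0 < a) (hab : a ≤ b)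
    (z' : KSpace n × KSpace n) :
    ∃ D : 𝓢(KSpace n × KSpace n, ℝ), ∀ t ∈ Set.Icc a b, ∀ z,
      |kfpKernel ε t z z' * kfpLogDeriv ε t z z'| ≤ D z := by
  obtain ⟨C, hC0, hC⟩ := abs_kfpLogDeriv_le (n := n) hε ha
  obtain ⟨N, hN⟩ := kfpNorm_le n ha
  obtain ⟨δ, c, hδ, hc⟩ := kfpPhase_coercive hε ha hab z'
  have hN0 : 0 ≤ N := (kfpNorm_nonneg n ha).trans (hN a le_rfl)
  have htg : (fun z : KSpace n × KSpace n => δ / 2 * (‖z.1‖ ^ 2 + ‖z.2‖ ^ 2)).HasTemperateGrowth := by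
    have h := (Function.HasTemperateGrowth.const (δ / 2)).mul ((hasTemperateGrowth_norm_sq_affine
      (ContinuousLinearMap.fst ℝ (KSpace n) (KSpace n)) 0).add (hasTemperateGrowth_norm_sq_affine
      (ContinuousLinearMap.snd ℝ (KSpace n) (KSpace n)) 0))
    refine (congrArg Function.HasTemperateGrowth (funext fun z => ?_)).mp h
    simp
  refine ⟨expNegSchwartz (2 * N * C * Real.exp (c / 2)) _ htg (δ := δ / 2) (c := 0) (by positivity)
    (fun z => by
      have := mul_le_mul_of_nonneg_left (sq_norm_prod_le z) (by positivity : 0 ≤ δ / 2)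
      linarith), fun t ht z => ?_⟩
  have ht0 : 0 < t := ha.trans_le ht.1
  rw [expNegSchwartz_apply, abs_mul, abs_of_pos (kfpKernel_pos ε ht0 z z'), kfpKernel_eq]
  have h1 := hC t ht.1 z z'
  have h2 := hN t ht.1
  have h3 := hc t ht z
  -- Half of the Gaussian decay is spent on absorbing the linear growth in the phase.
  have h4 : 1 + kfpPhase ε t z z' ≤ 2 * Real.exp (kfpPhase ε t z z' / 2) := by
    linarith [Real.add_one_le_exp (kfpPhase ε t z z' / 2)]
  calc kfpNorm n t * Real.exp (-kfpPhase ε t z z') * |kfpLogDeriv ε t z z'|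
      ≤ N * Real.exp (-kfpPhase ε t z z') * (C * (2 * Real.exp (kfpPhase ε t z z' / 2))) := by
        gcongr
        exact h1.trans (by gcongr)
    _ = 2 * N * C * Real.exp (-(kfpPhase ε t z z' / 2)) := by
        have : Real.exp (-kfpPhase ε t z z') * Real.exp (kfpPhase ε t z z' / 2) =
            Real.exp (-(kfpPhase ε t z z' / 2)) := by
          rw [← Real.exp_add]
          ring_nf
        rw [← this]
        ring
    _ ≤ 2 * N * C * (Real.exp (c / 2) * Real.exp (-(δ / 2 * (‖z.1‖ ^ 2 + ‖z.2‖ ^ 2)))) := by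
        rw [← Real.exp_add]
        gcongr
        linarith
    _ = _ := by ring

/-- The time derivative is traded for the spatial operator acting on the kernel, the form in which a
weak equation for `g` can be inserted. -/
theorem hasDerivAt_integral_kfpKernel_mul {ε t : ℝ} (hε : ε ^ 2 = 1) (ht : 0 < t)
    (z' : KSpace n × KSpace n) {g : KSpace n × KSpace n → ℂ} (hg : MemLp g 2 volume) :
    HasDerivAt (fun t => ∫ z, g z * (kfpKernel ε t z z' : ℂ))
      (-∫ z, g z * kfpOp ε (kfpSchwartz hε ht z') z) t := by
  obtain ⟨D, hD⟩ := exists_dominating_kfpKernel_deriv (a := t / 2) (b := 2 * t) hε (by linarith)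
    (by linarith) z'
  have hnhds : Set.Icc (t / 2) (2 * t) ∈ 𝓝 t := Icc_mem_nhds (by linarith) (by linarith)
  have hpos : ∀ s ∈ Set.Icc (t / 2) (2 * t), 0 < s := fun s hs => by linarith [hs.1]
  have key := hasDerivAt_integral_of_dominated_loc_of_deriv_le (μ := volume)
    (F := fun s z => g z * (kfpKernel ε s z z' : ℂ))
    (F' := fun s z => g z * ((kfpKernel ε s z z' * kfpLogDeriv ε s z z' : ℝ) : ℂ))
    (bound := fun z => ‖g z‖ * D z) (x₀ := t) hnhds ?_ ?_ ?_ ?_ ?_ ?_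
  · refine key.2.congr_deriv ?_
    rw [← integral_neg]
    congr 1
    ext z
    rw [kfpOp_kfpSchwartz]
    push_cast
    ring
  · filter_upwards [hnhds] with s hs
    exact hg.1.mul (memLp_kfpKernel_left hε (hpos s hs) z').1
  · exact hg.integrable_mul (memLp_kfpKernel_left hε ht z')
  · have h : (fun z => g z * ((kfpKernel ε t z z' * kfpLogDeriv ε t z z' : ℝ) : ℂ)) =
        fun z => -(g z * kfpOp ε (kfpSchwartz hε ht z') z) := by
      ext z
      rw [kfpOp_kfpSchwartz]
      push_cast
      ring
    rw [h]
    exact (hg.1.mul ((kfpOp ε (kfpSchwartz hε ht z')).memLp 2).1).neg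
  · refine Eventually.of_forall fun z s hs => ?_
    rw [norm_mul, Complex.norm_real, Real.norm_eq_abs]
    gcongr
    exact hD s hs z
  · exact hg.norm.integrable_mul (D.memLp 2)
  · refine Eventually.of_forall fun z s hs => ?_
    exact ((hasDerivAt_kfpKernel ε (hpos s hs) z z').ofReal_comp).const_mul (g z)

end TimeDerivative

/-! ### The semigroup -/

section Pairing

variable {α : Type*} [MeasurableSpace α] {μ : Measure α}

/-- The bilinear pairing `u ↦ ∫ u g` with a square integrable function `g`. -/
def pairingCLM (g : α → ℂ) (hg : MemLp g 2 μ) : Lp ℂ 2 μ →L[ℂ] ℂ :=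
  innerSL ℂ (hg.star).toLp

theorem pairingCLM_apply {g : α → ℂ} (hg : MemLp g 2 μ) (u : Lp ℂ 2 μ) :
    pairingCLM g hg u = ∫ z, u z * g z ∂μ := by
  rw [pairingCLM, innerSL_apply_apply, L2.inner_def]
  apply integral_congr_ae
  filter_upwards [hg.star.coeFn_toLp] with z hz
  rw [hz]
  simp [RCLike.inner_apply]

/-- Fubini. Absolute convergence holds because the Schur bound also controls the operator with
kernel `|k|` applied to `|u|`, which is then paired with `φ` by Hölder. -/
theorem SchurBound.integral_op_mul [SFinite μ] {k k' : α → α → ℝ} {p p' : α → ℝ≥0∞} {A A' : NNReal}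
    (h : SchurBound μ k p A) (h' : SchurBound μ k' p' A') (hk : ∀ z z', k' z z' = k z' z)
    (u φ : Lp ℂ 2 μ) :
    ∫ z, h.op u z * φ z ∂μ = ∫ z, u z * h'.op φ z ∂μ := by
  have e1 : ∫ z, h.op u z * φ z ∂μ = ∫ z, ∫ z', (k z z' : ℂ) * u z' * φ z ∂μ ∂μ := by
    apply integral_congr_ae
    filter_upwards [h.op_apply_ae u] with z hz
    rw [hz, integral_mul_const]
  have e2 : ∫ z, u z * h'.op φ z ∂μ = ∫ z', ∫ z, (k z z' : ℂ) * u z' * φ z ∂μ ∂μ := by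
    apply integral_congr_ae
    filter_upwards [h'.op_apply_ae φ] with z hz
    rw [hz, ← integral_const_mul]
    congr 1
    ext z'
    rw [hk]
    ring
  rw [e1, e2]
  apply integral_integral_swap
  have hm : AEStronglyMeasurable (fun z : α × α => (k z.1 z.2 : ℂ) * u z.2 * φ z.1) (μ.prod μ) :=
    ((Complex.measurable_ofReal.comp h.measurable_kernel).aestronglyMeasurable.mul
      (Lp.aestronglyMeasurable u).comp_snd).mul (Lp.aestronglyMeasurable φ).comp_fst
  refine ⟨hm, ?_⟩
  rw [HasFiniteIntegral]
  have hu := h.rpow_lintegral_sq_le (Lp.aestronglyMeasurable u)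
  have e3 : ∀ z, ∫⁻ z', ‖(k z z' : ℂ) * u z' * φ z‖ₑ ∂μ =
      (∫⁻ z', ‖k z z'‖ₑ * ‖u z'‖ₑ ∂μ) * ‖φ z‖ₑ := by
    intro z
    rw [← lintegral_mul_const' _ _ enorm_ne_top]
    refine lintegral_congr fun z' => ?_
    rw [enorm_mul, enorm_mul, show ‖(k z z' : ℂ)‖ₑ = ‖k z z'‖ₑ by simp [enorm_eq_nnnorm]]
  calc ∫⁻ z, ‖(k z.1 z.2 : ℂ) * u z.2 * φ z.1‖ₑ ∂(μ.prod μ)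
      = ∫⁻ z, ∫⁻ z', ‖(k z z' : ℂ) * u z' * φ z‖ₑ ∂μ ∂μ := lintegral_prod _ hm.enorm
    _ = ∫⁻ z, (∫⁻ z', ‖k z z'‖ₑ * ‖u z'‖ₑ ∂μ) * ‖φ z‖ₑ ∂μ := by simp_rw [e3]
    _ ≤ (∫⁻ z, (∫⁻ z', ‖k z z'‖ₑ * ‖u z'‖ₑ ∂μ) ^ (2 : ℝ) ∂μ) ^ (1 / (2 : ℝ)) *
        (∫⁻ z, ‖φ z‖ₑ ^ (2 : ℝ) ∂μ) ^ (1 / (2 : ℝ)) :=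
        ENNReal.lintegral_mul_le_Lp_mul_Lq μ (by constructor <;> norm_num)
          (h.measurable_lintegral (Lp.aestronglyMeasurable u))
          (Lp.aestronglyMeasurable φ).enorm
    _ < ∞ := by
        simp only [ENNReal.rpow_ofNat]
        rw [← eLpNorm_two_eq]
        exact ENNReal.mul_lt_top (hu.trans_lt (ENNReal.mul_lt_top ENNReal.coe_lt_top
          (Lp.memLp u).2)) (Lp.memLp φ).2

end Pairing

section Semigroup

variable {n : ℕ}

/-- The semigroup generated by `-(ε v·∇ₓ - Δᵥ + |v|²/4 - n/2)`, for `ε = ±1`. -/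
def kfpSemigroup (n : ℕ) (ε t : ℝ) : PhaseL2 n →L[ℂ] PhaseL2 n :=
  if h : 0 < t then (schurBound_kfpKernel (n := n) ε h).op else ContinuousLinearMap.id ℂ _

theorem kfpSemigroup_of_pos (ε : ℝ) {t : ℝ} (ht : 0 < t) :
    kfpSemigroup n ε t = (schurBound_kfpKernel (n := n) ε ht).op := dif_pos ht

theorem kfpSemigroup_of_nonpos (ε : ℝ) {t : ℝ} (ht : t ≤ 0) :
    kfpSemigroup n ε t = ContinuousLinearMap.id ℂ _ := dif_neg ht.not_gt

theorem kfpSemigroup_zero (ε : ℝ) : kfpSemigroup n ε 0 = ContinuousLinearMap.id ℂ _ :=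
  kfpSemigroup_of_nonpos ε le_rfl

theorem norm_kfpSemigroup_apply_le (ε t : ℝ) (u : PhaseL2 n) : ‖kfpSemigroup n ε t u‖ ≤ ‖u‖ := by
  rcases lt_or_ge 0 t with h | h
  · rw [kfpSemigroup_of_pos ε h]
    have := (schurBound_kfpKernel (n := n) ε h).op.le_of_opNorm_le
      (schurBound_kfpKernel (n := n) ε h).norm_op_le u
    simpa using this
  · rw [kfpSemigroup_of_nonpos ε h]
    rfl

/-- Evaluation of `exp (-t P) u` at the point `z`. -/
def kfpEval {ε t : ℝ} (hε : ε ^ 2 = 1) (ht : 0 < t) (z : KSpace n × KSpace n) :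
    PhaseL2 n →L[ℂ] ℂ := pairingCLM _ (memLp_kfpKernel_right hε ht z)

theorem kfpEval_apply {ε t : ℝ} (hε : ε ^ 2 = 1) (ht : 0 < t) (z : KSpace n × KSpace n)
    (u : PhaseL2 n) : kfpEval hε ht z u = ∫ z', u z' * (kfpKernel ε t z z' : ℂ) :=
  pairingCLM_apply _ u

theorem kfpSemigroup_apply_ae {ε t : ℝ} (hε : ε ^ 2 = 1) (ht : 0 < t) (u : PhaseL2 n) :
    kfpSemigroup n ε t u =ᵐ[volume] fun z => kfpEval hε ht z u := by
  rw [kfpSemigroup_of_pos ε ht]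
  filter_upwards [(schurBound_kfpKernel (n := n) ε ht).op_apply_ae u] with z hz
  rw [hz, kfpEval_apply]
  congr 1
  ext z'
  ring

theorem integral_kfpSemigroup_mul (ε t : ℝ) (u φ : PhaseL2 n) :
    ∫ z, kfpSemigroup n ε t u z * φ z = ∫ z, u z * kfpSemigroup n (-ε) t φ z := by
  rcases lt_or_ge 0 t with h | h
  · rw [kfpSemigroup_of_pos _ h, kfpSemigroup_of_pos _ h]
    exact SchurBound.integral_op_mul _ _ (fun z z' => (kfpKernel_swap ε t z' z).symm) u φ
  · rw [kfpSemigroup_of_nonpos _ h, kfpSemigroup_of_nonpos _ h]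
    rfl

theorem integral_kfpKernel_mul_kfpKernel {ε s t : ℝ} (hε : ε ^ 2 = 1) (hs : 0 < s) (ht : 0 < t)
    (z z'' : KSpace n × KSpace n) :
    ∫ z', kfpKernel ε s z z' * kfpKernel ε t z' z'' = kfpKernel ε (s + t) z z'' := by
  have hpos : ∀ z', 0 ≤ kfpKernel ε s z z' * kfpKernel ε t z' z'' := fun z' =>
    (mul_pos (kfpKernel_pos ε hs _ _) (kfpKernel_pos ε ht _ _)).le
  rw [integral_eq_lintegral_of_nonneg_ae (Eventually.of_forall hpos)]
  · have := lintegral_kfpKernel_mul_kfpKernel hε hs ht z z''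
    simp_rw [← Real.enorm_of_nonneg (hpos _)]
    rw [this, Real.enorm_of_nonneg (kfpKernel_pos ε (add_pos hs ht) _ _).le,
      ENNReal.toReal_ofReal (kfpKernel_pos ε (add_pos hs ht) _ _).le]
  · have h1 := (continuous_kfpKernel (n := n) ε s).comp
      (by fun_prop : Continuous fun z' : KSpace n × KSpace n => (z, z'))
    have h2 := (continuous_kfpKernel (n := n) ε t).comp
      (by fun_prop : Continuous fun z' : KSpace n × KSpace n => (z', z''))
    exact (h1.mul h2).aestronglyMeasurable

/-- The semigroup law at every point `z`, not only almost everywhere. By positivity the absolute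
double integral collapses to the kernel at time `s + t`, whose row is in `L²`; this justifies
Fubini. -/
theorem kfpEval_kfpSemigroup {ε s t : ℝ} (hε : ε ^ 2 = 1) (hs : 0 < s) (ht : 0 < t)
    (z : KSpace n × KSpace n) (u : PhaseL2 n) :
    kfpEval hε hs z (kfpSemigroup n ε t u) = kfpEval hε (add_pos hs ht) z u := by
  rw [kfpEval_apply, kfpEval_apply]
  have e1 : ∫ z', kfpSemigroup n ε t u z' * (kfpKernel ε s z z' : ℂ) =
      ∫ z', ∫ z'', u z'' * ((kfpKernel ε s z z' * kfpKernel ε t z' z'' : ℝ) : ℂ) := by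
    apply integral_congr_ae
    filter_upwards [kfpSemigroup_apply_ae hε ht u] with z' hz'
    rw [hz', kfpEval_apply, ← integral_mul_const]
    congr 1
    ext z''
    push_cast
    ring
  rw [e1, integral_integral_swap]
  · congr 1
    ext z''
    rw [integral_const_mul, integral_complex_ofReal, integral_kfpKernel_mul_kfpKernel hε hs ht]
  · have hm : AEStronglyMeasurable (fun w : (KSpace n × KSpace n) × (KSpace n × KSpace n) =>
        u w.2 * ((kfpKernel ε s z w.1 * kfpKernel ε t w.1 w.2 : ℝ) : ℂ))
        (volume.prod volume) := by
      refine (Lp.aestronglyMeasurable u).comp_snd.mul (Continuous.aestronglyMeasurable ?_)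
      have h1 := (continuous_kfpKernel (n := n) ε s).comp
        (by fun_prop : Continuous fun w : (KSpace n × KSpace n) × (KSpace n × KSpace n) => (z, w.1))
      have h2 := continuous_kfpKernel (n := n) ε t
      exact Complex.continuous_ofReal.comp (h1.mul h2)
    refine ⟨hm, ?_⟩
    rw [HasFiniteIntegral]
    refine lt_of_eq_of_lt (lintegral_prod_symm _ hm.enorm) ?_
    have e2 : ∀ z'', ∫⁻ z', ‖u z'' * ((kfpKernel ε s z z' * kfpKernel ε t z' z'' : ℝ) : ℂ)‖ₑ =
        ‖u z'' * (kfpKernel ε (s + t) z z'' : ℂ)‖ₑ := by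
      intro z''
      have e3 : ∀ r : ℝ, ‖(r : ℂ)‖ₑ = ‖r‖ₑ := fun r => by simp [enorm_eq_nnnorm]
      simp_rw [enorm_mul, e3]
      rw [lintegral_const_mul' _ _ enorm_ne_top]
      simp_rw [lintegral_kfpKernel_mul_kfpKernel hε hs ht]
    refine lt_of_eq_of_lt (lintegral_congr e2) ?_
    exact ((Lp.memLp u).integrable_mul (memLp_kfpKernel_right hε (add_pos hs ht) z)).2

theorem kfpSemigroup_add {ε s t : ℝ} (hε : ε ^ 2 = 1) (hs : 0 ≤ s) (ht : 0 ≤ t) :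
    kfpSemigroup n ε (s + t) = (kfpSemigroup n ε s).comp (kfpSemigroup n ε t) := by
  rcases hs.eq_or_lt with rfl | hs
  · rw [zero_add, kfpSemigroup_zero, ContinuousLinearMap.id_comp]
  rcases ht.eq_or_lt with rfl | ht
  · rw [add_zero, kfpSemigroup_zero, ContinuousLinearMap.comp_id]
  ext1 u
  apply Lp.ext
  filter_upwards [kfpSemigroup_apply_ae hε (add_pos hs ht) u,
    kfpSemigroup_apply_ae hε hs (kfpSemigroup n ε t u)] with z h1 h2
  rw [h1, ContinuousLinearMap.comp_apply, h2, kfpEval_kfpSemigroup hε hs ht]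

/-! ### Strong continuity -/

/-- Rescaling to a standard Gaussian moves all dependence on `s` into the argument of `F`, so that
dominated convergence applies as `s → 0`. -/
theorem integral_heatKernel_sub_mul {s : ℝ} (hs : 0 < s) (c : KSpace n) (F : KSpace n → ℂ) :
    ∫ y, (heatKernel s (c - y) : ℂ) * F y =
      ∫ y, (heatKernel 1 y : ℂ) * F (c - Real.sqrt s • y) := by
  have h1 := integral_sub_left_eq_self (fun y => (heatKernel s (c - y) : ℂ) * F y) volume c
  rw [← h1]
  simp only [sub_sub_cancel]
  have h2 := Measure.integral_comp_smul volume
    (fun y : KSpace n => (heatKernel s y : ℂ) * F (c - y)) (Real.sqrt s)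
  have hr : 0 < Real.sqrt s := Real.sqrt_pos.mpr hs
  have h3 : ∀ y : KSpace n, heatKernel 1 y = Real.sqrt s ^ n * heatKernel s (Real.sqrt s • y) := by
    intro y
    unfold heatKernel
    rw [norm_smul, mul_pow, Real.norm_eq_abs, sq_abs, Real.sq_sqrt hs.le, ← mul_assoc, mul_one,
      mul_one]
    congr 1
    · rw [Real.mul_rpow (by positivity) hs.le, mul_left_comm,
        show s ^ (-((n : ℝ) / 2)) = (Real.sqrt s ^ n)⁻¹ by
          rw [Real.rpow_neg hs.le, Real.sqrt_eq_rpow, ← Real.rpow_natCast, ← Real.rpow_mul hs.le]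
          congr 2
          ring, mul_inv_cancel₀ (by positivity), mul_one]
    · congr 2
      field_simp
  simp_rw [h3]
  push_cast
  simp_rw [mul_assoc]
  rw [integral_const_mul, h2, finrank_euclideanSpace_fin, abs_of_pos (by positivity)]
  rw [Complex.real_smul, ← mul_assoc]
  push_cast
  rw [mul_inv_cancel₀ (by exact_mod_cast (pow_pos hr n).ne'), one_mul]

theorem ofReal_integral_heatKernel_one : ∫ y : KSpace n, (heatKernel 1 y : ℂ) = 1 := by
  rw [integral_complex_ofReal, integral_heatKernel one_pos, Complex.ofReal_one]

/-- Gaussian averages of a bounded continuous function against two independent Gaussians. -/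
theorem tendsto_gaussian_average {h : KSpace n × KSpace n → ℂ} (hc : Continuous h) {C : ℝ}
    (hC : ∀ z, ‖h z‖ ≤ C) {G : ℝ → KSpace n → KSpace n → KSpace n × KSpace n}
    (hG : Continuous fun p : ℝ × KSpace n × KSpace n => G p.1 p.2.1 p.2.2)
    {z : KSpace n × KSpace n} (hz : ∀ w y, G 0 w y = z) :
    Tendsto (fun t => ∫ w, (heatKernel 1 w : ℂ) * ∫ y, (heatKernel 1 y : ℂ) * h (G t w y))
      (𝓝 0) (𝓝 (h z)) := by
  have hγ : Integrable fun y : KSpace n => heatKernel 1 y := integrable_heatKernel one_pos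
  have hγc : Continuous fun y : KSpace n => (heatKernel 1 y : ℂ) :=
    Complex.continuous_ofReal.comp (continuous_heatKernel 1)
  have hnorm : ∀ y : KSpace n, ‖(heatKernel 1 y : ℂ)‖ = heatKernel 1 y := fun y => by
    rw [Complex.norm_real, Real.norm_of_nonneg (heatKernel_pos one_pos y).le]
  have hpos : ∀ y : KSpace n, 0 ≤ heatKernel 1 y := fun y => (heatKernel_pos one_pos y).le
  have hcomp : ∀ t w, Continuous fun y => (heatKernel 1 y : ℂ) * h (G t w y) := fun t w =>
    hγc.mul (hc.comp (hG.comp (by fun_prop : Continuous fun y => (t, w, y))))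
  have hbd : ∀ t w y, ‖(heatKernel 1 y : ℂ) * h (G t w y)‖ ≤ heatKernel 1 y * C := by
    intro t w y
    rw [norm_mul, hnorm]
    exact mul_le_mul_of_nonneg_left (hC _) (hpos y)
  have inner : ∀ w, Tendsto (fun t => ∫ y, (heatKernel 1 y : ℂ) * h (G t w y)) (𝓝 0)
      (𝓝 (h z)) := by
    intro w
    have : ∫ y : KSpace n, (heatKernel 1 y : ℂ) * h z = h z := by
      rw [integral_mul_const, ofReal_integral_heatKernel_one, one_mul]
    rw [← this]
    refine tendsto_integral_filter_of_dominated_convergence (fun y => heatKernel 1 y * C)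
      (Eventually.of_forall fun t => (hcomp t w).aestronglyMeasurable)
      (Eventually.of_forall fun t => Eventually.of_forall (hbd t w)) (hγ.mul_const C)
      (Eventually.of_forall fun y => ?_)
    have h1 : Continuous fun t => (heatKernel 1 y : ℂ) * h (G t w y) :=
      continuous_const.mul (hc.comp (hG.comp (by fun_prop : Continuous fun t : ℝ => (t, w, y))))
    have h2 := h1.tendsto 0
    rwa [hz] at h2
  have : ∫ w : KSpace n, (heatKernel 1 w : ℂ) * h z = h z := by
    rw [integral_mul_const, ofReal_integral_heatKernel_one, one_mul]
  conv => rhs; rw [← this]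
  refine tendsto_integral_filter_of_dominated_convergence (fun y => heatKernel 1 y * C)
    (Eventually.of_forall fun t => ?_) (Eventually.of_forall fun t => Eventually.of_forall fun w => ?_)
    (hγ.mul_const C) (Eventually.of_forall fun w => (inner w).const_mul _)
  · refine hγc.aestronglyMeasurable.mul ?_
    have h1 : Continuous fun p : KSpace n × KSpace n => (heatKernel 1 p.2 : ℂ) * h (G t p.1 p.2) :=
      (hγc.comp continuous_snd).mul (hc.comp (hG.comp
        (by fun_prop : Continuous fun p : KSpace n × KSpace n => (t, p.1, p.2))))
    exact h1.stronglyMeasurable.integral_prod_right'.aestronglyMeasurable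
  · rw [norm_mul, hnorm]
    refine mul_le_mul_of_nonneg_left ?_ (hpos w)
    refine (norm_integral_le_of_norm_le (hγ.mul_const C) (Eventually.of_forall (hbd t w))).trans_eq ?_
    rw [integral_mul_const, integral_heatKernel one_pos, one_mul]

end Semigroup

section Continuity

variable {n : ℕ}

theorem one_sub_div_one_add_tanhHalf (t : ℝ) :
    (1 - tanhHalf t) / (1 + tanhHalf t) = Real.exp (-t) := by
  unfold tanhHalf
  have := Real.exp_pos (-t)
  have h : 1 + (1 - Real.exp (-t)) / (1 + Real.exp (-t)) = 2 / (1 + Real.exp (-t)) := by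
    field_simp
    ring
  rw [h]
  field_simp
  ring

theorem four_mul_tanhHalf_div (t : ℝ) :
    4 * tanhHalf t / (1 + tanhHalf t) ^ 2 = 1 - Real.exp (-t) ^ 2 := by
  unfold tanhHalf
  have := Real.exp_pos (-t)
  have h : 1 + (1 - Real.exp (-t)) / (1 + Real.exp (-t)) = 2 / (1 + Real.exp (-t)) := by
    field_simp
    ring
  rw [h]
  field_simp
  ring

/-- The end point of the Langevin trajectory issued from `z`, in terms of two standard Gaussian
vectors. -/
def langevinPoint (ε : ℝ) (z : KSpace n × KSpace n) (t : ℝ) (w y : KSpace n) :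
    KSpace n × KSpace n :=
  (z.1 - (ε * tanhHalf t) • (z.2 + (Real.exp (-t) • z.2 - Real.sqrt (1 - Real.exp (-t) ^ 2) • w)) -
      Real.sqrt (bridgeVar t) • y,
    Real.exp (-t) • z.2 - Real.sqrt (1 - Real.exp (-t) ^ 2) • w)

theorem continuous_langevinPoint (ε : ℝ) (z : KSpace n × KSpace n) :
    Continuous fun p : ℝ × KSpace n × KSpace n => langevinPoint ε z p.1 p.2.1 p.2.2 := by
  unfold langevinPoint
  have := continuous_tanhHalf
  have := continuous_bridgeVar
  fun_prop

theorem langevinPoint_zero (ε : ℝ) (z : KSpace n × KSpace n) (w y : KSpace n) :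
    langevinPoint ε z 0 w y = z := by
  simp [langevinPoint, tanhHalf_zero, bridgeVar_zero]

/-- After division by the ground state the kernel is a probability density: the law of
`langevinPoint`, with `w` and `y` independent standard Gaussians. -/
theorem integral_mul_kfpKernel_eq {ε t : ℝ} (hε : ε ^ 2 = 1) (ht : 0 < t)
    (z : KSpace n × KSpace n) {h : KSpace n × KSpace n → ℂ}
    (hh : MemLp (fun z => (groundState z.2 : ℂ) * h z) 2 volume) :
    ∫ z', ((groundState z'.2 : ℂ) * h z') * (kfpKernel ε t z z' : ℂ) =
      (groundState z.2 : ℂ) * ∫ w, (heatKernel 1 w : ℂ) *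
        ∫ y, (heatKernel 1 y : ℂ) * h (langevinPoint ε z t w y) := by
  have hτ := tanhHalf_pos ht
  have hi : Integrable (fun z' => ((groundState z'.2 : ℂ) * h z') * (kfpKernel ε t z z' : ℂ))
      ((volume : Measure (KSpace n)).prod volume) :=
    hh.integrable_mul (memLp_kfpKernel_right hε ht z)
  rw [Measure.volume_eq_prod, integral_prod_symm _ hi]
  have hs : 0 < 1 - Real.exp (-t) ^ 2 := by
    rw [← four_mul_tanhHalf_div]
    positivity
  have h1 : ∀ w y : KSpace n, ((groundState w : ℂ) * h (y, w)) * (kfpKernel ε t z (y, w) : ℂ) =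
      ((groundState z.2 : ℂ) * (heatKernel (1 - Real.exp (-t) ^ 2) (Real.exp (-t) • z.2 - w) : ℂ)) *
        ((heatKernel (bridgeVar t) ((z.1 - (ε * tanhHalf t) • (z.2 + w)) - y) : ℂ) * h (y, w)) := by
    intro w y
    have h2 := mehlerKernel_mul_groundState hτ z.2 w
    rw [four_mul_tanhHalf_div, one_sub_div_one_add_tanhHalf, ← heatKernel_neg, neg_sub] at h2
    have h3 : (mehlerKernel (tanhHalf t) z.2 w : ℂ) * (groundState w : ℂ) = (groundState z.2 : ℂ) *
      (heatKernel (1 - Real.exp (-t) ^ 2) (Real.exp (-t) • z.2 - w) : ℂ) := by exact_mod_cast h2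
    rw [← h3]
    unfold kfpKernel kfpShift
    simp only
    rw [sub_right_comm z.1 y]
    push_cast
    ring
  simp_rw [h1]
  have h4 : ∀ w : KSpace n, ∫ y, ((groundState z.2 : ℂ) *
      (heatKernel (1 - Real.exp (-t) ^ 2) (Real.exp (-t) • z.2 - w) : ℂ)) *
        ((heatKernel (bridgeVar t) ((z.1 - (ε * tanhHalf t) • (z.2 + w)) - y) : ℂ) * h (y, w)) =
      (groundState z.2 : ℂ) * ((heatKernel (1 - Real.exp (-t) ^ 2) (Real.exp (-t) • z.2 - w) : ℂ) *
        ∫ y, (heatKernel 1 y : ℂ) *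
          h ((z.1 - (ε * tanhHalf t) • (z.2 + w)) - Real.sqrt (bridgeVar t) • y, w)) := by
    intro w
    rw [integral_const_mul, mul_assoc]
    rw [integral_heatKernel_sub_mul (bridgeVar_pos ht) _ (fun y => h (y, w))]
  simp_rw [h4]
  rw [integral_const_mul]
  congr 1
  rw [integral_heatKernel_sub_mul hs _ (fun w => ∫ y, (heatKernel 1 y : ℂ) *
          h ((z.1 - (ε * tanhHalf t) • (z.2 + w)) - Real.sqrt (bridgeVar t) • y, w))]
  rfl

theorem norm_heatKernel_average_le {F : KSpace n → ℂ} {C : ℝ} (hF : ∀ y, ‖F y‖ ≤ C) :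
    ‖∫ y, (heatKernel 1 y : ℂ) * F y‖ ≤ C := by
  refine (norm_integral_le_of_norm_le (g := fun y => heatKernel 1 y * C)
    ((integrable_heatKernel one_pos).mul_const C) (Eventually.of_forall fun y => ?_)).trans_eq ?_
  · rw [norm_mul, Complex.norm_real, Real.norm_of_nonneg (heatKernel_pos one_pos y).le]
    exact mul_le_mul_of_nonneg_left (hF y) (heatKernel_pos one_pos y).le
  · rw [integral_mul_const, integral_heatKernel one_pos, one_mul]

theorem tendsto_inner_kfpSemigroup {ε : ℝ} (hε : ε ^ 2 = 1) {g : KSpace n × KSpace n → ℂ}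
    (hg : Continuous g) (hgs : HasCompactSupport g) (hg2 : MemLp g 2 volume) :
    Tendsto (fun t => inner ℂ hg2.toLp (kfpSemigroup n ε t hg2.toLp)) (𝓝[>] 0)
      (𝓝 (inner ℂ hg2.toLp hg2.toLp)) := by
  have hinner : ∀ w : PhaseL2 n, inner ℂ hg2.toLp w = ∫ z, w z * star (g z) := by
    intro w
    rw [L2.inner_def]
    apply integral_congr_ae
    filter_upwards [hg2.coeFn_toLp] with z hz
    rw [hz]
    simp [RCLike.inner_apply]
  -- Compact support of `g` keeps this quotient bounded, although the inverse ground state is not.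
  set h : KSpace n × KSpace n → ℂ := fun z => ((groundState z.2)⁻¹ : ℝ) * g z with hh
  have hgh : ∀ z, (groundState z.2 : ℂ) * h z = g z := by
    intro z
    have : (groundState z.2 : ℂ) ≠ 0 := by exact_mod_cast (groundState_pos z.2).ne'
    simp only [hh]
    push_cast
    field_simp
  have hhc : Continuous h := by
    refine Continuous.mul (Complex.continuous_ofReal.comp ?_) hg
    exact (continuous_groundState.comp continuous_snd).inv₀ fun z => (groundState_pos z.2).ne'
  obtain ⟨C, hC⟩ := hhc.bounded_above_of_compact_support hgs.mul_left
  simp_rw [hinner]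
  have e0 : ∫ z, hg2.toLp g z * star (g z) = ∫ z, g z * star (g z) := by
    apply integral_congr_ae
    filter_upwards [hg2.coeFn_toLp] with z hz
    rw [hz]
  rw [e0]
  have e1 : ∀ t, 0 < t → ∀ z, ∫ z', hg2.toLp g z' * (kfpKernel ε t z z' : ℂ) =
      (groundState z.2 : ℂ) * ∫ w, (heatKernel 1 w : ℂ) *
        ∫ y, (heatKernel 1 y : ℂ) * h (langevinPoint ε z t w y) := by
    intro t ht z
    rw [← integral_mul_kfpKernel_eq hε ht z (by simpa only [hgh] using hg2)]
    apply integral_congr_ae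
    filter_upwards [hg2.coeFn_toLp] with z' hz'
    rw [hz', hgh]
  have e2 : ∀ t, 0 < t → kfpSemigroup n ε t hg2.toLp =ᵐ[volume] fun z =>
      (groundState z.2 : ℂ) * ∫ w, (heatKernel 1 w : ℂ) *
        ∫ y, (heatKernel 1 y : ℂ) * h (langevinPoint ε z t w y) := by
    intro t ht
    filter_upwards [kfpSemigroup_apply_ae hε ht hg2.toLp] with z hz
    rw [hz, kfpEval_apply, e1 t ht]
  have key : Tendsto (fun t => ∫ z, ((groundState z.2 : ℂ) * ∫ w, (heatKernel 1 w : ℂ) *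
        ∫ y, (heatKernel 1 y : ℂ) * h (langevinPoint ε z t w y)) * star (g z)) (𝓝[>] 0)
      (𝓝 (∫ z, g z * star (g z))) := by
    refine tendsto_integral_filter_of_dominated_convergence (fun z => C * ‖g z‖) ?_ ?_ ?_ ?_
    · filter_upwards [self_mem_nhdsWithin] with t ht
      exact ((Lp.aestronglyMeasurable _).congr (e2 t ht)).mul hg.star.aestronglyMeasurable
    · refine Eventually.of_forall fun t => Eventually.of_forall fun z => ?_
      rw [norm_mul, norm_mul, norm_star, Complex.norm_real,
        Real.norm_of_nonneg (groundState_pos z.2).le]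
      refine mul_le_mul_of_nonneg_right ?_ (norm_nonneg _)
      have h1 : groundState z.2 ≤ 1 := by
        unfold groundState
        rw [Real.exp_le_one_iff]
        have : 0 ≤ ‖z.2‖ ^ 2 := by positivity
        linarith
      have h2 : ‖∫ w, (heatKernel 1 w : ℂ) *
          ∫ y, (heatKernel 1 y : ℂ) * h (langevinPoint ε z t w y)‖ ≤ C :=
        norm_heatKernel_average_le fun w => norm_heatKernel_average_le fun y => hC _
      calc _ ≤ 1 * C := mul_le_mul h1 h2 (norm_nonneg _) zero_le_one
        _ = C := one_mul C
    · exact (hg.integrable_of_hasCompactSupport hgs).norm.const_mul C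
    · refine Eventually.of_forall fun z => ?_
      have h1 := tendsto_gaussian_average hhc hC (continuous_langevinPoint ε z)
        (langevinPoint_zero ε z)
      have h2 := ((h1.const_mul (groundState z.2 : ℂ)).mul_const (star (g z))).mono_left
        (nhdsWithin_le_nhds (s := Set.Ioi 0))
      rwa [hgh] at h2
  refine key.congr' ?_
  filter_upwards [self_mem_nhdsWithin] with t ht
  apply integral_congr_ae
  filter_upwards [e2 t ht] with z hz
  rw [hz]

/-- For vectors no longer than `u`, `‖u - f i‖² ≤ 2‖u‖² - 2 Re ⟪u, f i⟫`. For a contraction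
semigroup it is thus enough to test against `u` itself. -/
theorem tendsto_of_tendsto_inner {H : Type*} [NormedAddCommGroup H] [InnerProductSpace ℂ H]
    {ι : Type*} {l : Filter ι} {f : ι → H} {u : H} (hn : ∀ i, ‖f i‖ ≤ ‖u‖)
    (h : Tendsto (fun i => inner ℂ u (f i)) l (𝓝 (inner ℂ u u))) : Tendsto f l (𝓝 u) := by
  have h1 : Tendsto (fun i => 2 * ‖u‖ ^ 2 - 2 * (inner ℂ u (f i)).re) l (𝓝 0) := by
    have h2 := (((Complex.continuous_re.tendsto _).comp h).const_mul 2).const_sub (2 * ‖u‖ ^ 2)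
    have h3 : (inner ℂ u u).re = ‖u‖ ^ 2 := by
      have := inner_self_eq_norm_sq (𝕜 := ℂ) u
      exact this
    rw [h3, sub_self] at h2
    exact h2
  have h4 : Tendsto (fun i => ‖u - f i‖ ^ 2) l (𝓝 0) := by
    refine squeeze_zero (fun i => by positivity) (fun i => ?_) h1
    rw [norm_sub_sq (𝕜 := ℂ)]
    have := pow_le_pow_left₀ (norm_nonneg _) (hn i) 2
    change ‖u‖ ^ 2 - 2 * (inner ℂ u (f i)).re + ‖f i‖ ^ 2 ≤ _
    linarith
  have h5 : Tendsto (fun i => ‖u - f i‖) l (𝓝 0) := by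
    have := (Real.continuous_sqrt.tendsto 0).comp h4
    rw [Real.sqrt_zero] at this
    refine this.congr fun i => ?_
    simp [Real.sqrt_sq]
  rw [tendsto_iff_norm_sub_tendsto_zero]
  exact h5.congr fun i => norm_sub_rev _ _

theorem tendsto_kfpSemigroup_zero {ε : ℝ} (hε : ε ^ 2 = 1) (u : PhaseL2 n) :
    Tendsto (fun t => kfpSemigroup n ε t u) (𝓝[>] 0) (𝓝 u) := by
  rw [Metric.tendsto_nhds]
  intro δ hδ
  obtain ⟨g, hgs, hle, hgc, hg2⟩ := (Lp.memLp u).exists_hasCompactSupport_eLpNorm_sub_le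
    (by norm_num) (ε := ENNReal.ofReal (δ / 3)) (by simpa using hδ)
  have h1 : ‖u - hg2.toLp‖ ≤ δ / 3 := by
    have e : u - hg2.toLp = ((Lp.memLp u).sub hg2).toLp := by
      rw [MemLp.toLp_sub (Lp.memLp u), Lp.toLp_coeFn]
    rw [e, Lp.norm_toLp]
    exact ENNReal.toReal_le_of_le_ofReal (by positivity) hle
  have h2 := tendsto_of_tendsto_inner (f := fun t => kfpSemigroup n ε t hg2.toLp)
    (fun t => norm_kfpSemigroup_apply_le ε t _) (tendsto_inner_kfpSemigroup hε hgc hgs hg2)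
  rw [Metric.tendsto_nhds] at h2
  filter_upwards [h2 (δ / 3) (by positivity)] with t ht
  rw [dist_eq_norm] at ht ⊢
  have h3 := norm_kfpSemigroup_apply_le ε t (u - hg2.toLp)
  rw [map_sub] at h3
  calc ‖kfpSemigroup n ε t u - u‖
      = ‖(kfpSemigroup n ε t u - kfpSemigroup n ε t hg2.toLp) +
          (kfpSemigroup n ε t hg2.toLp - hg2.toLp) - (u - hg2.toLp)‖ := by
        congr 1
        abel
    _ ≤ ‖kfpSemigroup n ε t u - kfpSemigroup n ε t hg2.toLp‖ +
          ‖kfpSemigroup n ε t hg2.toLp - hg2.toLp‖ + ‖u - hg2.toLp‖ :=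
        (norm_sub_le _ _).trans (add_le_add_left (norm_add_le _ _) _)
    _ < δ := by linarith

/-- Setting the operator equal to the identity for `t ≤ 0` gives continuity on all of `ℝ`, so that
two-sided calculus applies at `0`. Contractivity reduces every increment to one that starts at time
`0`. -/
theorem continuous_kfpSemigroup {ε : ℝ} (hε : ε ^ 2 = 1) (u : PhaseL2 n) :
    Continuous fun t => kfpSemigroup n ε t u := by
  have hmax : ∀ t, kfpSemigroup n ε t = kfpSemigroup n ε (max t 0) := by
    intro t
    rcases le_total t 0 with h | h
    · rw [max_eq_right h, kfpSemigroup_zero, kfpSemigroup_of_nonpos ε h]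
    · rw [max_eq_left h]
  have hle : ∀ s t : ℝ, 0 ≤ s → s ≤ t → ‖kfpSemigroup n ε t u - kfpSemigroup n ε s u‖ ≤
      ‖kfpSemigroup n ε (t - s) u - u‖ := by
    intro s t hs hst
    have h1 : kfpSemigroup n ε t = (kfpSemigroup n ε s).comp (kfpSemigroup n ε (t - s)) := by
      rw [← kfpSemigroup_add hε hs (by linarith)]
      congr 1
      ring
    rw [h1, ContinuousLinearMap.comp_apply, ← map_sub]
    exact norm_kfpSemigroup_apply_le ε s _
  have habs : ∀ s t : ℝ, ‖kfpSemigroup n ε t u - kfpSemigroup n ε s u‖ ≤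
      ‖kfpSemigroup n ε |max t 0 - max s 0| u - u‖ := by
    intro s t
    rw [hmax s, hmax t]
    rcases le_total (max s 0) (max t 0) with h | h
    · rw [abs_of_nonneg (by linarith)]
      exact hle _ _ (le_max_right _ _) h
    · rw [abs_of_nonpos (by linarith), neg_sub, norm_sub_rev]
      exact hle _ _ (le_max_right _ _) h
  have hN : Tendsto (fun r => ‖kfpSemigroup n ε r u - u‖) (𝓝 0) (𝓝 0) := by
    have h1 : Tendsto (fun r => ‖kfpSemigroup n ε r u - u‖) (𝓝[>] 0) (𝓝 0) :=
      tendsto_iff_norm_sub_tendsto_zero.mp (tendsto_kfpSemigroup_zero hε u)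
    have h2 : Tendsto (fun r => ‖kfpSemigroup n ε r u - u‖) (𝓝[≤] 0) (𝓝 0) := by
      refine (tendsto_const_nhds (x := (0 : ℝ))).congr' ?_
      filter_upwards [self_mem_nhdsWithin] with r hr
      rw [kfpSemigroup_of_nonpos ε hr]
      simp
    have h3 := h2.sup h1
    rwa [nhdsLE_sup_nhdsGT] at h3
  rw [continuous_iff_continuousAt]
  intro s
  rw [ContinuousAt, tendsto_iff_norm_sub_tendsto_zero]
  refine squeeze_zero (fun _ => norm_nonneg _) (fun t => habs s t) (hN.comp ?_)
  have hc : Continuous fun t : ℝ => |max t 0 - max s 0| := by fun_prop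
  have := hc.tendsto s
  simpa using this

end Continuity

/-! ### The generator -/

section Generator

variable {n : ℕ}

theorem eq_zero_of_kfpSemigroup_eq_zero {ε : ℝ} (hε : ε ^ 2 = 1) {w : PhaseL2 n}
    (h : ∀ c, 0 < c → kfpSemigroup n ε c w = 0) : w = 0 := by
  refine tendsto_nhds_unique (tendsto_kfpSemigroup_zero hε w) ?_
  refine (tendsto_const_nhds (x := (0 : PhaseL2 n))).congr' ?_
  filter_upwards [self_mem_nhdsWithin] with c hc
  exact (h c hc).symm

/-- The transposed kernel appears here as a function of its first variable, the form to which
`hasDerivAt_integral_kfpKernel_mul` applies. -/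
theorem kfpEval_kfpSemigroup_of_nonneg {ε c r : ℝ} (hε : ε ^ 2 = 1) (hc : 0 < c) (hr : 0 ≤ r)
    (z : KSpace n × KSpace n) (u : PhaseL2 n) :
    kfpEval hε hc z (kfpSemigroup n ε r u) =
      ∫ z', u z' * (kfpKernel (-ε) (c + r) z' z : ℂ) := by
  simp_rw [← kfpKernel_swap ε (c + r) z]
  rcases hr.eq_or_lt with rfl | hr
  · rw [kfpSemigroup_zero, add_zero, ContinuousLinearMap.id_apply, kfpEval_apply]
  · rw [kfpEval_kfpSemigroup hε hc hr, kfpEval_apply]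

/-- If the equation `P u = f` holds when tested against the kernels, then `u` is an orbit-wise
solution: `exp (-b P) u - u = - ∫₀ᵇ exp (-r P) f dr`. -/
theorem kfpSemigroup_sub_eq_integral {ε : ℝ} (hε : ε ^ 2 = 1) (hε' : (-ε) ^ 2 = 1)
    {u f : PhaseL2 n}
    (H : ∀ (a : ℝ) (ha : 0 < a) (z' : KSpace n × KSpace n),
      ∫ z, u z * kfpOp (-ε) (kfpSchwartz hε' ha z') z = ∫ z, f z * kfpSchwartz hε' ha z' z)
    {b : ℝ} (hb : 0 ≤ b) :
    kfpSemigroup n ε b u - u = -∫ r in (0 : ℝ)..b, kfpSemigroup n ε r f := by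
  rw [← add_eq_zero_iff_eq_neg]
  -- Smoothing by the semigroup at time `c > 0` keeps the kernel time `c + r` positive on the closed
  -- interval `[0, b]`. The claim becomes the fundamental theorem of calculus for scalar functions
  -- of `r`, and `c → 0` removes the smoothing.
  refine eq_zero_of_kfpSemigroup_eq_zero hε fun c hc => ?_
  apply Lp.ext
  filter_upwards [kfpSemigroup_apply_ae hε hc (kfpSemigroup n ε b u - u +
    ∫ r in (0 : ℝ)..b, kfpSemigroup n ε r f), Lp.coeFn_zero ℂ 2 volume] with z h1 h2
  rw [h1, h2, Pi.zero_apply, map_add, map_sub]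
  have hcont := continuous_kfpSemigroup hε f
  rw [← (kfpEval hε hc z).intervalIntegral_comp_comm (hcont.intervalIntegrable 0 b)]
  have hderiv : ∀ r ∈ Set.uIcc 0 b, HasDerivAt
      (fun r => ∫ z', u z' * (kfpKernel (-ε) (c + r) z' z : ℂ))
      (-kfpEval hε hc z (kfpSemigroup n ε r f)) r := by
    intro r hr
    rw [Set.uIcc_of_le hb] at hr
    have hcr : 0 < c + r := by linarith [hr.1]
    have h3 := hasDerivAt_integral_kfpKernel_mul hε' hcr z (Lp.memLp u)
    have h4 := h3.comp_const_add c r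
    refine h4.congr_deriv ?_
    rw [kfpEval_kfpSemigroup_of_nonneg hε hc hr.1, H (c + r) hcr z]
    simp_rw [kfpSchwartz_apply]
  have hint : IntervalIntegrable (fun r => -kfpEval hε hc z (kfpSemigroup n ε r f)) volume 0 b :=
    (((kfpEval hε hc z).continuous.comp hcont).neg).intervalIntegrable 0 b
  have hftc := intervalIntegral.integral_eq_sub_of_hasDerivAt hderiv hint
  rw [intervalIntegral.integral_neg] at hftc
  have e0 := kfpEval_kfpSemigroup_of_nonneg hε hc le_rfl z u
  rw [kfpSemigroup_zero, ContinuousLinearMap.id_apply] at e0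
  rw [kfpEval_kfpSemigroup_of_nonneg hε hc hb, e0, ← hftc]
  ring

theorem tendsto_slope_kfpSemigroup {ε : ℝ} (hε : ε ^ 2 = 1) (hε' : (-ε) ^ 2 = 1)
    {u f : PhaseL2 n}
    (H : ∀ (a : ℝ) (ha : 0 < a) (z' : KSpace n × KSpace n),
      ∫ z, u z * kfpOp (-ε) (kfpSchwartz hε' ha z') z = ∫ z, f z * kfpSchwartz hε' ha z' z) :
    Tendsto (fun t : ℝ => t⁻¹ • (kfpSemigroup n ε t u - u)) (𝓝[>] 0) (𝓝 (-f)) := by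
  have hd : HasDerivAt (fun t => ∫ r in (0 : ℝ)..t, kfpSemigroup n ε r f) f 0 := by
    have := ((continuous_kfpSemigroup hε f).integral_hasStrictDerivAt 0 0).hasDerivAt
    rwa [kfpSemigroup_zero] at this
  have h1 := hd.tendsto_slope_zero_right.neg
  refine h1.congr' ?_
  filter_upwards [self_mem_nhdsWithin] with t ht
  rw [zero_add, intervalIntegral.integral_same, sub_zero, ← smul_neg,
    kfpSemigroup_sub_eq_integral hε hε' H (le_of_lt ht)]

/-- The difference quotient is moved by duality from `u` to the test function, which is
differentiable along the transposed semigroup. -/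
theorem isFreeKFP_of_tendsto {u f : PhaseL2 n}
    (h : Tendsto (fun t : ℝ => t⁻¹ • (kfpSemigroup n 1 t u - u)) (𝓝[>] 0) (𝓝 (-f))) :
    IsFreeKFP u f := by
  intro φ
  simp_rw [freeKFPTranspose_eq]
  set Φ : PhaseL2 n := φ.toLp 2 with hΦ
  set Ψ : PhaseL2 n := (kfpOp (-1) φ).toLp 2 with hΨ
  have hφ : ∀ w : PhaseL2 n, ∫ z, w z * φ z = ∫ z, w z * Φ z := by
    intro w
    apply integral_congr_ae
    filter_upwards [φ.coeFn_toLp 2] with z hz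
    rw [hz]
  have h1 : Tendsto (fun t : ℝ => t⁻¹ • (kfpSemigroup n (-1) t Φ - Φ)) (𝓝[>] 0) (𝓝 (-Ψ)) := by
    -- For a Schwartz function the equation tested against kernels is ordinary integration by parts.
    refine tendsto_slope_kfpSemigroup (by norm_num) (by norm_num) fun a ha z' => ?_
    have e1 : ∀ g : KSpace n × KSpace n → ℂ, ∫ z, Φ z * g z = ∫ z, φ z * g z := by
      intro g
      apply integral_congr_ae
      filter_upwards [φ.coeFn_toLp 2] with z hz
      rw [hz]
    have e2 : ∀ g : KSpace n × KSpace n → ℂ, ∫ z, Ψ z * g z = ∫ z, kfpOp (-1) φ z * g z := by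
      intro g
      apply integral_congr_ae
      filter_upwards [(kfpOp (-1) φ).coeFn_toLp 2] with z hz
      rw [hz]
    rw [e1, e2, integral_mul_kfpOp, neg_neg]
  have p1 := ((pairingCLM _ (Lp.memLp u)).continuous.tendsto _).comp h1
  have p2 := ((pairingCLM _ (Lp.memLp Φ)).continuous.tendsto _).comp h
  have e : ∀ t : ℝ, pairingCLM _ (Lp.memLp u) (t⁻¹ • (kfpSemigroup n (-1) t Φ - Φ)) =
      pairingCLM _ (Lp.memLp Φ) (t⁻¹ • (kfpSemigroup n 1 t u - u)) := by
    intro t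
    rw [ContinuousLinearMap.map_smul_of_tower, ContinuousLinearMap.map_smul_of_tower, map_sub, map_sub]
    simp_rw [pairingCLM_apply]
    rw [integral_kfpSemigroup_mul 1 t u Φ]
    congr 2
    · congr 1
      ext z
      ring
    · congr 1
      ext z
      ring
  have p3 := tendsto_nhds_unique (p1.congr e) p2
  rw [map_neg, map_neg, neg_inj, pairingCLM_apply, pairingCLM_apply] at p3
  rw [hφ, ← p3]
  apply integral_congr_ae
  filter_upwards [(kfpOp (-1) φ).coeFn_toLp 2] with z hz
  rw [hz]
  ring

theorem isFreeKFPSemigroup_kfpSemigroup (n : ℕ) : IsFreeKFPSemigroup (kfpSemigroup n 1) where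
  map_zero := kfpSemigroup_zero 1
  map_add _ _ hs ht := kfpSemigroup_add (by norm_num) hs ht
  tendsto_zero u := tendsto_kfpSemigroup_zero (by norm_num) u
  generator u f := by
    refine ⟨isFreeKFP_of_tendsto, fun h => ?_⟩
    -- The kernels are Schwartz functions, so the weak equation may be tested against them directly;
    -- this gives the whole maximal domain.
    refine tendsto_slope_kfpSemigroup (by norm_num) (by norm_num) fun a ha z' => ?_
    rw [← h]
    simp_rw [freeKFPTranspose_eq]

end Generator

/-! ### Time decay -/

section DecayBounds

variable {n : ℕ}

/-- `tanh < 1` gives `σ > 2t - 4`, and `2t - 4 ≥ 2t/3` exactly when `t ≥ 3`. -/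
theorem le_bridgeVar {t : ℝ} (ht : 3 ≤ t) : 2 / 3 * t ≤ bridgeVar t := by
  have := tanhHalf_lt_one t
  unfold bridgeVar
  linarith

theorem heatKernel_le {s : ℝ} (hs : 0 < s) (x : KSpace n) :
    heatKernel s x ≤ (2 * Real.pi * s) ^ (-((n : ℝ) / 2)) := by
  unfold heatKernel
  refine mul_le_of_le_one_right (by positivity) ?_
  rw [Real.exp_le_one_iff]
  have : 0 ≤ ‖x‖ ^ 2 / (2 * s) := by positivity
  linarith

theorem heat_constant_le {t : ℝ} (ht : 3 ≤ t) :
    (2 * Real.pi * bridgeVar t) ^ (-((n : ℝ) / 2)) ≤ 1 / t ^ ((n : ℝ) / 2) := by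
  have ht0 : 0 < t := by linarith
  rw [one_div, ← Real.rpow_neg ht0.le]
  refine Real.rpow_le_rpow_of_nonpos ht0 ?_ ?_
  · have := le_bridgeVar ht
    have := Real.pi_gt_three
    nlinarith
  · have : (0 : ℝ) ≤ (n : ℝ) / 2 := by positivity
    linarith

/-- Replacing the heat factor by its maximum decouples position from velocity: what remains is the
Mehler operator acting on the position integral of `|u|`. -/
theorem enorm_kfpEval_le {t : ℝ} (ht : 3 ≤ t) (ht0 : 0 < t) (z : KSpace n × KSpace n)
    (u : PhaseL2 n) :
    ‖kfpEval (ε := 1) (by norm_num) ht0 z u‖ₑ ≤ ENNReal.ofReal (1 / t ^ ((n : ℝ) / 2)) *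
      ∫⁻ w, ‖mehlerKernel (tanhHalf t) z.2 w‖ₑ * ∫⁻ y, ‖u (y, w)‖ₑ := by
  have hum : Measurable u := (Lp.stronglyMeasurable u).measurable
  rw [kfpEval_apply]
  simp_rw [mul_comm (u _)]
  refine (enorm_integral_ofReal_mul_le _ _).trans ?_
  have hk : Measurable fun z' => kfpKernel 1 t z z' :=
    ((continuous_kfpKernel (n := n) 1 t).comp (by fun_prop : Continuous fun z' => (z, z'))).measurable
  have hm : Measurable fun z' => ‖kfpKernel 1 t z z'‖ₑ * ‖u z'‖ₑ := hk.enorm.mul hum.enorm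
  rw [lintegral_prod_swap hm, ← lintegral_const_mul' _ _ ENNReal.ofReal_ne_top]
  refine lintegral_mono fun w => ?_
  have hmeas : Measurable fun y => ‖u (y, w)‖ₑ :=
    (hum.comp (measurable_id.prodMk measurable_const)).enorm
  rw [← lintegral_const_mul _ hmeas, ← lintegral_const_mul' _ _ ENNReal.ofReal_ne_top]
  refine lintegral_mono fun y => ?_
  rw [kfpKernel, enorm_mul, ← mul_assoc]
  refine mul_le_mul_left (mul_le_mul_left ?_ _) _
  rw [Real.enorm_of_nonneg (heatKernel_pos (bridgeVar_pos ht0) _).le]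
  exact ENNReal.ofReal_le_ofReal ((heatKernel_le (bridgeVar_pos ht0) _).trans (heat_constant_le ht))

end DecayBounds

/-! ### Decay between weighted `L²` spaces -/

section Weighted

variable {n : ℕ}

/-- The weight `⟨x⟩^{2s}`. -/
def bracketWeight (s : ℝ) (x : KSpace n) : ℝ≥0∞ :=
  ENNReal.ofReal (Real.sqrt (1 + ‖x‖ ^ 2) ^ (2 * s))

theorem bracket_pos (x : KSpace n) : 0 < Real.sqrt (1 + ‖x‖ ^ 2) := by positivity

theorem measurable_bracketWeight (s : ℝ) : Measurable (bracketWeight s : KSpace n → ℝ≥0∞) := by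
  unfold bracketWeight
  have h : Continuous fun x : KSpace n => Real.sqrt (1 + ‖x‖ ^ 2) ^ (2 * s) :=
    Continuous.rpow_const (by fun_prop) fun x => Or.inl (bracket_pos x).ne'
  exact h.measurable.ennreal_ofReal

theorem bracketWeight_ne_zero (s : ℝ) (x : KSpace n) : bracketWeight s x ≠ 0 := by
  unfold bracketWeight
  have := Real.rpow_pos_of_pos (bracket_pos x) (2 * s)
  simpa using this

theorem bracketWeight_neg (s : ℝ) (x : KSpace n) :
    bracketWeight (-s) x = (bracketWeight s x)⁻¹ := by
  unfold bracketWeight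
  rw [← ENNReal.ofReal_inv_of_pos (Real.rpow_pos_of_pos (bracket_pos x) _), mul_neg,
    Real.rpow_neg (bracket_pos x).le]

theorem one_le_bracketWeight {s : ℝ} (hs : 0 ≤ s) (x : KSpace n) : 1 ≤ bracketWeight s x := by
  unfold bracketWeight
  rw [ENNReal.one_le_ofReal]
  refine Real.one_le_rpow ?_ (by positivity)
  rw [Real.one_le_sqrt]
  linarith [sq_nonneg ‖x‖]

theorem lintegral_bracketWeight_lt_top {s : ℝ} (hs : (n : ℝ) / 2 < s) :
    ∫⁻ x : KSpace n, bracketWeight (-s) x < ∞ := by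
  have h := integrable_rpow_neg_one_add_norm_sq (E := KSpace n) (μ := volume) (r := 2 * s)
    (by rw [finrank_euclideanSpace_fin]; linarith)
  have h2 := h.lintegral_lt_top
  refine lt_of_le_of_lt (le_of_eq (lintegral_congr fun x => ?_)) h2
  unfold bracketWeight
  congr 1
  rw [Real.sqrt_eq_rpow, ← Real.rpow_mul (by positivity)]
  congr 1
  ring

theorem eLpNorm_weightedMeasure (s : ℝ) (f : KSpace n × KSpace n → ℂ) (hf : Measurable f) :
    eLpNorm f 2 (weightedMeasure n s) =
      (∫⁻ w, ∫⁻ y, bracketWeight s y * ‖f (y, w)‖ₑ ^ 2) ^ (1 / 2 : ℝ) := by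
  rw [eLpNorm_two_eq]
  congr 1
  have hw : Measurable fun z : KSpace n × KSpace n => bracketWeight s z.1 :=
    (measurable_bracketWeight s).comp measurable_fst
  have h1 := lintegral_withDensity_eq_lintegral_mul volume hw (hf.enorm.pow_const 2)
  have h2 := lintegral_prod_swap (n := n) (hw.mul (hf.enorm.pow_const 2))
  exact h1.trans h2

theorem volume_le_weightedMeasure {s : ℝ} (hs : 0 ≤ s) :
    (volume : Measure (KSpace n × KSpace n)) ≤ weightedMeasure n s := by
  have h : (volume : Measure (KSpace n × KSpace n)).withDensity 1 ≤ weightedMeasure n s :=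
    withDensity_mono (Eventually.of_forall fun z => one_le_bracketWeight hs z.1)
  rwa [withDensity_one] at h

/-- Cauchy-Schwarz in position at fixed velocity, splitting off `⟨y⟩^(-s) ⟨y⟩^s`. -/
theorem lintegral_sq_marginal_le (s : ℝ) (u : PhaseL2 n) :
    ∫⁻ w, (∫⁻ y, ‖u (y, w)‖ₑ) ^ 2 ≤ (∫⁻ x : KSpace n, bracketWeight (-s) x) *
      ∫⁻ w, ∫⁻ y, bracketWeight s y * ‖u (y, w)‖ₑ ^ 2 := by
  have hum : Measurable u := (Lp.stronglyMeasurable u).measurable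
  have hm : Measurable fun w : KSpace n => ∫⁻ y, bracketWeight s y * ‖u (y, w)‖ₑ ^ 2 := by
    have : Measurable fun z : KSpace n × KSpace n => bracketWeight s z.1 * ‖u z‖ₑ ^ 2 :=
      ((measurable_bracketWeight s).comp measurable_fst).mul (hum.enorm.pow_const 2)
    exact this.lintegral_prod_left'
  rw [← lintegral_const_mul _ hm]
  refine lintegral_mono fun w => ?_
  have hmeas : Measurable fun y => ‖u (y, w)‖ₑ :=
    (hum.comp (measurable_id.prodMk measurable_const)).enorm
  have h := sq_lintegral_mul_le (μ := (volume : Measure (KSpace n))) (k := fun _ => 1)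
    (f := fun y => ‖u (y, w)‖ₑ) (p := bracketWeight (-s)) measurable_const hmeas.aemeasurable
    (measurable_bracketWeight _) (bracketWeight_ne_zero _) (fun x => ENNReal.ofReal_ne_top)
  simp only [one_mul] at h
  refine h.trans_eq ?_
  congr 1
  refine lintegral_congr fun y => ?_
  rw [div_eq_mul_inv, mul_comm, bracketWeight_neg, inv_inv]

theorem weighted_decay {s : ℝ} (hs : (n : ℝ) / 2 < s) :
    ∃ C : ℝ, 0 < C ∧ ∀ t : ℝ, 3 ≤ t →
      ∀ u : KSpace n × KSpace n → ℂ, MemLp u 2 (weightedMeasure n s) →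
        ∃ hu : MemLp u 2 volume,
          eLpNorm (kfpSemigroup n 1 t (hu.toLp u)) 2 (weightedMeasure n (-s)) ≤
            ENNReal.ofReal (C / t ^ ((n : ℝ) / 2)) * eLpNorm u 2 (weightedMeasure n s) := by
  set I : ℝ≥0∞ := ∫⁻ x : KSpace n, bracketWeight (-s) x with hI
  have hItop : I ≠ ∞ := (lintegral_bracketWeight_lt_top hs).ne
  have hs0 : 0 ≤ s := by
    have : (0 : ℝ) ≤ (n : ℝ) / 2 := by positivity
    linarith
  -- The integral `I` of `⟨x⟩^(-2s)` enters as `I^(1/2)` twice: for the output, whose bound does not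
  -- depend on position, and for the input. The `1` only secures positivity.
  refine ⟨I.toReal + 1, by positivity, fun t ht u hu => ?_⟩
  have ht0 : 0 < t := by linarith
  have hu' : MemLp u 2 volume := hu.mono_measure (volume_le_weightedMeasure hs0)
  refine ⟨hu', ?_⟩
  set U : PhaseL2 n := hu'.toLp u with hU
  set c : ℝ≥0∞ := ENNReal.ofReal (1 / t ^ ((n : ℝ) / 2)) with hc
  have hUm : Measurable U := (Lp.stronglyMeasurable U).measurable
  have hSm : Measurable (kfpSemigroup n 1 t U) := (Lp.stronglyMeasurable _).measurable
  have e1 : eLpNorm u 2 (weightedMeasure n s) = eLpNorm U 2 (weightedMeasure n s) :=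
    eLpNorm_congr_ae ((withDensity_absolutelyContinuous _ _).ae_eq hu'.coeFn_toLp.symm)
  set N : KSpace n → ℝ≥0∞ := fun w => ∫⁻ y, ‖U (y, w)‖ₑ with hN
  have hNm : Measurable N := hUm.enorm.lintegral_prod_left'
  set MN : KSpace n → ℝ≥0∞ := fun v => ∫⁻ w, ‖mehlerKernel (tanhHalf t) v w‖ₑ * N w with hMN
  have hMNm : Measurable MN := by
    have : Measurable fun z : KSpace n × KSpace n =>
        ‖mehlerKernel (tanhHalf t) z.1 z.2‖ₑ * N z.2 :=
      (continuous_mehlerKernel (n := n) (tanhHalf t)).measurable.enorm.mul (hNm.comp measurable_snd)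
    exact this.lintegral_prod_right'
  have h1 : ∀ᵐ z : KSpace n × KSpace n, ‖kfpSemigroup n 1 t U z‖ₑ ≤ c * MN z.2 := by
    filter_upwards [kfpSemigroup_apply_ae (ε := 1) (by norm_num) ht0 U] with z hz
    rw [hz]
    exact enorm_kfpEval_le ht ht0 z U
  have h2 : ∫⁻ w, ∫⁻ y, bracketWeight (-s) y * ‖kfpSemigroup n 1 t U (y, w)‖ₑ ^ 2 ≤
      c ^ 2 * I * ∫⁻ v, MN v ^ 2 := by
    have hw : Measurable fun z : KSpace n × KSpace n => bracketWeight (-s) z.1 :=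
      (measurable_bracketWeight _).comp measurable_fst
    calc ∫⁻ w, ∫⁻ y, bracketWeight (-s) y * ‖kfpSemigroup n 1 t U (y, w)‖ₑ ^ 2
        = ∫⁻ z : KSpace n × KSpace n, bracketWeight (-s) z.1 * ‖kfpSemigroup n 1 t U z‖ₑ ^ 2 :=
          (lintegral_prod_swap (n := n) (hw.mul (hSm.enorm.pow_const 2))).symm
      _ ≤ ∫⁻ z : KSpace n × KSpace n, bracketWeight (-s) z.1 * (c * MN z.2) ^ 2 := by
          refine lintegral_mono_ae ?_
          filter_upwards [h1] with z hz
          gcongr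
      _ = ∫⁻ w, ∫⁻ y, bracketWeight (-s) y * (c * MN w) ^ 2 :=
          lintegral_prod_swap (n := n)
            (hw.mul (((hMNm.comp measurable_snd).const_mul c).pow_const 2))
      _ = ∫⁻ w, I * (c * MN w) ^ 2 := by
          refine lintegral_congr fun w => ?_
          rw [lintegral_mul_const _ (measurable_bracketWeight _)]
      _ = c ^ 2 * I * ∫⁻ v, MN v ^ 2 := by
          rw [← lintegral_const_mul _ (hMNm.pow_const 2)]
          refine lintegral_congr fun w => ?_
          ring
  -- The Mehler operator is a contraction in velocity.
  have h3 : ∫⁻ v, MN v ^ 2 ≤ ∫⁻ w, N w ^ 2 := by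
    have := (schurBound_mehlerKernel (n := n) (tanhHalf_pos ht0)).lintegral_sq_le
      hNm.aemeasurable
    simpa using this
  have h4 := lintegral_sq_marginal_le s U
  rw [e1, eLpNorm_weightedMeasure _ _ hSm, eLpNorm_weightedMeasure _ _ hUm]
  set J := ∫⁻ w, ∫⁻ y, bracketWeight s y * ‖U (y, w)‖ₑ ^ 2 with hJ
  have h5 : ∫⁻ w, ∫⁻ y, bracketWeight (-s) y * ‖kfpSemigroup n 1 t U (y, w)‖ₑ ^ 2 ≤
      (c * I) ^ 2 * J := by
    refine h2.trans ?_
    calc c ^ 2 * I * ∫⁻ v, MN v ^ 2 ≤ c ^ 2 * I * (I * J) := by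
          gcongr
          exact h3.trans h4
      _ = (c * I) ^ 2 * J := by ring
  have h6 : c * I ≤ ENNReal.ofReal ((I.toReal + 1) / t ^ ((n : ℝ) / 2)) := by
    rw [div_eq_mul_one_div, ENNReal.ofReal_mul (by positivity), mul_comm]
    gcongr
    refine (ENNReal.ofReal_toReal hItop).symm.trans_le (ENNReal.ofReal_le_ofReal (by linarith))
  calc (∫⁻ w, ∫⁻ y, bracketWeight (-s) y * ‖kfpSemigroup n 1 t U (y, w)‖ₑ ^ 2) ^ (1 / 2 : ℝ)
      ≤ ((c * I) ^ 2 * J) ^ (1 / 2 : ℝ) := ENNReal.rpow_le_rpow h5 (by norm_num)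
    _ = c * I * J ^ (1 / 2 : ℝ) := by
        rw [ENNReal.mul_rpow_of_nonneg _ _ (by norm_num), ← ENNReal.rpow_natCast,
          ← ENNReal.rpow_mul]
        norm_num
    _ ≤ _ := by gcongr

end Weighted

/-! ### Pointwise values of `L²`-valued integrals and differences of kernel operators -/

section BochnerEvaluation

variable {Y X : Type*} [MeasurableSpace Y] [MeasurableSpace X] {μ : Measure Y} {ν : Measure X}
  [SigmaFinite μ] [SigmaFinite ν]

/-- The Bochner integral of an `L²`-valued function is computed pointwise. -/
theorem coeFn_integral_Lp_ae {F : Y → Lp ℂ 2 ν} (hF : Integrable F μ) {f : Y → X → ℂ}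
    (hf : StronglyMeasurable (Function.uncurry f)) (h : ∀ᵐ y ∂μ, F y =ᵐ[ν] f y) :
    (∫ y, F y ∂μ : Lp ℂ 2 ν) =ᵐ[ν] fun x => ∫ y, f y x ∂μ := by
  have hint : ∀ s, MeasurableSet s → ν s < ∞ →
      Integrable (Function.uncurry f) (μ.prod (ν.restrict s)) := by
    intro s hs hνs
    refine ⟨hf.aestronglyMeasurable, ?_⟩
    rw [HasFiniteIntegral, lintegral_prod _ hf.enorm.aemeasurable]
    calc ∫⁻ y, ∫⁻ x in s, ‖f y x‖ₑ ∂ν ∂μ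
        ≤ ∫⁻ y, ‖F y‖ₑ * ν s ^ (1 / 2 : ℝ) ∂μ := by
          refine lintegral_mono_ae ?_
          filter_upwards [h] with y hy
          have h1 := eLpNorm_le_eLpNorm_mul_rpow_measure_univ (μ := ν.restrict s) (p := 1) (q := 2)
            (by norm_num) (f := F y) (Lp.aestronglyMeasurable (F y)).restrict
          rw [eLpNorm_one_eq_lintegral_enorm, Measure.restrict_apply_univ] at h1
          calc ∫⁻ x in s, ‖f y x‖ₑ ∂ν = ∫⁻ x in s, ‖F y x‖ₑ ∂ν := by
                refine lintegral_congr_ae (ae_restrict_of_ae ?_)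
                filter_upwards [hy] with x hx
                rw [hx]
            _ ≤ _ := h1
            _ ≤ _ := by
                refine mul_le_mul' ?_ (le_of_eq (by norm_num))
                rw [Lp.enorm_def]
                exact eLpNorm_restrict_le _ _ _ _
      _ < ∞ := by
          rw [lintegral_mul_const' _ _ (ENNReal.rpow_ne_top_of_nonneg (by norm_num) hνs.ne)]
          exact ENNReal.mul_lt_top hF.2 (ENNReal.rpow_lt_top_of_nonneg (by norm_num) hνs.ne)
  refine ae_eq_of_forall_setIntegral_eq_of_sigmaFinite ?_ ?_ ?_
  · intro s hs hνs
    have : IsFiniteMeasure (ν.restrict s) := isFiniteMeasure_restrict.mpr hνs.ne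
    exact ((Lp.memLp _).restrict s).integrable (by norm_num)
  · intro s hs hνs
    exact (hint s hs hνs).integral_prod_right
  · intro s hs hνs
    -- Integration over `s` is a continuous functional on `L²`, so it commutes with the Bochner
    -- integral; Fubini on the finite measure set `s` handles the other side.
    have hone : MemLp (s.indicator fun _ => (1 : ℂ)) 2 ν :=
      memLp_indicator_const 2 hs 1 (Or.inr hνs.ne)
    have hpair : ∀ w : Lp ℂ 2 ν, pairingCLM _ hone w = ∫ x in s, w x ∂ν := by
      intro w
      rw [pairingCLM_apply, ← integral_indicator hs]
      congr 1
      ext x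
      by_cases hx : x ∈ s <;> simp [hx]
    rw [← hpair, ← ContinuousLinearMap.integral_comp_comm _ hF]
    simp_rw [hpair]
    have e1 : ∫ y, ∫ x in s, F y x ∂ν ∂μ = ∫ y, ∫ x in s, f y x ∂ν ∂μ := by
      apply integral_congr_ae
      filter_upwards [h] with y hy
      exact integral_congr_ae (ae_restrict_of_ae hy)
    rw [e1, integral_integral_swap (hint s hs hνs)]

theorem SchurBound.norm_op_sub_le {k₁ k₂ : X → X → ℝ} {p₁ p₂ p : X → ℝ≥0∞} {A₁ A₂ A : NNReal}
    (h₁ : SchurBound ν k₁ p₁ A₁) (h₂ : SchurBound ν k₂ p₂ A₂)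
    (h : SchurBound ν (fun x y => k₁ x y - k₂ x y) p A) : ‖h₁.op - h₂.op‖ ≤ A := by
  have e : h₁.op - h₂.op = h.op := by
    ext1 u
    apply Lp.ext
    filter_upwards [h.op_apply_ae u, h₁.op_apply_ae u, h₂.op_apply_ae u,
      Lp.coeFn_sub (h₁.op u) (h₂.op u), h₁.ae_integrable (Lp.memLp u),
      h₂.ae_integrable (Lp.memLp u)] with x hx hx1 hx2 hx3 i1 i2
    rw [sub_apply, hx3, Pi.sub_apply, hx, hx1, hx2, ← integral_sub i1 i2]
    congr 1
    ext y
    push_cast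
    ring
  rw [e]
  exact h.norm_op_le

end BochnerEvaluation

/-! ### Decay from `𝓛¹` to `𝓛^∞` -/

section Mixed

variable {n : ℕ}

/-- Used with `a` a heat factor, to bound the fibre operators, and with `a` a difference of two heat
factors, to show their continuity. -/
theorem schurBound_mul_mehlerKernel {τ : ℝ} (hτ : 0 < τ) {a : KSpace n → KSpace n → ℝ}
    (ha : Continuous (Function.uncurry a)) {A : NNReal} (hA : ∀ v w, |a v w| ≤ A) :
    SchurBound (volume : Measure (KSpace n)) (fun v w => a v w * mehlerKernel τ v w)
      (fun v => ‖groundState v‖ₑ) A := by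
  have hb := schurBound_mehlerKernel (n := n) hτ
  have hle : ∀ v w, ‖a v w * mehlerKernel τ v w‖ₑ ≤ A * ‖mehlerKernel τ v w‖ₑ := by
    intro v w
    rw [enorm_mul]
    refine mul_le_mul_left ?_ _
    rw [enorm_le_coe, ← NNReal.coe_le_coe, coe_nnnorm, Real.norm_eq_abs]
    exact hA v w
  exact
    { measurable_kernel := ha.measurable.mul (continuous_mehlerKernel τ).measurable
      measurable_weight := hb.measurable_weight
      weight_ne_zero := hb.weight_ne_zero
      weight_ne_top := hb.weight_ne_top
      lintegral_right := fun v => by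
        calc _ ≤ ∫⁻ w, A * (‖mehlerKernel τ v w‖ₑ * ‖groundState w‖ₑ) := by
              refine lintegral_mono fun w => ?_
              rw [← mul_assoc]
              exact mul_le_mul_left (hle v w) _
          _ ≤ _ := by
              rw [lintegral_const_mul' _ _ ENNReal.coe_ne_top]
              have := hb.lintegral_right v
              rw [ENNReal.coe_one, one_mul] at this
              exact mul_le_mul_right this _
      lintegral_left := fun w => by
        calc _ ≤ ∫⁻ v, A * (‖mehlerKernel τ v w‖ₑ * ‖groundState v‖ₑ) := by
              refine lintegral_mono fun v => ?_
              rw [← mul_assoc]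
              exact mul_le_mul_left (hle v w) _
          _ ≤ _ := by
              rw [lintegral_const_mul' _ _ ENNReal.coe_ne_top]
              have := hb.lintegral_left w
              rw [ENNReal.coe_one, one_mul] at this
              exact mul_le_mul_right this _ }

/-- The maximum of the heat kernel at time `t`. -/
def heatMax (n : ℕ) (t : ℝ) : NNReal := Real.toNNReal ((2 * Real.pi * bridgeVar t) ^ (-((n : ℝ) / 2)))

theorem coe_heatMax {t : ℝ} (ht : 0 < t) :
    (heatMax n t : ℝ) = (2 * Real.pi * bridgeVar t) ^ (-((n : ℝ) / 2)) := by
  have := bridgeVar_pos ht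
  exact Real.coe_toNNReal _ (by positivity)

theorem schurBound_fibre {t : ℝ} (ht : 0 < t) (x : KSpace n) :
    SchurBound (volume : Measure (KSpace n))
      (fun v w => heatKernel (bridgeVar t) (x - tanhHalf t • (v + w)) *
        mehlerKernel (tanhHalf t) v w) (fun v => ‖groundState v‖ₑ) (heatMax n t) := by
  refine schurBound_mul_mehlerKernel (tanhHalf_pos ht)
    (a := fun v w => heatKernel (bridgeVar t) (x - tanhHalf t • (v + w))) ?_ fun v w => ?_
  · exact (continuous_heatKernel _).comp (by fun_prop)
  · rw [abs_of_pos (heatKernel_pos (bridgeVar_pos ht) _), coe_heatMax ht]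
    unfold heatKernel
    have := bridgeVar_pos ht
    refine mul_le_of_le_one_right (by positivity) ?_
    rw [Real.exp_le_one_iff]
    have : 0 ≤ ‖x - tanhHalf t • (v + w)‖ ^ 2 / (2 * bridgeVar t) := by positivity
    linarith

/-- The operator on `L²(ℝⁿ_v)` that the kernel defines for a fixed displacement in position. -/
def fibreOp {t : ℝ} (ht : 0 < t) (x : KSpace n) :
    Lp ℂ 2 (volume : Measure (KSpace n)) →L[ℂ] Lp ℂ 2 (volume : Measure (KSpace n)) :=
  (schurBound_fibre ht x).op

/-- A Gaussian is a Schwartz function, hence continuous and vanishing at infinity. -/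
theorem uniformContinuous_heatKernel {s : ℝ} (hs : 0 < s) :
    UniformContinuous (heatKernel s : KSpace n → ℝ) := by
  have htg : (fun x : KSpace n => ‖x‖ ^ 2 / (2 * s)).HasTemperateGrowth := by
    have := (Function.hasTemperateGrowth_norm_sq (KSpace n)).mul
      (Function.HasTemperateGrowth.const (1 / (2 * s)))
    refine (congrArg Function.HasTemperateGrowth (funext fun z => ?_)).mp this
    simp only [Pi.mul_apply]
    ring
  have := ZeroAtInftyContinuousMap.uniformContinuous (SchwartzMap.toZeroAtInfty (expNegSchwartz ((2 * Real.pi * s) ^ (-((n : ℝ) / 2))) _ htg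
    (δ := 1 / (2 * s)) (c := 0) (by positivity) (fun z => le_of_eq (by ring))))
  exact this

/-- Uniform continuity of the heat kernel makes the multiplier small uniformly in both velocities.
The resulting operator norm continuity gives measurability of `y ↦ fibreOp ht (x - y) (U y)`. -/
theorem continuous_fibreOp {t : ℝ} (ht : 0 < t) : Continuous (fibreOp (n := n) ht) := by
  rw [Metric.continuous_iff]
  intro x δ hδ
  obtain ⟨η, hη, h⟩ := Metric.uniformContinuous_iff.mp
    (uniformContinuous_heatKernel (n := n) (bridgeVar_pos ht)) (δ / 2) (by positivity)
  refine ⟨η, hη, fun x' hx' => ?_⟩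
  rw [dist_eq_norm]
  have hb : SchurBound (volume : Measure (KSpace n))
      (fun v w => heatKernel (bridgeVar t) (x' - tanhHalf t • (v + w)) *
        mehlerKernel (tanhHalf t) v w - heatKernel (bridgeVar t) (x - tanhHalf t • (v + w)) *
        mehlerKernel (tanhHalf t) v w) (fun v => ‖groundState v‖ₑ) (Real.toNNReal (δ / 2)) := by
    simp_rw [← sub_mul]
    refine schurBound_mul_mehlerKernel (tanhHalf_pos ht)
      (a := fun v w => heatKernel (bridgeVar t) (x' - tanhHalf t • (v + w)) -
        heatKernel (bridgeVar t) (x - tanhHalf t • (v + w))) ?_ fun v w => ?_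
    · exact ((continuous_heatKernel _).comp (by fun_prop)).sub
        ((continuous_heatKernel _).comp (by fun_prop))
    · rw [Real.coe_toNNReal _ (by positivity), ← Real.dist_eq]
      refine (h ?_).le
      rwa [dist_sub_right]
  have := (schurBound_fibre ht x').norm_op_sub_le (schurBound_fibre ht x) hb
  rw [Real.coe_toNNReal _ (by positivity)] at this
  exact this.trans_lt (by linarith)

theorem norm_fibreOp_le {t : ℝ} (ht : 0 < t) (x : KSpace n)
    (φ : Lp ℂ 2 (volume : Measure (KSpace n))) : ‖fibreOp ht x φ‖ ≤ heatMax n t * ‖φ‖ :=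
  (fibreOp ht x).le_of_opNorm_le (schurBound_fibre ht x).norm_op_le φ

theorem integrable_fibreOp {t : ℝ} (ht : 0 < t) (U : MixedLp n 1) (x : KSpace n) :
    Integrable fun y => fibreOp ht (x - y) (U y) := by
  refine ((L1.integrable_coeFn U).norm.const_mul (heatMax n t : ℝ)).mono' ?_
    (Eventually.of_forall fun y => norm_fibreOp_le ht _ _)
  have h1 : Continuous fun y : KSpace n => fibreOp ht (x - y) :=
    (continuous_fibreOp ht).comp (by fun_prop)
  exact isBoundedBilinearMap_apply.continuous.comp_aestronglyMeasurable
    (h1.aestronglyMeasurable.prodMk (Lp.aestronglyMeasurable U))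

theorem norm_integral_fibreOp_le {t : ℝ} (ht : 0 < t) (U : MixedLp n 1) (x : KSpace n) :
    ‖∫ y, fibreOp ht (x - y) (U y)‖ ≤ heatMax n t * ‖U‖ := by
  rw [L1.norm_eq_integral_norm, ← integral_const_mul]
  exact norm_integral_le_of_norm_le ((L1.integrable_coeFn U).norm.const_mul _)
    (Eventually.of_forall fun y => norm_fibreOp_le ht _ _)

theorem memLp_integral_fibreOp {t : ℝ} (ht : 0 < t) (U : MixedLp n 1) :
    MemLp (fun x => ∫ y, fibreOp ht (x - y) (U y)) ∞ volume := by
  refine memLp_top_of_bound ?_ _ (Eventually.of_forall (norm_integral_fibreOp_le ht U))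
  have h1 : Continuous fun p : KSpace n × KSpace n => fibreOp ht (p.1 - p.2) :=
    (continuous_fibreOp ht).comp (by fun_prop)
  have h2 : AEStronglyMeasurable (fun p : KSpace n × KSpace n => fibreOp ht (p.1 - p.2) (U p.2))
      (volume.prod volume) :=
    isBoundedBilinearMap_apply.continuous.comp_aestronglyMeasurable
      (h1.aestronglyMeasurable.prodMk (Lp.aestronglyMeasurable U).comp_snd)
  exact h2.integral_prod_right'

/-- The extension of `exp (-t P₀)` to an operator from `𝓛¹` to `𝓛^∞`. -/
def mixedOp {t : ℝ} (ht : 0 < t) : MixedLp n 1 →L[ℂ] MixedLp n ∞ :=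
  LinearMap.mkContinuous
    { toFun := fun U => (memLp_integral_fibreOp ht U).toLp
      map_add' := by
        intro U V
        rw [← MemLp.toLp_add]
        apply MemLp.toLp_congr
        refine Eventually.of_forall fun x => ?_
        rw [Pi.add_apply, ← integral_add (integrable_fibreOp ht U x) (integrable_fibreOp ht V x)]
        apply integral_congr_ae
        filter_upwards [Lp.coeFn_add U V] with y hy
        rw [hy, Pi.add_apply, map_add]
      map_smul' := by
        intro c U
        rw [RingHom.id_apply, ← MemLp.toLp_const_smul]
        apply MemLp.toLp_congr
        refine Eventually.of_forall fun x => ?_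
        simp only [Pi.smul_apply]
        rw [← integral_smul]
        apply integral_congr_ae
        filter_upwards [Lp.coeFn_smul c U] with y hy
        rw [hy, Pi.smul_apply, map_smul] } (heatMax n t) (by
    intro U
    simp only [LinearMap.coe_mk, AddHom.coe_mk]
    rw [Lp.norm_toLp]
    refine ENNReal.toReal_le_of_le_ofReal (by positivity) ?_
    rw [eLpNorm_exponent_top]
    refine eLpNormEssSup_le_of_ae_bound (Eventually.of_forall (norm_integral_fibreOp_le ht U)))

theorem mixedOp_apply_ae {t : ℝ} (ht : 0 < t) (U : MixedLp n 1) :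
    mixedOp ht U =ᵐ[volume] fun x => ∫ y, fibreOp ht (x - y) (U y) :=
  (memLp_integral_fibreOp ht U).coeFn_toLp

theorem norm_mixedOp_apply_le {t : ℝ} (ht : 0 < t) (U : MixedLp n 1) :
    ‖mixedOp ht U‖ ≤ heatMax n t * ‖U‖ :=
  (mixedOp ht).le_of_opNorm_le (LinearMap.mkContinuous_norm_le _ (heatMax n t).2 _) U

theorem stronglyMeasurable_kfpIntegrand {u : KSpace n × KSpace n → ℂ} (hu : StronglyMeasurable u)
    (t : ℝ) (x : KSpace n) :
    StronglyMeasurable fun q : (KSpace n × KSpace n) × KSpace n =>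
      u (q.1.1, q.2) * (kfpKernel 1 t (x, q.1.2) (q.1.1, q.2) : ℂ) := by
  have e : Measurable fun q : (KSpace n × KSpace n) × KSpace n => (q.1.1, q.2) :=
    measurable_fst.fst.prodMk measurable_snd
  have e' : Measurable fun q : (KSpace n × KSpace n) × KSpace n => (x, q.1.2) :=
    measurable_const.prodMk measurable_fst.snd
  have h1 : StronglyMeasurable fun q : (KSpace n × KSpace n) × KSpace n => u (q.1.1, q.2) :=
    hu.comp_measurable e
  have h2 : Measurable (Function.uncurry (kfpKernel 1 t : KSpace n × KSpace n → _ → ℝ)) :=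
    (continuous_kfpKernel 1 t).measurable
  have h3 : Measurable fun q : (KSpace n × KSpace n) × KSpace n =>
      Function.uncurry (kfpKernel 1 t) ((x, q.1.2), (q.1.1, q.2)) := h2.comp (e'.prodMk e)
  exact h1.mul (Complex.measurable_ofReal.comp h3).stronglyMeasurable

theorem stronglyMeasurable_integral_kfpKernel {u : KSpace n × KSpace n → ℂ}
    (hu : StronglyMeasurable u) (t : ℝ) (x : KSpace n) :
    StronglyMeasurable (Function.uncurry fun y v : KSpace n =>
      ∫ w, u (y, w) * (kfpKernel 1 t (x, v) (y, w) : ℂ)) :=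
  (stronglyMeasurable_kfpIntegrand hu t x).integral_prod_right' (ν := volume)

/-- Identifies the Bochner integral that defines `mixedOp` with the iterated kernel integral of `u`,
for every `x` and almost every `v`. -/
theorem integral_fibreOp_ae {t : ℝ} (ht : 0 < t) {U : MixedLp n 1} {u : PhaseL2 n}
    (h : SameFunction U u) (x : KSpace n) :
    ((∫ y, fibreOp ht (x - y) (U y) : Lp ℂ 2 (volume : Measure (KSpace n))) : KSpace n → ℂ)
      =ᵐ[volume] fun v => ∫ y, ∫ w, u (y, w) * (kfpKernel 1 t (x, v) (y, w) : ℂ) := by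
  refine coeFn_integral_Lp_ae (integrable_fibreOp ht U x)
    (stronglyMeasurable_integral_kfpKernel (Lp.stronglyMeasurable u) t x) ?_
  unfold SameFunction at h
  filter_upwards [h] with y hy
  filter_upwards [(schurBound_fibre ht (x - y)).op_apply_ae (U y)] with v hv
  rw [fibreOp, hv]
  apply integral_congr_ae
  filter_upwards [hy] with w hw
  rw [hw, kfpKernel, kfpShift, one_mul, mul_comm]

theorem kfpEval_eq_integral_integral {t : ℝ} (ht : 0 < t) (u : PhaseL2 n) (x v : KSpace n) :
    ∫ z', u z' * (kfpKernel 1 t (x, v) z' : ℂ) =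
      ∫ y, ∫ w, u (y, w) * (kfpKernel 1 t (x, v) (y, w) : ℂ) := by
  have hi : Integrable (fun z' => u z' * (kfpKernel 1 t (x, v) z' : ℂ))
      ((volume : Measure (KSpace n)).prod volume) :=
    (Lp.memLp u).integrable_mul (memLp_kfpKernel_right (by norm_num) ht (x, v))
  exact integral_prod _ hi

theorem sameFunction_mixedOp {t : ℝ} (ht : 0 < t) (U : MixedLp n 1) (u : PhaseL2 n)
    (h : SameFunction U u) : SameFunction (mixedOp ht U) (kfpSemigroup n 1 t u) := by
  have hS' := Measure.ae_ae_of_ae_prod (μ := (volume : Measure (KSpace n)))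
    (ν := (volume : Measure (KSpace n)))
    (kfpSemigroup_apply_ae (ε := 1) (by norm_num) ht u)
  unfold SameFunction
  filter_upwards [mixedOp_apply_ae ht U, hS'] with x hx hSx
  rw [hx]
  filter_upwards [integral_fibreOp_ae ht h x, hSx] with v hv hv'
  rw [hv, hv', kfpEval_apply, kfpEval_eq_integral_integral ht]

end Mixed

end

theorem mainTheorem6 (n : ℕ) (hn : 1 ≤ n) :
    ∃ S : ℝ → PhaseL2 n →L[ℂ] PhaseL2 n, IsFreeKFPSemigroup S ∧
      -- (a): for `t ≥ 3`, `e^{-tP₀}` extends from `L² ∩ 𝓛¹` to `𝓛¹`, with values in `𝓛^∞`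
      (∃ C : ℝ, 0 < C ∧ ∀ t : ℝ, 3 ≤ t →
        ∃ T : MixedLp n 1 →L[ℂ] MixedLp n ∞,
          (∀ (U : MixedLp n 1) (u : PhaseL2 n),
            SameFunction U u → SameFunction (T U) (S t u)) ∧
          ∀ U : MixedLp n 1, ‖T U‖ ≤ C / t ^ ((n : ℝ) / 2) * ‖U‖) ∧
      -- (b): `e^{-tP₀}` maps `𝓛^{2,s}`, a subspace of `L²`, into `𝓛^{2,-s}`
      (∀ s : ℝ, (n : ℝ) / 2 < s → ∃ C : ℝ, 0 < C ∧ ∀ t : ℝ, 3 ≤ t →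
        ∀ u : KSpace n × KSpace n → ℂ, MemLp u 2 (weightedMeasure n s) →
          ∃ hu : MemLp u 2 volume,
            eLpNorm (S t (hu.toLp u)) 2 (weightedMeasure n (-s)) ≤
              ENNReal.ofReal (C / t ^ ((n : ℝ) / 2)) *
                eLpNorm u 2 (weightedMeasure n s)) := by
  -- In (a) the constant can be `1`, since `2π · 2/3 ≥ 1`.
  refine ⟨kfpSemigroup n 1, isFreeKFPSemigroup_kfpSemigroup n, ⟨1, one_pos, fun t ht => ?_⟩,
    fun s hs => weighted_decay hs⟩
  have ht0 : 0 < t := by linarith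
  refine ⟨mixedOp ht0, fun U u h => sameFunction_mixedOp ht0 U u h, fun U => ?_⟩
  refine (norm_mixedOp_apply_le ht0 U).trans (mul_le_mul_of_nonneg_right ?_ (norm_nonneg _))
  rw [coe_heatMax ht0]
  exact heat_constant_le ht
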